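/- Let $\mathcal G$ be a connected, locally finite metric graph with countably many vertices; each edge $e$ is identified with an interval of length $l_e>0$, $\mathcal G$ carries the geodesic distance, and $\overline{\mathcal G}$ is its completion. A set of boundary vertices, containing all vertices of degree one, is fixed; the other vertices are interior, $\mathcal G_{int}$ is $\mathcal G$ without the boundary vertices, and $\partial\overline{\mathcal G}=\overline{\mathcal G}\setminus\mathcal G_{int}$. Assume that $\overline{\mathcal G}$ is compact and $\partial\overline{\mathcal G}$ is totally disconnected. Let $L^2(\mathcal G)=\bigoplus_e L^2[0,l_e]$ (real valued), and let $N_\epsilon(A)$ be the $\epsilon$-neighbourhood of $A$ in $\overline{\mathcal G}$. Let $\mathcal D_{max}$ be the set of continuous $f:\mathcal G\to\mathbb R$ with absolutely continuous derivative on each edge, with $f,f''\in L^2(\mathcal G)$, and with $\sum_{e\sim v}\partial_\nu f_e(v)=0$ at each interior vertex $v$, where $\partial_\nu f_e(v)$ is the derivative at $v$ along $e$ in the direction pointing away from $v$. *Operators.* Let $\mathcal E(0)=\{E_0,E_1,\dots,E_N\}$ be a partition of $\partial\overline{\mathcal G}$ by clopen sets ($E_n\neq\emptyset$ for $n\ge1$;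 $E_0$ may be absent, i.e. empty) such that for some $\delta>0$ the sets $N_\delta(E_n)$, $0\le n\le N$, are pairwise disjoint and have finite volume for $n\geq 1$. Given $\mathcal E(j)$, the partition $\mathcal E(j+1)$ is obtained by splitting each set of $\mathcal E(j)$ into two nonempty disjoint clopen sets, sets for which this is impossible being kept. For functions $\mathcal H=\{h_1,\dots,h_N\}$, let $\mathcal D_{\mathcal E(j),\mathcal H(j)}$ be the set of $\phi\in\mathcal D_{max}$ such that, for some $0<\epsilon<\delta$, $\phi=0$ on $N_\epsilon(E_0)$, and for each $n\ge 1$ and each $A\in\mathcal E(j)$ with $A\subseteq E_n$ there is a constant $c_A$ with $\phi=c_Ah_n$ on $N_\epsilon(A)$. Let $S_{\mathcal E(j),\mathcal H(j)}$ be the operator $-D^2$ in $L^2(\mathcal G)$ with this domain. For a densely defined nonnegative symmetric operator $S$, let $\tau$ be the closed form obtained by completing the domain of $S$ with respect to $\langle Sf,g\rangle_2+\langle f,g\rangle_2$; the Friedrichs extension of $S$ is the operator associated with $\tau$. *Boundary functions.* Let $N\ge1$ and let $\mathcal K=\{k_1,\dots,k_N\}$ satisfy, for each $n$: $k_n:\overline{\mathcal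 G}\to\mathbb R$ is continuous and harmonic (linear on each edge, with $\sum_{e\sim v}\partial_\nu k_{n,e}(v)=0$ at each interior vertex) with $\int_{\mathcal G}(k_n')^2<\infty$; $k_n$ has a constant value $C_n>0$ on $E_n$ but is not constant in any neighbourhood $N_\epsilon(E_n)$; and, for regular values $t\ne C_n$ of $k_n$ sufficiently close to $C_n$ (values attained neither at a vertex nor at a point where $k_n'=0$), $\partial_\nu k_n(x)>0$ at the points $x$ near $E_n$ with $k_n(x)=t$, where $\partial_\nu k_n(x)$ is the derivative in the direction that points into the side of the level set $\{k_n=t\}$ not containing $E_n$, i.e. into $\{k_n\ge t\}$ if $t>C_n$ and into $\{k_n\le t\}$ if $t<C_n$. *Claim.* Let $j\ge 0$ and $S_K=S_{\mathcal E(j),\mathcal K(j)}$. Let $S_H=S_{\mathcal E'(j'),\mathcal H(j')}$ where $\mathcal E'(0)$ is any partition as above (with any number $N'\ge 0$ of sets besides $E_0'$), $\mathcal E'(1),\mathcal E'(2),\dots$ are obtained from it by successive splitting, $j'\ge0$, and all functions $h_n\in\mathcal H$ are constants. Then $S_K$ and $S_H$ are densely defined, symmetric and nonnegative, and their Friedrichs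 extensions are distinct. They are told apart by their closed quadratic forms $\tau_K,\tau_H$: every $f$ in the domain of $\tau_H$ is absolutely continuous on the edges with $f'\in L^2(\mathcal G)$ and $\tau_H[f,f]=\int_{\mathcal G}(f')^2$, whereas there is an $f$ in the domain of $S_K$, absolutely continuous on the edges with $f'\in L^2(\mathcal G)$, such that $\tau_K[f,f]>\int_{\mathcal G}(f')^2$; for this $f$ it is not true that $f$ is in the domain of $\tau_H$ with $\tau_H[f,f]=\tau_K[f,f]$. -/

import Mathlib

open Set Filter Topology MeasureTheory
open scoped InnerProductSpace

noncomputable section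

/-! ### Nonnegative symmetric operators, their closed forms and Friedrichs extensions -/

namespace FormMethod

variable {H : Type*} [NormedAddCommGroup H] [InnerProductSpace ℝ H]

/-- A densely defined nonnegative symmetric operator in a real Hilbert space. -/
structure IsNonnegSymmetric (S : H →ₗ.[ℝ] H) : Prop where
  dense : Dense (S.domain : Set H)
  symm : ∀ f g : S.domain, ⟪S f, (g : H)⟫_ℝ = ⟪(f : H), S g⟫_ℝ
  nonneg : ∀ f : S.domain, 0 ≤ ⟪S f, (f : H)⟫_ℝ

/-- `u` is a sequence in the domain of `S` that is Cauchy for the inner product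
`⟪S f, g⟫ + ⟪f, g⟫` and converges to `f` in the Hilbert space: it represents `f` as an element of
the completion of the domain for that inner product. -/
def FormConverges (S : H →ₗ.[ℝ] H) (u : ℕ → S.domain) (f : H) : Prop :=
  Tendsto (fun n => (u n : H)) atTop (𝓝 f) ∧
    Tendsto (fun p : ℕ × ℕ => ⟪S (u p.1 - u p.2), ((u p.1 - u p.2 : S.domain) : H)⟫_ℝ)
      atTop (𝓝 0)

/-- The domain of the closed form `τ` generated by `S`. -/
def formDomain (S : H →ₗ.[ℝ] H) : Set H :=
  {f | ∃ u : ℕ → S.domain, FormConverges S u f}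

/-- `τ[f, g] = a` for the closed form `τ` generated by `S`: both vectors are in the form domain, and
`⟪S uₙ, vₙ⟫ → a` for all sequences that represent them. -/
def IsFormValue (S : H →ₗ.[ℝ] H) (f g : H) (a : ℝ) : Prop :=
  f ∈ formDomain S ∧ g ∈ formDomain S ∧
    ∀ u v : ℕ → S.domain, FormConverges S u f → FormConverges S v g →
      Tendsto (fun n => ⟪S (u n), (v n : H)⟫_ℝ) atTop (𝓝 a)

/-- `L` is the Friedrichs extension of `S`, the operator associated with the closed form `τ`:
`f` is in the domain of `L` with `L f = w` exactly if `f` is in the form domain and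
`τ[f, g] = ⟪w, g⟫` for all `g` in the form domain. -/
def IsFriedrichsExtension (S L : H →ₗ.[ℝ] H) : Prop :=
  ∀ f w : H, (f, w) ∈ L.graph ↔
    f ∈ formDomain S ∧ ∀ g ∈ formDomain S, IsFormValue S f g ⟪w, g⟫_ℝ

end FormMethod

/-! ### Metric graphs -/

/-- A connected, locally finite metric graph with countably many vertices. The edge `e` is identified
with the interval `[0, len e]`, with `0` at `src e` and `len e` at `tgt e`; the orientation plays no
role. Multiple edges and loops are allowed. The set `bdry` of boundary vertices contains all vertices
of degree one. -/
structure MetricGraph (V E : Type*) where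
  src : E → V
  tgt : E → V
  len : E → ℝ
  len_pos : ∀ e, 0 < len e
  countable_vertices : Countable V
  finite_src : ∀ v, {e | src e = v}.Finite
  finite_tgt : ∀ v, {e | tgt e = v}.Finite
  connected : ∀ u v, Relation.ReflTransGen
    (fun a b => ∃ e, (src e = a ∧ tgt e = b) ∨ (src e = b ∧ tgt e = a)) u v
  bdry : Set V
  degree_one_mem : ∀ v, (finite_src v).toFinset.card + (finite_tgt v).toFinset.card = 1 → v ∈ bdry

namespace MetricGraph

variable {V E : Type*} (G : MetricGraph V E)

/-- The points of the metric graph: the vertices and the points inside the edges. -/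
inductive Point (G : MetricGraph V E) : Type _
  | vert (v : V) : Point G
  | inner (e : E) (s : ℝ) (hs : s ∈ Ioo 0 (G.len e)) : Point G

open Classical in
/-- The point of the edge `e` with coordinate `s ∈ [0, len e]` (other coordinates are moved to the
nearest endpoint). -/
def pt (e : E) (s : ℝ) : G.Point :=
  if h : s ∈ Ioo 0 (G.len e) then Point.inner e s h
  else if s ≤ 0 then Point.vert (G.src e) else Point.vert (G.tgt e)

/-- `PathLength p q L`: there is a path of length `L` from `p` to `q`, which consists of finitely
many segments, each of them running inside one edge. -/
inductive PathLength (G : MetricGraph V E) : G.Point → G.Point → ℝ → Prop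
  | nil (p : G.Point) : PathLength G p p 0
  | step (p : G.Point) (L : ℝ) (e : E) (s t : ℝ) (hs : s ∈ Icc 0 (G.len e))
      (ht : t ∈ Icc 0 (G.len e)) (h : PathLength G p (G.pt e s) L) :
      PathLength G p (G.pt e t) (L + |s - t|)

theorem PathLength.nonneg {p q : G.Point} {L : ℝ} (h : G.PathLength p q L) : 0 ≤ L := by
  induction h with
  | nil => exact le_rfl
  | step L e s t hs ht h ih => positivity

theorem PathLength.trans {p q r : G.Point} {L M : ℝ} (h : G.PathLength p q L)
    (h' : G.PathLength q r M) : G.PathLength p r (L + M) := by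
  induction h' with
  | nil => simpa using h
  | step M e s t hs ht _ ih =>
    rw [← add_assoc]
    exact PathLength.step p _ e s t hs ht ih

theorem PathLength.single (e : E) {s t : ℝ} (hs : s ∈ Icc 0 (G.len e)) (ht : t ∈ Icc 0 (G.len e)) :
    G.PathLength (G.pt e s) (G.pt e t) |s - t| := by
  simpa using PathLength.step _ 0 e s t hs ht (PathLength.nil _)

theorem PathLength.symm {p q : G.Point} {L : ℝ} (h : G.PathLength p q L) : G.PathLength q p L := by
  induction h with
  | nil => exact PathLength.nil _
  | step L e s t hs ht _ ih =>
    rw [add_comm, abs_sub_comm]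
    exact (PathLength.single G e ht hs).trans G ih

theorem pt_of_mem (e : E) {s : ℝ} (hs : s ∈ Ioo 0 (G.len e)) : G.pt e s = Point.inner e s hs := by
  simp [pt, hs.1, hs.2]

theorem pt_zero (e : E) : G.pt e 0 = Point.vert (G.src e) := by
  simp [pt]

theorem pt_len (e : E) : G.pt e (G.len e) = Point.vert (G.tgt e) := by
  simp [pt, G.len_pos e]

theorem exists_pathLength_vert (u v : V) :
    ∃ L, G.PathLength (Point.vert u) (Point.vert v) L := by
  have h0 : ∀ e, (0 : ℝ) ∈ Icc 0 (G.len e) := fun e => ⟨le_rfl, (G.len_pos e).le⟩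
  have h1 : ∀ e, G.len e ∈ Icc 0 (G.len e) := fun e => ⟨(G.len_pos e).le, le_rfl⟩
  induction G.connected u v with
  | refl => exact ⟨0, PathLength.nil _⟩
  | tail _ hbc ih =>
    obtain ⟨L, hL⟩ := ih
    obtain ⟨e, ⟨rfl, rfl⟩ | ⟨rfl, rfl⟩⟩ := hbc
    · have := PathLength.single G e (h0 e) (h1 e)
      rw [pt_zero, pt_len] at this
      exact ⟨_, hL.trans G this⟩
    · have := PathLength.single G e (h1 e) (h0 e)
      rw [pt_zero, pt_len] at this
      exact ⟨_, hL.trans G this⟩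

theorem exists_pathLength (p q : G.Point) : ∃ L, G.PathLength p q L := by
  have key : ∀ p : G.Point, ∃ v L, G.PathLength p (Point.vert v) L := by
    rintro (v | ⟨e, s, hs⟩)
    · exact ⟨v, 0, PathLength.nil _⟩
    · have := PathLength.single G e (Ioo_subset_Icc_self hs) ⟨le_rfl, (G.len_pos e).le⟩
      rw [pt_zero, pt_of_mem G e hs] at this
      exact ⟨_, _, this⟩
  obtain ⟨u, L, hL⟩ := key p
  obtain ⟨v, M, hM⟩ := key q
  obtain ⟨K, hK⟩ := G.exists_pathLength_vert u v
  exact ⟨_, (hL.trans G hK).trans G (hM.symm G)⟩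

/-- The geodesic distance: the infimum of the lengths of paths. -/
instance : PseudoMetricSpace G.Point where
  dist p q := sInf {L | G.PathLength p q L}
  dist_self p := by
    refine le_antisymm (csInf_le ⟨0, fun L hL => PathLength.nonneg G hL⟩ (PathLength.nil p)) ?_
    exact Real.sInf_nonneg fun L hL => PathLength.nonneg G hL
  dist_comm p q := by
    congr 1
    ext L
    exact ⟨PathLength.symm G, PathLength.symm G⟩
  dist_triangle p q r := by
    have hb : ∀ p q : G.Point, BddBelow {L | G.PathLength p q L} :=
      fun p q => ⟨0, fun L hL => PathLength.nonneg G hL⟩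
    refine le_of_forall_pos_le_add fun ε hε => ?_
    have hn : ∀ p q : G.Point, {L | G.PathLength p q L}.Nonempty := G.exists_pathLength
    obtain ⟨L, hL, hL'⟩ := Real.lt_sInf_add_pos (hn p q) (half_pos hε)
    obtain ⟨M, hM, hM'⟩ := Real.lt_sInf_add_pos (hn q r) (half_pos hε)
    have := csInf_le (hb p r) (PathLength.trans G hL hM)
    linarith

/-- The completion of the metric graph. -/
abbrev Bar : Type _ := UniformSpace.Completion G.Point

/-- The graph interior: all points except the boundary vertices. -/
def interiorPoints : Set G.Point := {p | ∀ v ∈ G.bdry, p ≠ Point.vert v}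

/-- The boundary of the completion: the complement of the graph interior. -/
def bdryBar : Set G.Bar := ((↑) '' G.interiorPoints)ᶜ

/-- `A` is a clopen subset of the boundary of the completion. -/
def IsBdryClopen (A : Set G.Bar) : Prop :=
  A ⊆ G.bdryBar ∧ IsClopen ((↑) ⁻¹' A : Set G.bdryBar)

/-- The trace on the graph of the `ε`-neighbourhood of `A` in the completion. -/
def nbhd (ε : ℝ) (A : Set G.Bar) : Set G.Point := {x | (x : G.Bar) ∈ Metric.thickening ε A}

/-! ### Lebesgue measure, functions on the edges, and `L²` -/

/-- A set of points is measurable if its trace on every edge is a Borel set. -/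
instance : MeasurableSpace G.Point := ⨅ e, MeasurableSpace.map (G.pt e) (borel ℝ)

/-- Lebesgue measure on the graph, the sum of the Lebesgue measures of the edges. -/
def vol : Measure G.Point :=
  Measure.sum fun e => (volume.restrict (Ioo 0 (G.len e))).map (G.pt e)

/-- `L²(G)`, the real Hilbert space of square integrable functions. -/
abbrev L2 : Type _ := Lp ℝ 2 G.vol

variable {G}

/-- The derivative of `f` along the edge `e` (one-sided at the endpoints). -/
def edgeDeriv (f : G.Point → ℝ) (e : E) (s : ℝ) : ℝ :=
  derivWithin (fun t => f (G.pt e t)) (Icc 0 (G.len e)) s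

/-- The second derivative of `f` along the edge `e`. -/
def edgeDeriv2 (f : G.Point → ℝ) (e : E) (s : ℝ) : ℝ := deriv (edgeDeriv f e) s

/-- The function on the graph with the given edge components; the vertices, which have measure zero,
get the value `0`. -/
def ofEdges (u : E → ℝ → ℝ) : G.Point → ℝ
  | Point.vert _ => 0
  | Point.inner e s _ => u e s

/-- `f'` as a function on the graph. -/
def D1 (f : G.Point → ℝ) : G.Point → ℝ := ofEdges (edgeDeriv f)

/-- `f''` as a function on the graph. -/
def D2 (f : G.Point → ℝ) : G.Point → ℝ := ofEdges (edgeDeriv2 f)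

/-- The sum of the derivatives of `f` at the vertex `v`, along the incident edges, in coordinates
pointing away from `v`. -/
def vertexFlux (f : G.Point → ℝ) (v : V) : ℝ :=
  ∑ e ∈ (G.finite_src v).toFinset, edgeDeriv f e 0 -
    ∑ e ∈ (G.finite_tgt v).toFinset, edgeDeriv f e (G.len e)

variable (G)

/-- The maximal domain: continuous functions on the graph with absolutely continuous derivative on
every (closed) edge, with `f` and `f''` square integrable, and with `∑ ∂_ν f_e(v) = 0` at every
interior vertex `v`. -/
structure IsDmax (f : G.Point → ℝ) : Prop where
  cont : Continuous f
  diff : ∀ e, DifferentiableOn ℝ (fun t => f (G.pt e t)) (Icc 0 (G.len e))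
  ac : ∀ e, AbsolutelyContinuousOnInterval (edgeDeriv f e) 0 (G.len e)
  memLp : MemLp f 2 G.vol
  memLp_D2 : MemLp (D2 f) 2 G.vol
  kirchhoff : ∀ v ∉ G.bdry, vertexFlux f v = 0

/-! ### Harmonic functions -/

/-- Harmonic functions on the completion: continuous, `f'' = 0` on every edge, and `∑ ∂_ν f_e(v) = 0`
at every interior vertex. -/
structure IsHarmonic (f : G.Bar → ℝ) : Prop where
  cont : Continuous f
  affine : ∀ e, ∃ a b : ℝ, ∀ s ∈ Icc 0 (G.len e), f (G.pt e s : G.Point) = a + b * s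
  kirchhoff : ∀ v ∉ G.bdry, vertexFlux (fun x : G.Point => f x) v = 0

/-- `f` is absolutely continuous on every edge and `f'` is square integrable. -/
def HasFiniteEnergy (f : G.Point → ℝ) : Prop :=
  (∀ e, AbsolutelyContinuousOnInterval (fun t => f (G.pt e t)) 0 (G.len e)) ∧ MemLp (D1 f) 2 G.vol

/-- Finite energy harmonic functions. -/
def IsFiniteEnergyHarmonic (f : G.Bar → ℝ) : Prop :=
  G.IsHarmonic f ∧ G.HasFiniteEnergy fun x => f x

/-- `t` is a regular value of `k`: it is a value, it is not attained at a vertex, and `k' ≠ 0` at the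
points where it is attained. -/
def IsRegularValue (k : G.Bar → ℝ) (t : ℝ) : Prop :=
  (∃ x : G.Point, k x = t) ∧ (∀ v, k (Point.vert v : G.Point) ≠ t) ∧
    ∀ e, ∀ s ∈ Ioo 0 (G.len e), k (G.pt e s : G.Point) = t →
      edgeDeriv (fun x : G.Point => k x) e s ≠ 0

/-- The part of the graph on the side of the level set `{k = t}` that does not contain the set where
`k` has the value `C`: it is `{k ≥ t}` if `t > C`, and `{k ≤ t}` if `t < C`. -/
def farSide (k : G.Bar → ℝ) (C t : ℝ) : Set G.Point := {y | (k y - t) * (C - t) ≤ 0}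

/-- The harmonic functions `k` that serve as Robin type boundary conditions at `A`:
`k` is a finite energy harmonic function on the completion with a constant value `C > 0` on `A`, and
on the level sets `{k = t}` near `A`, for regular values `t` close to `C`, the derivative
`∂_ν k` is positive. Here a point `x` of a level set is regarded as a boundary vertex of the graph
which the level set cuts off from `A`, so `∂_ν k (x)` is the derivative of `k` in the direction
`σ = ±1` of the edge in which this graph continues at `x`. The function is not constant near `A`
(so there are such level sets). -/
structure IsRobinFunction (A : Set G.Bar) (k : G.Bar → ℝ) (C : ℝ) : Prop where
  pos : 0 < C
  const : ∀ z ∈ A, k z = C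
  finite_energy : G.IsFiniteEnergyHarmonic k
  normal_deriv_pos : ∃ ε > 0, ∃ η > 0, ∀ t, t ≠ C → |t - C| < η → G.IsRegularValue k t →
    ∀ e, ∀ s ∈ Ioo 0 (G.len e), G.pt e s ∈ G.nbhd ε A → k (G.pt e s : G.Point) = t →
      ∀ σ : ℝ, (σ = 1 ∨ σ = -1) → (∀ᶠ r in 𝓝[>] (0 : ℝ), G.pt e (s + σ * r) ∈ G.farSide k C t) →
        0 < σ * edgeDeriv (fun x : G.Point => k x) e s
  nonconst : ∀ ε > 0, ∃ x ∈ G.nbhd ε A, k x ≠ C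

/-! ### Partitions of the boundary and the operators `-D²` -/

/-- The initial partition `E₀, E 0, …, E (N - 1)` of the boundary by clopen sets, with disjoint
`δ`-neighbourhoods that have finite volume except perhaps the one of `E₀`. The set `E₀` may be absent,
i.e. empty. -/
structure BoundaryPartition (N : ℕ) where
  E₀ : Set G.Bar
  E : Fin N → Set G.Bar
  δ : ℝ
  δ_pos : 0 < δ
  clopen₀ : G.IsBdryClopen E₀
  clopen : ∀ n, G.IsBdryClopen (E n)
  nonempty : ∀ n, (E n).Nonempty
  cover : E₀ ∪ ⋃ n, E n = G.bdryBar
  disjoint₀ : ∀ n, Disjoint (Metric.thickening δ E₀) (Metric.thickening δ (E n))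
  disjoint : ∀ m n, m ≠ n → Disjoint (Metric.thickening δ (E m)) (Metric.thickening δ (E n))
  finite_vol : ∀ n, G.vol (G.nbhd δ (E n)) < ⊤

/-- `A` is the disjoint union of the nonempty clopen sets `B` and `C`. -/
def IsSplitting (A B C : Set G.Bar) : Prop :=
  G.IsBdryClopen B ∧ G.IsBdryClopen C ∧ B.Nonempty ∧ C.Nonempty ∧ Disjoint B C ∧ B ∪ C = A

/-- `Q` arises from `P` by splitting every set of `P` into two nonempty disjoint clopen sets, except
for those sets that cannot be split, which are kept. -/
def SplitStep (P Q : Set (Set G.Bar)) : Prop :=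
  ∃ B C : Set G.Bar → Set G.Bar,
    (∀ A ∈ P, G.IsSplitting A (B A) (C A) ∨
      ((∀ B' C', ¬ G.IsSplitting A B' C') ∧ B A = A ∧ C A = A)) ∧
    Q = B '' P ∪ C '' P

variable {G}

/-- `P 0, P 1, P 2, …` is a sequence of partitions obtained by successive splitting from the initial
partition. -/
def IsPartitionSequence {N : ℕ} (𝓑 : G.BoundaryPartition N) (P : ℕ → Set (Set G.Bar)) : Prop :=
  P 0 = {A | A.Nonempty ∧ (A = 𝓑.E₀ ∨ ∃ n, A = 𝓑.E n)} ∧ ∀ j, G.SplitStep (P j) (P (j + 1))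

/-- Membership in the domain of `-D²` given by the partition `P` (which refines the initial partition)
and the functions `h n`: near `E₀` the function `φ` vanishes, and near each set `A ∈ P` that is
contained in `E n` it is a constant multiple of `h n`. -/
def IsInDomain {N : ℕ} (𝓑 : G.BoundaryPartition N) (P : Set (Set G.Bar))
    (h : Fin N → G.Point → ℝ) (φ : G.Point → ℝ) : Prop :=
  G.IsDmax φ ∧ ∃ ε, 0 < ε ∧ ε < 𝓑.δ ∧ (∀ x ∈ G.nbhd ε 𝓑.E₀, φ x = 0) ∧
    ∀ n, ∀ A ∈ P, A ⊆ 𝓑.E n → ∃ c : ℝ, ∀ x ∈ G.nbhd ε A, φ x = c * h n x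

theorem measurable_pt (e : E) : Measurable (G.pt e) := by
  rw [BorelSpace.measurable_eq (α := ℝ)]
  exact measurable_iff_le_map.2 (iInf_le _ e)

theorem measurable_point_iff (f : G.Point → ℝ) :
    Measurable f ↔ ∀ e, Measurable fun s => f (G.pt e s) := by
  refine ⟨fun h e => h.comp (measurable_pt e), fun h s hs => ?_⟩
  refine (MeasurableSpace.measurableSet_iInf).2 fun e => ?_
  have := h e hs
  rwa [BorelSpace.measurable_eq (α := ℝ)] at this

theorem measurable_ofEdges {u : E → ℝ → ℝ} (hu : ∀ e, Measurable (u e)) :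
    Measurable (ofEdges u : G.Point → ℝ) := by
  classical
  refine (measurable_point_iff _).2 fun e => ?_
  have : (fun s => (ofEdges u : G.Point → ℝ) (G.pt e s)) = (Ioo 0 (G.len e)).indicator (u e) := by
    ext s
    by_cases hs : s ∈ Ioo 0 (G.len e)
    · rw [pt_of_mem G e hs, indicator_of_mem hs]; rfl
    · rw [indicator_of_notMem hs, pt, dif_neg hs]
      split_ifs <;> rfl
  rw [this]
  exact (hu e).indicator measurableSet_Ioo

theorem measurable_D2 (f : G.Point → ℝ) : Measurable (D2 f) :=
  measurable_ofEdges fun _ => measurable_deriv _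

theorem countable_edges (G : MetricGraph V E) : Countable E := by
  have := G.countable_vertices
  have h : (⋃ v, {e | G.src e = v}) = univ := by ext e; simp
  exact countable_univ_iff.1 (h ▸ countable_iUnion fun v => (G.finite_src v).countable)

theorem ae_vol_of_edges {p : G.Point → Prop} (hp : MeasurableSet {x | p x})
    (h : ∀ e, ∀ᵐ s : ℝ, s ∈ Ioo 0 (G.len e) → p (G.pt e s)) : ∀ᵐ x ∂G.vol, p x := by
  have := G.countable_edges
  refine Measure.ae_sum_iff.2 fun e => ?_
  rw [ae_map_iff (measurable_pt e).aemeasurable hp]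
  exact (ae_restrict_iff' measurableSet_Ioo).2 (h e)

theorem ae_edge_of_ae_vol {p : G.Point → Prop} (h : ∀ᵐ x ∂G.vol, p x) (e : E) :
    ∀ᵐ s : ℝ, s ∈ Ioo 0 (G.len e) → p (G.pt e s) := by
  have h1 := ae_mono (Measure.le_sum
    (fun e => (volume.restrict (Ioo 0 (G.len e))).map (G.pt e)) e) h
  exact (ae_restrict_iff' measurableSet_Ioo).1 (ae_of_ae_map (measurable_pt e).aemeasurable h1)

theorem edgeDeriv_add {f g : G.Point → ℝ} (hf : G.IsDmax f) (hg : G.IsDmax g) (e : E) {s : ℝ}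
    (hs : s ∈ Icc 0 (G.len e)) : edgeDeriv (f + g) e s = edgeDeriv f e s + edgeDeriv g e s :=
  derivWithin_add (hf.diff e s hs) (hg.diff e s hs)

theorem edgeDeriv_smul (c : ℝ) (f : G.Point → ℝ) (e : E) (s : ℝ) :
    edgeDeriv (c • f) e s = c * edgeDeriv f e s :=
  derivWithin_const_smul_field c _

theorem D2_smul (c : ℝ) (f : G.Point → ℝ) : D2 (c • f) = c • D2 f := by
  funext x
  rcases x with v | ⟨e, s, hs⟩
  · simp [D2, ofEdges]
  · have : edgeDeriv (c • f) e = fun s => c * edgeDeriv f e s := funext (edgeDeriv_smul c f e)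
    simp [D2, ofEdges, edgeDeriv2, this, deriv_const_mul_field]

theorem D2_add {f g : G.Point → ℝ} (hf : G.IsDmax f) (hg : G.IsDmax g) :
    D2 (f + g) =ᵐ[G.vol] D2 f + D2 g := by
  refine ae_vol_of_edges
    (measurableSet_eq_fun (measurable_D2 _) ((measurable_D2 f).add (measurable_D2 g))) fun e => ?_
  have huI : uIcc 0 (G.len e) = Icc 0 (G.len e) := uIcc_of_le (G.len_pos e).le
  filter_upwards [(hf.ac e).ae_differentiableAt, (hg.ac e).ae_differentiableAt] with s h1 h2 hs
  have hs' : s ∈ Icc 0 (G.len e) := Ioo_subset_Icc_self hs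
  have h1 := h1 (huI ▸ hs')
  have h2 := h2 (huI ▸ hs')
  have heq : edgeDeriv (f + g) e =ᶠ[𝓝 s] edgeDeriv f e + edgeDeriv g e := by
    filter_upwards [Icc_mem_nhds hs.1 hs.2] with t ht
    exact edgeDeriv_add hf hg e ht
  rw [pt_of_mem G e hs]
  simp only [D2, ofEdges, edgeDeriv2, Pi.add_apply]
  rw [heq.deriv_eq]
  exact deriv_add h1 h2

theorem ac_congr {f g : ℝ → ℝ} {a b : ℝ} (hf : AbsolutelyContinuousOnInterval f a b)
    (h : ∀ s ∈ uIcc a b, g s = f s) : AbsolutelyContinuousOnInterval g a b := by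
  rw [absolutelyContinuousOnInterval_iff] at hf ⊢
  intro ε hε
  obtain ⟨δ, hδ, H⟩ := hf ε hε
  refine ⟨δ, hδ, fun I hI hlt => ?_⟩
  convert H I hI hlt using 1
  refine Finset.sum_congr rfl fun i hi => ?_
  rw [h _ (hI.1 i hi).1, h _ (hI.1 i hi).2]

theorem IsDmax.add {f g : G.Point → ℝ} (hf : G.IsDmax f) (hg : G.IsDmax g) :
    G.IsDmax (f + g) where
  cont := hf.cont.add hg.cont
  diff e := (hf.diff e).add (hg.diff e)
  ac e := by
    refine ac_congr ((hf.ac e).add (hg.ac e)) fun s hs => ?_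
    rw [uIcc_of_le (G.len_pos e).le] at hs
    exact edgeDeriv_add hf hg e hs
  memLp := hf.memLp.add hg.memLp
  memLp_D2 := (memLp_congr_ae (D2_add hf hg)).2 (hf.memLp_D2.add hg.memLp_D2)
  kirchhoff v hv := by
    have h0 : ∀ e, edgeDeriv (f + g) e 0 = edgeDeriv f e 0 + edgeDeriv g e 0 := fun e =>
      edgeDeriv_add hf hg e ⟨le_rfl, (G.len_pos e).le⟩
    have h1 : ∀ e, edgeDeriv (f + g) e (G.len e) =
        edgeDeriv f e (G.len e) + edgeDeriv g e (G.len e) := fun e =>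
      edgeDeriv_add hf hg e ⟨(G.len_pos e).le, le_rfl⟩
    have hf' := hf.kirchhoff v hv
    have hg' := hg.kirchhoff v hv
    simp only [vertexFlux, h0, h1, Finset.sum_add_distrib] at hf' hg' ⊢
    linarith

theorem IsDmax.smul {f : G.Point → ℝ} (c : ℝ) (hf : G.IsDmax f) : G.IsDmax (c • f) where
  cont := hf.cont.const_smul c
  diff e := (hf.diff e).const_smul c
  ac e := ac_congr ((hf.ac e).const_mul c) fun s _ => edgeDeriv_smul c f e s
  memLp := hf.memLp.const_smul c
  memLp_D2 := D2_smul c f ▸ hf.memLp_D2.const_smul c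
  kirchhoff v hv := by
    have hf' := hf.kirchhoff v hv
    simp only [vertexFlux, edgeDeriv_smul, ← Finset.mul_sum, ← mul_sub] at hf' ⊢
    rw [hf', mul_zero]

theorem edgeDeriv_zero (e : E) (s : ℝ) : edgeDeriv (0 : G.Point → ℝ) e s = 0 := by
  simpa using edgeDeriv_smul (0 : ℝ) (0 : G.Point → ℝ) e s

theorem IsDmax.zero : G.IsDmax (0 : G.Point → ℝ) where
  cont := continuous_const
  diff e := differentiableOn_const 0
  ac e := by
    have : edgeDeriv (0 : G.Point → ℝ) e = fun _ => 0 := funext (edgeDeriv_zero e)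
    rw [this]
    exact (contDiff_const.contDiffOn).absolutelyContinuousOnInterval
  memLp := MemLp.zero
  memLp_D2 := by
    have : D2 (0 : G.Point → ℝ) = 0 := by simpa using D2_smul (0 : ℝ) (0 : G.Point → ℝ)
    rw [this]
    exact MemLp.zero
  kirchhoff v _ := by simp [vertexFlux, edgeDeriv_zero]

theorem nbhd_mono {ε ε' : ℝ} (h : ε ≤ ε') (A : Set G.Bar) : G.nbhd ε A ⊆ G.nbhd ε' A :=
  fun _ hx => Metric.thickening_mono h A hx

/-- The domain of `-D²` as a space of functions on the graph. -/
def functionDomain {N : ℕ} (𝓑 : G.BoundaryPartition N) (P : Set (Set G.Bar))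
    (h : Fin N → G.Point → ℝ) : Submodule ℝ (G.Point → ℝ) where
  carrier := {φ | IsInDomain 𝓑 P h φ}
  zero_mem' := ⟨IsDmax.zero, 𝓑.δ / 2, half_pos 𝓑.δ_pos, half_lt_self 𝓑.δ_pos, fun _ _ => rfl,
    fun _ _ _ _ => ⟨0, fun _ _ => by simp⟩⟩
  add_mem' := by
    rintro φ ψ ⟨hφ, ε, hε, hεδ, h0, h1⟩ ⟨hψ, ε', hε', hεδ', h0', h1'⟩
    refine ⟨hφ.add hψ, min ε ε', lt_min hε hε', lt_of_le_of_lt (min_le_left _ _) hεδ,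
      fun x hx => ?_, fun n A hA hAn => ?_⟩
    · simp [h0 x (nbhd_mono (min_le_left _ _) _ hx), h0' x (nbhd_mono (min_le_right _ _) _ hx)]
    · obtain ⟨c, hc⟩ := h1 n A hA hAn
      obtain ⟨c', hc'⟩ := h1' n A hA hAn
      refine ⟨c + c', fun x hx => ?_⟩
      simp only [Pi.add_apply, hc x (nbhd_mono (min_le_left _ _) _ hx),
        hc' x (nbhd_mono (min_le_right _ _) _ hx)]
      ring
  smul_mem' := by
    rintro a φ ⟨hφ, ε, hε, hεδ, h0, h1⟩
    refine ⟨hφ.smul a, ε, hε, hεδ, fun x hx => ?_, fun n A hA hAn => ?_⟩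
    · simp [h0 x hx]
    · obtain ⟨c, hc⟩ := h1 n A hA hAn
      refine ⟨a * c, fun x hx => ?_⟩
      simp only [Pi.smul_apply, smul_eq_mul, hc x hx]
      ring

theorem IsDmax.D2_eq_zero {φ : G.Point → ℝ} (hD : G.IsDmax φ) (h0 : φ =ᵐ[G.vol] 0) :
    D2 φ = 0 := by
  have hzero : ∀ e, EqOn (fun s => φ (G.pt e s)) (fun _ => 0) (Icc 0 (G.len e)) := by
    intro e
    have hc := (hD.diff e).continuousOn
    have hIoo : EqOn (fun s => φ (G.pt e s)) (fun _ => 0) (Ioo 0 (G.len e)) := by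
      refine Measure.eqOn_open_of_ae_eq (μ := volume) ?_ isOpen_Ioo
        (hc.mono Ioo_subset_Icc_self) continuousOn_const
      exact (ae_restrict_iff' measurableSet_Ioo).2 (ae_edge_of_ae_vol h0 e)
    exact hIoo.of_subset_closure hc continuousOn_const Ioo_subset_Icc_self
      (closure_Ioo (G.len_pos e).ne).ge
  have hd : ∀ e, ∀ s ∈ Icc 0 (G.len e), edgeDeriv φ e s = 0 := by
    intro e s hs
    rw [edgeDeriv, derivWithin_congr (hzero e) (hzero e hs)]
    simp
  funext x
  rcases x with v | ⟨e, s, hs⟩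
  · rfl
  · have : edgeDeriv φ e =ᶠ[𝓝 s] fun _ => 0 := by
      filter_upwards [Icc_mem_nhds hs.1 hs.2] with t ht using hd e t ht
    change deriv _ s = 0
    rw [this.deriv_eq, deriv_const]

section Operator

variable {N : ℕ} (𝓑 : G.BoundaryPartition N) (P : Set (Set G.Bar)) (h : Fin N → G.Point → ℝ)

/-- The class in `L²` of a function in the domain. -/
def classMap : functionDomain 𝓑 P h →ₗ[ℝ] G.L2 where
  toFun φ := φ.2.1.memLp.toLp (φ : G.Point → ℝ)
  map_add' _ _ := rfl
  map_smul' _ _ := rfl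

/-- The map `φ ↦ -φ''` into `L²`. -/
def negD2 : functionDomain 𝓑 P h →ₗ[ℝ] G.L2 where
  toFun φ := -(φ.2.1.memLp_D2.toLp (D2 (φ : G.Point → ℝ)))
  map_add' φ ψ := by
    rw [← neg_add, ← MemLp.toLp_add]
    exact congrArg _ ((MemLp.toLp_eq_toLp_iff _ _).2 (D2_add φ.2.1 ψ.2.1))
  map_smul' c φ := by
    rw [RingHom.id_apply, smul_neg, ← MemLp.toLp_const_smul]
    exact congrArg _ ((MemLp.toLp_eq_toLp_iff _ _).2 (ae_of_all _ (congrFun (D2_smul c _))))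

theorem classMap_apply (φ : functionDomain 𝓑 P h) :
    classMap 𝓑 P h φ = φ.2.1.memLp.toLp (φ : G.Point → ℝ) := rfl

theorem negD2_apply (φ : functionDomain 𝓑 P h) :
    negD2 𝓑 P h φ = -(φ.2.1.memLp_D2.toLp (D2 (φ : G.Point → ℝ))) := rfl

theorem toLp_eq_zero_iff' {f : G.Point → ℝ} (hf : MemLp f 2 G.vol) :
    hf.toLp f = 0 ↔ f =ᵐ[G.vol] 0 := by
  rw [← MemLp.toLp_zero (MemLp.zero : MemLp (0 : G.Point → ℝ) 2 G.vol), MemLp.toLp_eq_toLp_iff]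

theorem ker_classMap_le : LinearMap.ker (classMap 𝓑 P h) ≤ LinearMap.ker (negD2 𝓑 P h) := by
  intro φ hφ
  rw [LinearMap.mem_ker, classMap_apply, toLp_eq_zero_iff'] at hφ
  rw [LinearMap.mem_ker, negD2_apply, neg_eq_zero, toLp_eq_zero_iff']
  exact ae_of_all _ (congrFun (IsDmax.D2_eq_zero φ.2.1 hφ))

/-- The operator `-D²` in `L²(G)`: its domain consists of the classes of the functions `φ` in the
domain given by the partition `P` and the functions `h n`, and it maps the class of `φ` to the class
of `-φ''`. -/
def operator : G.L2 →ₗ.[ℝ] G.L2 where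
  domain := LinearMap.range (classMap 𝓑 P h)
  toFun := ((LinearMap.ker (classMap 𝓑 P h)).liftQ (negD2 𝓑 P h) (ker_classMap_le 𝓑 P h)).comp
    (classMap 𝓑 P h).quotKerEquivRange.symm.toLinearMap

theorem operator_apply (φ : functionDomain 𝓑 P h) :
    operator 𝓑 P h ⟨classMap 𝓑 P h φ, LinearMap.mem_range_self _ φ⟩ = negD2 𝓑 P h φ := by
  have h1 := (classMap 𝓑 P h).quotKerEquivRange_symm_apply_image φ (LinearMap.mem_range_self _ φ)
  exact congrArg ((LinearMap.ker (classMap 𝓑 P h)).liftQ (negD2 𝓑 P h)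
    (ker_classMap_le 𝓑 P h)) h1

end Operator

/-- `f ∈ L²(G)` is the class of a function `F` of finite energy, and `∫ (F')² = q`. -/
def HasEnergy (f : G.L2) (q : ℝ) : Prop :=
  ∃ F : G.Point → ℝ, f =ᵐ[G.vol] F ∧ G.HasFiniteEnergy F ∧ ∫ x, D1 F x ^ 2 ∂G.vol = q

end MetricGraph

end

/-! Near each part `A` of the boundary partition a function `φ` in the domain is a multiple `c_A h`
of a harmonic function. Integration by parts therefore gives the energy plus a boundary term: ⟪-φ'',
φ⟫ = ∫ (φ')² + ∑_A c_A² · `excess h χ_A`, where `excess h χ` is -∫ h'(hχ)' and `χ_A` is a cutoff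
function at `A` (`integral_D2_mul_of_family`). Formally the excess is the boundary value of `h`
times the flux of `h` from `A` into the graph.

For constants the excess is zero, so the form of `S_H` is the energy. Form-Cauchy sequences then
have `L²`-convergent derivatives, and since differentiation is closed the identity survives in the
form domain (`exists_hasEnergy`).

For a Robin function `k` with boundary value `C > 0` the excess is nonnegative, and it is positive
if `k` is not constant near `A`. The sign condition on regular level sets forces `k ≥ C` near `A`
(`IsRobinFunction.exists_ge`). The flux itself need not exist pointwise on `A`, so it is estimated
by testing against a truncation `T(k)χ`. Here `T` is 0 up to `C + s₁`, the identity above `C + s₀`,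
and linear in between. This test function vanishes near the boundary, hence ∫ k'(T(k)χ)' = 0, and
the excess becomes ∫ k'((T(k)χ)' - (kχ)'). For small `s₀` the product k'χ' vanishes where `k < C +
s₀`, so only χ(k')²(T' - 1) is left. Because `T` climbs from 0 to `C + s₀` over a width below `s₀`,
T' - 1 is at least `C / s₀` in the band. The region `k ≤ C + s₁`, where T' - 1 is -1, contributes
nothing in the limit `s₁ → 0`, since k' = 0 wherever `χ ≠ 0` and `k ≤ C`
(`IsCutoff.exists_excess_ge`).

Hence `f = kχ`, with `χ` a cutoff function at a part where `k` is not constant, is in the domain of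
`S_K` and its form value exceeds its energy (`exists_energy_lt`), which no form value of `S_H` does.
A Friedrichs extension extends its operator, so a common extension would make the two forms agree at
`f` (`isFormValue_of_friedrichs_eq`), a contradiction. -/

noncomputable section

/-! ### Closability of the form of a nonnegative symmetric operator -/

namespace FormMethod

variable {H : Type*} [NormedAddCommGroup H] [InnerProductSpace ℝ H] {S : H →ₗ.[ℝ] H}

/-- The Cauchy–Schwarz inequality for the form of a nonnegative symmetric operator. -/
theorem IsNonnegSymmetric.sq_le (hS : IsNonnegSymmetric S) (u v : S.domain) :
    ⟪S u, (v : H)⟫_ℝ ^ 2 ≤ ⟪S u, (u : H)⟫_ℝ * ⟪S v, (v : H)⟫_ℝ := by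
  have h : ∀ t : ℝ, 0 ≤ ⟪S v, (v : H)⟫_ℝ * (t * t) + 2 * ⟪S u, (v : H)⟫_ℝ * t
      + ⟪S u, (u : H)⟫_ℝ := by
    intro t
    have h1 := hS.nonneg (u + t • v)
    have h2 : ⟪S v, (u : H)⟫_ℝ = ⟪S u, (v : H)⟫_ℝ := by
      rw [hS.symm v u, real_inner_comm]
    rw [S.map_add, S.map_smul] at h1
    simp only [Submodule.coe_add, Submodule.coe_smul, inner_add_left, inner_add_right,
      inner_smul_left, inner_smul_right, RCLike.conj_to_real, h2] at h1
    linarith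
  have := discrim_le_zero h
  rw [discrim] at this
  linarith

theorem IsNonnegSymmetric.abs_le (hS : IsNonnegSymmetric S) (u v : S.domain) :
    |⟪S u, (v : H)⟫_ℝ| ≤ √⟪S u, (u : H)⟫_ℝ * √⟪S v, (v : H)⟫_ℝ := by
  rw [← Real.sqrt_mul (hS.nonneg u)]
  exact Real.abs_le_sqrt (hS.sq_le u v)

theorem IsNonnegSymmetric.sqrt_add_le (hS : IsNonnegSymmetric S) (u v : S.domain) :
    √⟪S (u + v), ((u + v : S.domain) : H)⟫_ℝ ≤ √⟪S u, (u : H)⟫_ℝ + √⟪S v, (v : H)⟫_ℝ := by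
  apply Real.sqrt_le_iff.2
  refine ⟨by positivity, ?_⟩
  have h1 := hS.abs_le u v
  have h2 : ⟪S v, (u : H)⟫_ℝ = ⟪S u, (v : H)⟫_ℝ := by
    rw [hS.symm v u, real_inner_comm]
  rw [add_sq, Real.sq_sqrt (hS.nonneg u), Real.sq_sqrt (hS.nonneg v), S.map_add]
  simp only [Submodule.coe_add, inner_add_left, inner_add_right, h2]
  have := le_abs_self ⟪S u, (v : H)⟫_ℝ
  linarith

theorem FormConverges.add (hS : IsNonnegSymmetric S) {u v : ℕ → S.domain} {f g : H}
    (hu : FormConverges S u f) (hv : FormConverges S v g) : FormConverges S (u + v) (f + g) := by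
  refine ⟨hu.1.add hv.1, ?_⟩
  have h1 := ((Real.continuous_sqrt.tendsto 0).comp hu.2).add
    ((Real.continuous_sqrt.tendsto 0).comp hv.2)
  have h2 := h1.pow 2
  simp only [Real.sqrt_zero, add_zero, ne_eq, OfNat.ofNat_ne_zero, not_false_eq_true, zero_pow]
    at h2
  refine squeeze_zero (fun p => hS.nonneg _) (fun p => ?_) h2
  have h3 := hS.sqrt_add_le (u p.1 - u p.2) (v p.1 - v p.2)
  have h4 : u p.1 - u p.2 + (v p.1 - v p.2) = (u + v) p.1 - (u + v) p.2 := by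
    simp only [Pi.add_apply]; abel
  rw [h4, Real.sqrt_le_left (by positivity)] at h3
  exact h3

theorem FormConverges.smul (c : ℝ) {u : ℕ → S.domain} {f : H}
    (hu : FormConverges S u f) : FormConverges S (c • u) (c • f) := by
  refine ⟨hu.1.const_smul c, ?_⟩
  have h := hu.2.const_mul (c * c)
  rw [mul_zero] at h
  refine h.congr fun p => ?_
  have : (c • u) p.1 - (c • u) p.2 = c • (u p.1 - u p.2) := by
    simp [smul_sub]
  rw [this, S.map_smul]
  simp only [Submodule.coe_smul, inner_smul_left, inner_smul_right, RCLike.conj_to_real]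
  ring

theorem FormConverges.sub (hS : IsNonnegSymmetric S) {u v : ℕ → S.domain} {f g : H}
    (hu : FormConverges S u f) (hv : FormConverges S v g) : FormConverges S (u - v) (f - g) := by
  have := hu.add hS (hv.smul (-1))
  simpa [sub_eq_add_neg] using this

theorem FormConverges.const (f : S.domain) : FormConverges S (fun _ => f) (f : H) :=
  ⟨tendsto_const_nhds, by simp⟩

/-- The Cauchy property keeps a whole tail within form distance `1` of a single `u m`; the triangle
inequality for the form seminorm does the rest. -/
theorem FormConverges.exists_bound (hS : IsNonnegSymmetric S) {u : ℕ → S.domain} {f : H}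
    (hu : FormConverges S u f) : ∃ M, 0 ≤ M ∧ ∀ᶠ n in atTop, √⟪S (u n), (u n : H)⟫_ℝ ≤ M := by
  have h := hu.2.eventually (gt_mem_nhds one_pos)
  obtain ⟨m, h⟩ := eventually_atTop_prod_self'.1 h
  refine ⟨1 + √⟪S (u m), (u m : H)⟫_ℝ, by positivity, ?_⟩
  filter_upwards [eventually_ge_atTop m] with n hn
  have h1 := h n hn m le_rfl
  have h2 := hS.sqrt_add_le (u n - u m) (u m)
  rw [sub_add_cancel] at h2
  have h3 : √⟪S (u n - u m), ((u n - u m : S.domain) : H)⟫_ℝ ≤ 1 := by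
    rw [Real.sqrt_le_one]; exact h1.le
  linarith

/-- The form of a nonnegative symmetric operator is closable. -/
theorem FormConverges.tendsto_zero (hS : IsNonnegSymmetric S) {u : ℕ → S.domain}
    (hu : FormConverges S u 0) : Tendsto (fun n => ⟪S (u n), (u n : H)⟫_ℝ) atTop (𝓝 0) := by
  obtain ⟨M, hM0, hM⟩ := hu.exists_bound hS
  rw [Metric.tendsto_atTop]
  intro ε hε
  have h := hu.2.eventually (gt_mem_nhds (show (0 : ℝ) < (ε / (2 * (M + 1))) ^ 2 by positivity))
  obtain ⟨n₁, h⟩ := eventually_atTop_prod_self'.1 h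
  obtain ⟨n₀, hn₀⟩ := mem_atTop_sets.1 (inter_mem (eventually_ge_atTop n₁) hM)
  refine ⟨n₀, fun n hn => ?_⟩
  have hnT := hn₀ n hn
  rw [Real.dist_eq, sub_zero, abs_of_nonneg (hS.nonneg _)]
  -- Split ⟪S uₙ, uₙ⟫ into ⟪S uₙ, uₙ - uₘ⟫ and ⟪S uₙ, uₘ⟫. For fixed `n` the second term tends to 0
  -- because uₘ → 0 in the Hilbert space, and Cauchy–Schwarz bounds the first by `M` times the
  -- Cauchy tail. The `M + 1` in the denominator allows `M = 0`.
  have key : ⟪S (u n), (u n : H)⟫_ℝ ≤ M * (ε / (2 * (M + 1))) := by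
    have hlim : Tendsto (fun m => ⟪S (u n), (u m : H)⟫_ℝ) atTop (𝓝 0) := by
      simpa using (tendsto_const_nhds (x := S (u n))).inner hu.1
    have hlim2 : Tendsto (fun m => ⟪S (u n), (u n : H)⟫_ℝ - ⟪S (u n), (u m : H)⟫_ℝ) atTop
        (𝓝 (⟪S (u n), (u n : H)⟫_ℝ - 0)) := hlim.const_sub _
    rw [sub_zero] at hlim2
    refine le_of_tendsto hlim2 ?_
    filter_upwards [eventually_ge_atTop n₁] with m hm
    have h1 := hS.abs_le (u n) (u n - u m)
    have h2 : √⟪S (u n - u m), ((u n - u m : S.domain) : H)⟫_ℝ ≤ ε / (2 * (M + 1)) := by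
      rw [Real.sqrt_le_left (by positivity)]
      exact (h n hnT.1 m hm).le
    rw [← inner_sub_right, ← Submodule.coe_sub]
    refine (le_abs_self _).trans (h1.trans ?_)
    exact mul_le_mul hnT.2 h2 (Real.sqrt_nonneg _) hM0
  have : M * (ε / (2 * (M + 1))) < ε := by
    rw [mul_div_assoc', div_lt_iff₀ (by positivity)]
    nlinarith
  linarith

theorem FormConverges.tendsto_inner_zero (hS : IsNonnegSymmetric S) {u v : ℕ → S.domain} {g : H}
    (hu : FormConverges S u 0) (hv : FormConverges S v g) :
    Tendsto (fun n => ⟪S (u n), (v n : H)⟫_ℝ) atTop (𝓝 0) := by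
  obtain ⟨M, hM0, hM⟩ := hv.exists_bound hS
  have h1 := ((Real.continuous_sqrt.tendsto 0).comp (hu.tendsto_zero hS)).mul_const M
  rw [Real.sqrt_zero, zero_mul] at h1
  refine squeeze_zero_norm' ?_ h1
  filter_upwards [hM] with n hn
  exact (hS.abs_le _ _).trans (mul_le_mul_of_nonneg_left hn (Real.sqrt_nonneg _))

theorem IsNonnegSymmetric.inner_comm (hS : IsNonnegSymmetric S) (u v : S.domain) :
    ⟪S u, (v : H)⟫_ℝ = ⟪S v, (u : H)⟫_ℝ := by
  rw [hS.symm u v, real_inner_comm]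

/-- The sequences `u' - u` and `v' - v` represent `0`, so by closability their form norms tend to 0,
while those of `v'` and `u` stay bounded. The difference is ⟪S(u' - u), v'⟫ + ⟪S u, v' - v⟫. -/
theorem FormConverges.tendsto_sub (hS : IsNonnegSymmetric S) {u u' v v' : ℕ → S.domain} {f g : H}
    (hu : FormConverges S u f) (hu' : FormConverges S u' f) (hv : FormConverges S v g)
    (hv' : FormConverges S v' g) :
    Tendsto (fun n => ⟪S (u' n), (v' n : H)⟫_ℝ - ⟪S (u n), (v n : H)⟫_ℝ) atTop (𝓝 0) := by
  have h1 : FormConverges S (u' - u) 0 := by simpa using hu'.sub hS hu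
  have h2 : FormConverges S (v' - v) 0 := by simpa using hv'.sub hS hv
  have h3 := (h1.tendsto_inner_zero hS hv').add (h2.tendsto_inner_zero hS hu)
  rw [add_zero] at h3
  refine h3.congr fun n => ?_
  rw [hS.inner_comm ((v' - v) n) (u n)]
  simp only [Pi.sub_apply, S.map_sub, Submodule.coe_sub, inner_sub_left, inner_sub_right]
  ring

/-- A form value can be computed with any representing sequences. -/
theorem isFormValue_of_tendsto (hS : IsNonnegSymmetric S) {u v : ℕ → S.domain} {f g : H} {a : ℝ}
    (hu : FormConverges S u f) (hv : FormConverges S v g)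
    (h : Tendsto (fun n => ⟪S (u n), (v n : H)⟫_ℝ) atTop (𝓝 a)) : IsFormValue S f g a := by
  refine ⟨⟨u, hu⟩, ⟨v, hv⟩, fun u' v' hu' hv' => ?_⟩
  have := (hu.tendsto_sub hS hu' hv hv').add h
  simpa using this

theorem IsFormValue.unique {f g : H} {a b : ℝ} (h : IsFormValue S f g a)
    (h' : IsFormValue S f g b) : a = b := by
  obtain ⟨⟨u, hu⟩, ⟨v, hv⟩, h1⟩ := h
  exact tendsto_nhds_unique (h1 u v hu hv) (h'.2.2 u v hu hv)

theorem IsFormValue.add (hS : IsNonnegSymmetric S) {f f' g : H} {a b : ℝ}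
    (h : IsFormValue S f g a) (h' : IsFormValue S f' g b) : IsFormValue S (f + f') g (a + b) := by
  obtain ⟨⟨u, hu⟩, ⟨v, hv⟩, h1⟩ := h
  obtain ⟨⟨u', hu'⟩, -, h1'⟩ := h'
  refine isFormValue_of_tendsto hS (hu.add hS hu') hv
    (((h1 u v hu hv).add (h1' u' v hu' hv)).congr fun n => ?_)
  rw [Pi.add_apply, S.map_add, inner_add_left]

theorem IsFormValue.smul (hS : IsNonnegSymmetric S) (c : ℝ) {f g : H} {a : ℝ}
    (h : IsFormValue S f g a) : IsFormValue S (c • f) g (c * a) := by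
  obtain ⟨⟨u, hu⟩, ⟨v, hv⟩, h1⟩ := h
  refine isFormValue_of_tendsto hS (hu.smul c) hv (((h1 u v hu hv).const_mul c).congr fun n => ?_)
  rw [Pi.smul_apply, S.map_smul, inner_smul_left]
  rfl

theorem mem_formDomain (f : S.domain) : (f : H) ∈ formDomain S := ⟨_, FormConverges.const f⟩

/-- With a constant sequence in the first slot, only the convergence of the second sequence in the
Hilbert space matters. -/
theorem isFormValue_of_mem_domain (hS : IsNonnegSymmetric S) (f : S.domain) {g : H}
    (hg : g ∈ formDomain S) : IsFormValue S (f : H) g ⟪S f, g⟫_ℝ := by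
  obtain ⟨v, hv⟩ := hg
  exact isFormValue_of_tendsto hS (FormConverges.const f) hv
    ((tendsto_const_nhds (x := S f)).inner hv.1)

/-! ### The Friedrichs extension as a linear operator -/

/-- The graph of the Friedrichs extension. -/
def friedrichsGraph (hS : IsNonnegSymmetric S) : Submodule ℝ (H × H) where
  carrier := {x | x.1 ∈ formDomain S ∧ ∀ g ∈ formDomain S, IsFormValue S x.1 g ⟪x.2, g⟫_ℝ}
  zero_mem' := by
    refine ⟨mem_formDomain (0 : S.domain), fun g hg => ?_⟩
    simpa using isFormValue_of_mem_domain hS (0 : S.domain) hg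
  add_mem' := by
    rintro x y ⟨⟨u, hu⟩, hx⟩ ⟨⟨v, hv⟩, hy⟩
    refine ⟨⟨_, hu.add hS hv⟩, fun g hg => ?_⟩
    simpa [inner_add_left] using (hx g hg).add hS (hy g hg)
  smul_mem' := by
    rintro c x ⟨⟨u, hu⟩, hx⟩
    refine ⟨⟨_, hu.smul c⟩, fun g hg => ?_⟩
    simpa [inner_smul_left] using (hx g hg).smul hS c

theorem exists_isFriedrichsExtension (hS : IsNonnegSymmetric S) :
    ∃ L : H →ₗ.[ℝ] H, IsFriedrichsExtension S L := by
  refine ⟨(friedrichsGraph hS).toLinearPMap, fun f w => ?_⟩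
  rw [Submodule.toLinearPMap_graph_eq]
  · rfl
  · rintro ⟨f, w⟩ ⟨-, h⟩ rfl
    -- The relation is single-valued: a pair `(0, w)` has ⟪w, g⟫ = τ[0, g] = 0 for all `g` in the
    -- dense domain.
    refine hS.dense.eq_zero_of_inner_left (𝕜 := ℝ) fun g hg => ?_
    have h1 := h g (mem_formDomain ⟨g, hg⟩)
    have h2 := isFormValue_of_mem_domain hS (0 : S.domain) (mem_formDomain ⟨g, hg⟩)
    have := h1.unique h2
    simpa using this

/-- The Friedrichs extension extends the operator, so the forms of two operators with the same
Friedrichs extension agree on the domain of each of them. -/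
theorem isFormValue_of_friedrichs_eq {T L : H →ₗ.[ℝ] H} (hS : IsNonnegSymmetric S)
    (hSL : IsFriedrichsExtension S L) (hTL : IsFriedrichsExtension T L) (f : S.domain) :
    IsFormValue T (f : H) f ⟪S f, (f : H)⟫_ℝ := by
  have h1 : ((f : H), S f) ∈ L.graph :=
    (hSL _ _).2 ⟨mem_formDomain f, fun g hg => isFormValue_of_mem_domain hS f hg⟩
  obtain ⟨h2, h3⟩ := (hTL _ _).1 h1
  exact h3 _ h2

end FormMethod

end

noncomputable section

namespace MetricGraph

variable {V E : Type*} {G : MetricGraph V E}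

/-! ### The topology of the graph and of its completion -/

theorem zero_mem_Icc_len (e : E) : (0 : ℝ) ∈ Icc 0 (G.len e) := ⟨le_rfl, (G.len_pos e).le⟩

theorem len_mem_Icc_len (e : E) : G.len e ∈ Icc 0 (G.len e) := ⟨(G.len_pos e).le, le_rfl⟩

/-- Outside the edge `pt e` is constant, so it is Lipschitz on the whole line, and continuity and
measurability can be treated without endpoints. -/
theorem pt_clamp (e : E) (s : ℝ) : G.pt e (max 0 (min s (G.len e))) = G.pt e s := by
  rcases le_or_gt s 0 with h | h
  · rw [max_eq_left ((min_le_left _ _).trans h), pt_zero]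
    simp [pt, h, h.not_gt]
  · rcases le_or_gt (G.len e) s with h' | h'
    · rw [min_eq_right h', max_eq_right (G.len_pos e).le, pt_len]
      simp [pt, h.not_ge, h'.not_gt]
    · rw [min_eq_left h'.le, max_eq_right h.le]

theorem clamp_mem (e : E) (s : ℝ) : max 0 (min s (G.len e)) ∈ Icc 0 (G.len e) :=
  ⟨le_max_left _ _, max_le (G.len_pos e).le (min_le_right _ _)⟩

theorem dist_le_of_pathLength {p q : G.Point} {L : ℝ} (h : G.PathLength p q L) : dist p q ≤ L :=
  csInf_le ⟨0, fun _ hL => PathLength.nonneg G hL⟩ h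

theorem exists_pathLength_lt {p q : G.Point} {r : ℝ} (h : dist p q < r) :
    ∃ L < r, G.PathLength p q L := by
  obtain ⟨L, hL, hL'⟩ := exists_lt_of_csInf_lt (G.exists_pathLength p q) h
  exact ⟨L, hL', hL⟩

theorem dist_pt_le (e : E) (s t : ℝ) : dist (G.pt e s) (G.pt e t) ≤ |s - t| := by
  rw [← pt_clamp e s, ← pt_clamp e t]
  refine (dist_le_of_pathLength (PathLength.single G e (clamp_mem e s) (clamp_mem e t))).trans ?_
  refine (abs_max_sub_max_le_max _ _ _ _).trans ?_
  rw [sub_self, abs_zero, max_eq_right (abs_nonneg _)]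
  refine (abs_min_sub_min_le_max _ _ _ _).trans ?_
  rw [sub_self, abs_zero, max_eq_left (abs_nonneg _)]

theorem continuous_pt (e : E) : Continuous (G.pt e) :=
  (LipschitzWith.of_dist_le_mul (K := 1) fun s t => by
    simpa [Real.dist_eq] using dist_pt_le e s t).continuous

theorem abs_sub_le_of_edges {f : G.Point → ℝ} {K : ℝ}
    (h : ∀ e, ∀ s ∈ Icc 0 (G.len e), ∀ t ∈ Icc 0 (G.len e),
      |f (G.pt e s) - f (G.pt e t)| ≤ K * |s - t|) {p q : G.Point} {L : ℝ}
    (hL : G.PathLength p q L) : |f p - f q| ≤ K * L := by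
  induction hL with
  | nil => simp
  | step L e s t hs ht _ ih =>
    have := h e s hs t ht
    have := abs_sub_le (f p) (f (G.pt e s)) (f (G.pt e t))
    linarith

/-- Bounds along the edges add up along a path and pass to the infimum over paths. This is the
source of lower bounds for the geodesic distance: it suffices to exhibit a test function that is
Lipschitz on every edge. -/
theorem lipschitz_of_edges {f : G.Point → ℝ} {K : ℝ} (hK : 0 ≤ K)
    (h : ∀ e, ∀ s ∈ Icc 0 (G.len e), ∀ t ∈ Icc 0 (G.len e),
      |f (G.pt e s) - f (G.pt e t)| ≤ K * |s - t|) (p q : G.Point) :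
    |f p - f q| ≤ K * dist p q := by
  refine le_of_forall_pos_le_add fun ε hε => ?_
  obtain ⟨L, hL, hpath⟩ := exists_pathLength_lt (p := p) (q := q) (r := dist p q + ε / (K + 1))
    (by have : 0 < ε / (K + 1) := by positivity
        linarith)
  refine (abs_sub_le_of_edges h hpath).trans ((mul_le_mul_of_nonneg_left hL.le hK).trans ?_)
  have : K * (ε / (K + 1)) ≤ ε := by
    rw [mul_div_assoc', div_le_iff₀ (by positivity)]
    nlinarith
  linarith

theorem continuous_of_edges {f : G.Point → ℝ} {F : Set E} (hF : F.Finite)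
    (h0 : ∀ e ∉ F, ∀ s ∈ Icc 0 (G.len e), f (G.pt e s) = f (G.pt e 0))
    (h1 : ∀ e ∈ F, ∃ K : ℝ, ∀ s ∈ Icc 0 (G.len e), ∀ t ∈ Icc 0 (G.len e),
      |f (G.pt e s) - f (G.pt e t)| ≤ K * |s - t|) : Continuous f := by
  choose! K hK using h1
  obtain ⟨M, hM⟩ := (hF.image K).bddAbove
  refine (LipschitzWith.of_dist_le_mul (K := ⟨max M 0, le_max_right _ _⟩) fun p q => ?_).continuous
  rw [Real.dist_eq]
  refine lipschitz_of_edges (le_max_right _ _) (fun e s hs t ht => ?_) p q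
  by_cases he : e ∈ F
  · refine (hK e he s hs t ht).trans (mul_le_mul_of_nonneg_right ?_ (abs_nonneg _))
    exact (hM (mem_image_of_mem _ he)).trans (le_max_left _ _)
  · rw [h0 e he s hs, h0 e he t ht, sub_self, abs_zero]
    positivity

/-- The test function is the distance to `s` along `e`, truncated at `ρ`, and the constant `ρ` off
`e`. Both ends of `e` are at least `ρ` away from `s`, so the two pieces match at the ends. -/
theorem eq_inner_of_dist_lt {e : E} {s : ℝ} (hs : s ∈ Ioo 0 (G.len e)) {p : G.Point}
    (h : dist p (Point.inner e s hs) < min s (G.len e - s)) :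
    ∃ t, ∃ ht : t ∈ Ioo 0 (G.len e), p = Point.inner e t ht ∧
      |t - s| ≤ dist p (Point.inner e s hs) := by
  classical
  set ρ := min s (G.len e - s) with hρ
  have hρ1 : ρ ≤ s := min_le_left _ _
  have hρ2 : ρ ≤ G.len e - s := min_le_right _ _
  let f : G.Point → ℝ := fun x => match x with
    | Point.vert _ => ρ
    | Point.inner e' t _ => if e' = e then min ρ |t - s| else ρ
  have hf : ∀ e', ∀ t ∈ Icc 0 (G.len e'),
      f (G.pt e' t) = if e' = e then min ρ |t - s| else ρ := by
    intro e' t ht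
    by_cases h' : t ∈ Ioo 0 (G.len e')
    · rw [pt_of_mem G e' h']
    · have hv : f (G.pt e' t) = ρ := by
        rw [pt, dif_neg h']; split_ifs <;> rfl
      rw [hv]
      split_ifs with he
      · subst he
        symm
        apply min_eq_left
        rcases eq_or_lt_of_le ht.1 with h0 | h0
        · rw [← h0, zero_sub, abs_neg]; exact hρ1.trans (le_abs_self s)
        · have : t = G.len e' := le_antisymm ht.2 (not_lt.1 fun h2 => h' ⟨h0, h2⟩)
          rw [this]; exact hρ2.trans (le_abs_self _)
      · rfl
  have hlip := lipschitz_of_edges (f := f) zero_le_one (fun e' t ht t' ht' => by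
    rw [hf e' t ht, hf e' t' ht', one_mul]
    split_ifs
    · refine (abs_min_sub_min_le_max _ _ _ _).trans ?_
      rw [sub_self, abs_zero, max_eq_right (abs_nonneg _)]
      refine (abs_abs_sub_abs_le _ _).trans ?_
      rw [sub_sub_sub_cancel_right]
    · simp) p (Point.inner e s hs)
  have hz : f (Point.inner e s hs) = 0 := by
    have hρ0 : 0 ≤ ρ := le_min hs.1.le (sub_nonneg.2 hs.2.le)
    simp [f, hρ0]
  rw [hz, sub_zero, one_mul] at hlip
  have hlt : f p < ρ := (le_abs_self _).trans_lt (hlip.trans_lt h)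
  rcases p with v | ⟨e', t, ht⟩
  · exact absurd hlt (lt_irrefl _)
  · by_cases he : e' = e
    · subst he
      refine ⟨t, ht, rfl, ?_⟩
      have h1 : min ρ |t - s| < ρ := by simpa [f] using hlt
      have h2 : f (Point.inner e' t ht) = |t - s| := by
        simpa [f] using ((min_lt_iff.1 h1).resolve_left (lt_irrefl _)).le
      rw [h2, abs_abs] at hlip
      exact hlip
    · simp [f, he] at hlt

/-- The test function is the distance to `v` along the incident edges, truncated at `ρ`. Local
finiteness allows a `ρ` below the lengths of all incident edges, so the truncation is reached at any
end different from `v`; the inner minimum treats loops as well. -/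
theorem exists_star_vert (v : V) : ∃ ρ > 0, ∀ p : G.Point, dist p (Point.vert v) < ρ →
    p = Point.vert v ∨ ∃ e, (G.src e = v ∨ G.tgt e = v) ∧ ∃ t, ∃ ht : t ∈ Ioo 0 (G.len e),
      p = Point.inner e t ht := by
  classical
  have hfin : {e | G.src e = v ∨ G.tgt e = v}.Finite := (G.finite_src v).union (G.finite_tgt v)
  obtain ⟨ρ, hρ, hρe⟩ : ∃ ρ > 0, ∀ e, (G.src e = v ∨ G.tgt e = v) → ρ ≤ G.len e := by
    have : ∀ᶠ ρ in 𝓝[>] (0 : ℝ), ∀ e ∈ {e | G.src e = v ∨ G.tgt e = v}, ρ ≤ G.len e :=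
      (eventually_all_finite hfin).2 fun e _ =>
        mem_nhdsWithin_of_mem_nhds (Iic_mem_nhds (G.len_pos e))
    obtain ⟨ρ, h1, h2⟩ := (this.and self_mem_nhdsWithin).exists
    exact ⟨ρ, h2, h1⟩
  refine ⟨ρ, hρ, fun p hp => ?_⟩
  let g : E → ℝ → ℝ := fun e t =>
    min ρ (min (if G.src e = v then t else ρ) (if G.tgt e = v then G.len e - t else ρ))
  let f : G.Point → ℝ := fun x => match x with
    | Point.vert u => if u = v then 0 else ρ
    | Point.inner e t _ => g e t
  have hf : ∀ e, ∀ t ∈ Icc 0 (G.len e), f (G.pt e t) = g e t := by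
    intro e t ht
    by_cases h' : t ∈ Ioo 0 (G.len e)
    · rw [pt_of_mem G e h']
    · rcases eq_or_lt_of_le ht.1 with h0 | h0
      · rw [← h0, pt_zero]
        have h1 : G.tgt e = v → ρ ≤ G.len e := fun h => hρe e (Or.inr h)
        simp only [f, g]
        split_ifs with h2 h3 h3 <;> simp [hρ.le] <;> first | linarith [h1 h3]
      · have : t = G.len e := le_antisymm ht.2 (not_lt.1 fun h2 => h' ⟨h0, h2⟩)
        rw [this, pt_len]
        have h1 : G.src e = v → ρ ≤ G.len e := fun h => hρe e (Or.inl h)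
        simp only [f, g]
        split_ifs with h2 h3 h3 <;> simp [hρ.le] <;> first | linarith [h1 h3]
  have hlip := lipschitz_of_edges (f := f) zero_le_one (fun e t ht t' ht' => by
    rw [hf e t ht, hf e t' ht', one_mul]
    refine (abs_min_sub_min_le_max _ _ _ _).trans (max_le (by simp) ?_)
    refine (abs_min_sub_min_le_max _ _ _ _).trans (max_le ?_ ?_)
    · split_ifs <;> simp
    · split_ifs
      · rw [sub_sub_sub_cancel_left, abs_sub_comm]
      · simp) p (Point.vert v)
  have hz : f (Point.vert v) = 0 := by simp [f]
  rw [hz, sub_zero, one_mul] at hlip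
  have hlt : f p < ρ := (le_abs_self _).trans_lt (hlip.trans_lt hp)
  rcases p with u | ⟨e, t, ht⟩
  · left
    by_contra hu
    have hu' : u ≠ v := fun h => hu (h ▸ rfl)
    simp [f, hu'] at hlt
  · right
    refine ⟨e, ?_, t, ht, rfl⟩
    by_contra hc
    push Not at hc
    simp [f, g, hc.1, hc.2] at hlt

theorem pt_mem_cases (e : E) {s : ℝ} (hs : s ∈ Icc 0 (G.len e)) :
    s ∈ Ioo 0 (G.len e) ∨ s = 0 ∨ s = G.len e := by
  by_cases h : s ∈ Ioo 0 (G.len e)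
  · exact Or.inl h
  · right
    rcases eq_or_lt_of_le hs.1 with h0 | h0
    · exact Or.inl h0.symm
    · exact Or.inr (le_antisymm hs.2 (not_lt.1 fun h2 => h ⟨h0, h2⟩))

/-- Every point has a neighbourhood that meets only finitely many edges and contains no other
vertex. -/
theorem exists_star (z : G.Point) : ∃ ρ > 0, ∃ F : Set E, F.Finite ∧
    (∀ p : G.Point, dist p z < ρ → p = z ∨
      ∃ e ∈ F, ∃ t, ∃ ht : t ∈ Ioo 0 (G.len e), p = Point.inner e t ht) ∧
    ∀ e, ∀ s ∈ Icc 0 (G.len e), dist (G.pt e s) z < ρ → e ∈ F := by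
  rcases z with v | ⟨e₀, s₀, hs₀⟩
  · obtain ⟨ρ, hρ, h⟩ := exists_star_vert (G := G) v
    refine ⟨ρ, hρ, {e | G.src e = v ∨ G.tgt e = v}, (G.finite_src v).union (G.finite_tgt v),
      fun p hp => ?_, fun e s hs hd => ?_⟩
    · exact h p hp
    · have hcase := h _ hd
      rcases pt_mem_cases e hs with h1 | h1 | h1
      · rw [pt_of_mem G e h1] at hcase
        simp only [reduceCtorEq, Point.inner.injEq, false_or] at hcase
        obtain ⟨e', he', t, -, h2, -⟩ := hcase
        exact h2 ▸ he'
      · rw [h1, pt_zero] at hcase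
        simp only [Point.vert.injEq, reduceCtorEq, exists_false, and_false, or_false] at hcase
        exact Or.inl hcase
      · rw [h1, pt_len] at hcase
        simp only [Point.vert.injEq, reduceCtorEq, exists_false, and_false, or_false] at hcase
        exact Or.inr hcase
  · refine ⟨min s₀ (G.len e₀ - s₀), lt_min hs₀.1 (sub_pos.2 hs₀.2), {e₀}, finite_singleton _,
      fun p hp => Or.inr ⟨e₀, rfl, ?_⟩, fun e s hs hd => ?_⟩
    · obtain ⟨t, ht, h2, -⟩ := eq_inner_of_dist_lt hs₀ hp
      exact ⟨t, ht, h2⟩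
    obtain ⟨t, ht, h2, -⟩ := eq_inner_of_dist_lt hs₀ hd
    rcases pt_mem_cases e hs with h1 | h1 | h1
    · rw [pt_of_mem G e h1, Point.inner.injEq] at h2
      exact h2.1
    · rw [h1, pt_zero] at h2; simp at h2
    · rw [h1, pt_len] at h2; simp at h2

/-- The completion identifies points at distance zero, and the geodesic distance is so far only a
pseudometric; the star neighbourhoods separate the points. -/
theorem coe_point_injective {p q : G.Point} (h : (p : G.Bar) = q) : p = q := by
  have h0 : dist p q = 0 := by rw [← UniformSpace.Completion.dist_eq, h, dist_self]
  have key : ∀ (p : G.Point) (e : E) (t : ℝ) (ht : t ∈ Ioo 0 (G.len e)),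
      dist p (Point.inner e t ht) = 0 → p = Point.inner e t ht := by
    intro p e t ht h0
    obtain ⟨t', ht', rfl, h1⟩ :=
      eq_inner_of_dist_lt ht (h0.trans_lt (lt_min ht.1 (sub_pos.2 ht.2)))
    rw [h0] at h1
    have : t' = t := sub_eq_zero.1 (abs_nonpos_iff.1 h1)
    subst this
    rfl
  rcases q with v | ⟨e, t, ht⟩
  · rcases p with u | ⟨e, t, ht⟩
    · obtain ⟨ρ, hρ, hstar⟩ := exists_star_vert (G := G) v
      rcases hstar _ (h0.trans_lt hρ) with h1 | ⟨_, _, _, _, h1⟩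
      · exact h1
      · simp at h1
    · exact (key _ e t ht (by rw [dist_comm, h0])).symm
  · exact key p e t ht h0

theorem coe_mem_bdryBar {p : G.Point} : (p : G.Bar) ∈ G.bdryBar ↔ p ∉ G.interiorPoints := by
  simp only [bdryBar, mem_compl_iff, mem_image, not_exists, not_and]
  refine ⟨fun h hp => h p hp rfl, fun h q hq hqp => ?_⟩
  rw [coe_point_injective hqp] at hq
  exact h hq

theorem vert_mem_bdryBar {v : V} (hv : v ∈ G.bdry) :
    ((Point.vert v : G.Point) : G.Bar) ∈ G.bdryBar :=
  coe_mem_bdryBar.2 fun h => h v hv rfl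

theorem inner_notMem_bdryBar {e : E} {s : ℝ} (hs : s ∈ Ioo 0 (G.len e)) :
    ((G.pt e s : G.Point) : G.Bar) ∉ G.bdryBar := by
  rw [coe_mem_bdryBar, not_not, pt_of_mem G e hs]
  exact fun v _ => by simp

theorem exists_dist_lt (y : G.Bar) {ε : ℝ} (hε : 0 < ε) : ∃ p : G.Point, dist y p < ε :=
  (UniformSpace.Completion.denseRange_coe).exists_dist_lt y hε

theorem isCompact_image_pt (e : E) {S : Set ℝ} (hS : IsCompact S) :
    IsCompact ((fun s => ((G.pt e s : G.Point) : G.Bar)) '' S) :=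
  hS.image ((UniformSpace.Completion.continuous_coe _).comp (continuous_pt e))

/-- The completion adds no points near an interior point. The graph points in the ball lie in a
union of `z` and finitely many closed edges, which is compact and hence closed in the completion, so
their limits in the ball are graph points again. -/
theorem notMem_bdryBar_of_star {z : G.Point} (hz : z ∈ G.interiorPoints) {ρ : ℝ} {F : Set E}
    (hF : F.Finite) (h : ∀ p : G.Point, dist p z < ρ → p = z ∨
      ∃ e ∈ F, ∃ t, ∃ ht : t ∈ Ioo 0 (G.len e), p = Point.inner e t ht) {y : G.Bar}
    (hy : dist y z < ρ) : y ∉ G.bdryBar := by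
  set K : Set G.Bar := {(z : G.Bar)} ∪ ⋃ e ∈ F,
    (fun s => ((G.pt e s : G.Point) : G.Bar)) '' Icc 0 (G.len e) with hK
  have hKc : IsClosed K :=
    (isCompact_singleton.union (hF.isCompact_biUnion fun e _ =>
      isCompact_image_pt e isCompact_Icc)).isClosed
  have hyK : y ∈ K := by
    rw [← hKc.closure_eq, Metric.mem_closure_iff]
    intro ε hε
    obtain ⟨p, hp⟩ := exists_dist_lt y (lt_min hε (sub_pos.2 hy))
    refine ⟨p, ?_, hp.trans_le (min_le_left _ _)⟩
    have h1 : dist p z < ρ := by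
      rw [← UniformSpace.Completion.dist_eq]
      have h2 := dist_triangle (p : G.Bar) y z
      have h3 := hp.trans_le (min_le_right _ _)
      rw [dist_comm (p : G.Bar) y] at h2
      linarith
    rcases h p h1 with rfl | ⟨e, he, t, ht, rfl⟩
    · exact Or.inl rfl
    · refine Or.inr (mem_iUnion₂.2 ⟨e, he, t, Ioo_subset_Icc_self ht, ?_⟩)
      simp only [pt_of_mem G e ht]
  have hint : ∃ p : G.Point, (p : G.Bar) = y := by
    rcases hyK with h1 | h1
    · exact ⟨z, h1.symm⟩
    · obtain ⟨e, -, s, -, hs⟩ := mem_iUnion₂.1 h1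
      exact ⟨_, hs⟩
  obtain ⟨p, rfl⟩ := hint
  rw [coe_mem_bdryBar, not_not]
  rw [UniformSpace.Completion.dist_eq] at hy
  rcases h p hy with rfl | ⟨e, -, t, ht, rfl⟩
  · exact hz
  · exact fun v _ => by simp

theorem isClosed_bdryBar : IsClosed G.bdryBar := by
  rw [← isOpen_compl_iff, Metric.isOpen_iff]
  intro y hy
  simp only [bdryBar, compl_compl, mem_image] at hy
  obtain ⟨z, hz, rfl⟩ := hy
  obtain ⟨ρ, hρ, F, hF, h, -⟩ := exists_star z
  exact ⟨ρ, hρ, fun y hy => notMem_bdryBar_of_star hz hF h hy⟩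

theorem mem_nbhd {ε : ℝ} {A : Set G.Bar} {x : G.Point} :
    x ∈ G.nbhd ε A ↔ ∃ a ∈ A, dist (x : G.Bar) a < ε := Metric.mem_thickening_iff

theorem nbhd_subset {ε : ℝ} {A B : Set G.Bar} (h : A ⊆ B) : G.nbhd ε A ⊆ G.nbhd ε B :=
  fun _ hx => Metric.thickening_subset_of_subset ε h hx

theorem mem_nbhd_of_dist {ε r : ℝ} {A : Set G.Bar} {x y : G.Point} (hx : x ∈ G.nbhd ε A)
    (h : dist x y ≤ r) : y ∈ G.nbhd (ε + r) A := by
  obtain ⟨a, ha, hd⟩ := mem_nbhd.1 hx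
  refine mem_nbhd.2 ⟨a, ha, ?_⟩
  have h1 := dist_triangle (y : G.Bar) x a
  rw [UniformSpace.Completion.dist_eq, dist_comm y x] at h1
  linarith

/-- The ball of radius half the edge length about the midpoint stays inside the open edge, which has
no boundary points. -/
theorem midpoint_notMem_nbhd (e : E) : G.pt e (G.len e / 2) ∉ G.nbhd (G.len e / 2) G.bdryBar := by
  intro hmem
  have hl := G.len_pos e
  have hm : G.len e / 2 ∈ Ioo 0 (G.len e) := ⟨by linarith, by linarith⟩
  obtain ⟨a, ha, hd⟩ := mem_nbhd.1 hmem
  rw [pt_of_mem G e hm, dist_comm] at hd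
  refine notMem_bdryBar_of_star (z := Point.inner e (G.len e / 2) hm) (F := {e})
    (fun v _ => by simp) (finite_singleton e) (fun p hp => Or.inr ⟨e, rfl, ?_⟩) hd ha
  obtain ⟨t, ht, h2, -⟩ := eq_inner_of_dist_lt hm (hp.trans_le (by rw [sub_half, min_self]))
  exact ⟨t, ht, h2⟩

theorem mem_nbhd_of_mem {ε : ℝ} (hε : 0 < ε) {A : Set G.Bar} {x : G.Point} (h : (x : G.Bar) ∈ A) :
    x ∈ G.nbhd ε A := Metric.self_subset_thickening hε A h

/-! ### Finiteness of edges away from the boundary -/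

section Compact

variable [CompactSpace G.Bar]

/-- All but finitely many edges lie in a given neighbourhood of the boundary. -/
theorem finite_edges_not_near {ε : ℝ} (hε : 0 < ε) :
    {e | ∃ s ∈ Icc 0 (G.len e), G.pt e s ∉ G.nbhd ε G.bdryBar}.Finite := by
  set K : Set G.Bar := (Metric.thickening ε G.bdryBar)ᶜ with hK
  have hKc : IsCompact K := Metric.isOpen_thickening.isClosed_compl.isCompact
  -- Off the boundary every point of the completion is a graph point, and its star meets only
  -- finitely many edges; compactness of `K` makes the count globally finite.
  have hloc : ∀ y ∈ K, ∃ U ∈ 𝓝 y, {e | ∃ s ∈ Icc 0 (G.len e),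
      ((G.pt e s : G.Point) : G.Bar) ∈ U}.Finite := by
    intro y hy
    have hy' : y ∉ G.bdryBar := fun h => hy (Metric.self_subset_thickening hε _ h)
    simp only [bdryBar, mem_compl_iff, not_not, mem_image] at hy'
    obtain ⟨z, -, rfl⟩ := hy'
    obtain ⟨ρ, hρ, F, hF, -, h⟩ := exists_star z
    refine ⟨Metric.ball (z : G.Bar) ρ, Metric.ball_mem_nhds _ hρ, hF.subset ?_⟩
    rintro e ⟨s, hs, hd⟩
    rw [Metric.mem_ball, UniformSpace.Completion.dist_eq] at hd
    exact h e s hs hd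
  choose! U hU hUfin using hloc
  obtain ⟨t, htK, ht⟩ := hKc.elim_nhds_subcover U hU
  refine (t.finite_toSet.biUnion fun y hy => hUfin y (htK y hy)).subset ?_
  rintro e ⟨s, hs, hn⟩
  obtain ⟨y, hy, hsU⟩ := mem_iUnion₂.1 (ht (show ((G.pt e s : G.Point) : G.Bar) ∈ K from hn))
  exact mem_iUnion₂.2 ⟨y, hy, s, hs, hsU⟩

/-- The midpoint of such an edge lies outside the `r / 2`-neighbourhood of the boundary. -/
theorem finite_long_edges {r : ℝ} (hr : 0 < r) : {e | r ≤ G.len e}.Finite := by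
  refine (finite_edges_not_near (G := G) (half_pos hr)).subset fun e he => ?_
  refine ⟨G.len e / 2, ⟨(half_pos (G.len_pos e)).le, (half_lt_self (G.len_pos e)).le⟩, fun h => ?_⟩
  exact midpoint_notMem_nbhd e (nbhd_mono (div_le_div_of_nonneg_right he zero_le_two) _ h)

end Compact

/-- The intermediate value theorem along a path. -/
theorem PathLength.exists_eq {g : G.Point → ℝ} (hg : Continuous g) {p q : G.Point} {L t : ℝ}
    (h : G.PathLength p q L) (hp : g p < t) (hq : t < g q) :
    ∃ e, ∃ s ∈ Icc 0 (G.len e), g (G.pt e s) = t ∧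
      dist p (G.pt e s) + dist (G.pt e s) q ≤ L := by
  induction h with
  | nil => exact absurd (hp.trans hq) (lt_irrefl _)
  | step L e s s' hs hs' h ih =>
    rcases lt_trichotomy t (g (G.pt e s)) with h1 | h1 | h1
    · obtain ⟨e', r, hr, h2, h3⟩ := ih h1
      refine ⟨e', r, hr, h2, ?_⟩
      have := dist_triangle (G.pt e' r) (G.pt e s) (G.pt e s')
      have := dist_pt_le (G := G) e s s'
      linarith
    · refine ⟨e, s, hs, h1.symm, ?_⟩
      have := dist_le_of_pathLength h
      have := dist_pt_le (G := G) e s s'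
      linarith
    · have hc : ContinuousOn (fun r => g (G.pt e r)) (uIcc s s') :=
        (hg.comp (continuous_pt e)).continuousOn
      have hmem : t ∈ uIcc (g (G.pt e s)) (g (G.pt e s')) := by
        rw [uIcc_of_le (h1.trans hq).le]; exact ⟨h1.le, hq.le⟩
      obtain ⟨r, hr, hrt⟩ := intermediate_value_uIcc hc hmem
      refine ⟨e, r, (ordConnected_Icc.uIcc_subset hs hs') hr, hrt, ?_⟩
      have h2 := dist_triangle p (G.pt e s) (G.pt e r)
      have h3 := dist_le_of_pathLength h
      have h4 := dist_pt_le (G := G) e s r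
      have h5 := dist_pt_le (G := G) e r s'
      have h6 : |s - r| + |r - s'| = |s - s'| := by
        rcases le_total s s' with h7 | h7
        · rw [uIcc_of_le h7] at hr
          rw [abs_of_nonpos (by linarith [hr.1]), abs_of_nonpos (by linarith [hr.2]),
            abs_of_nonpos (by linarith)]
          ring
        · rw [uIcc_of_ge h7] at hr
          rw [abs_of_nonneg (by linarith [hr.2]), abs_of_nonneg (by linarith [hr.1]),
            abs_of_nonneg (by linarith)]
          ring
      linarith

/-! ### Cutoff functions -/

/-- Functions that are smooth on the edges, constant near the vertices, and not constant on finitely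
many edges only. -/
structure IsFlat (χ : G.Point → ℝ) : Prop where
  smooth : ∀ e, ∃ g : ℝ → ℝ, ContDiff ℝ 2 g ∧ ∀ s ∈ Icc 0 (G.len e), χ (G.pt e s) = g s
  flat : ∀ e, ∃ τ > 0, (∀ s ∈ Icc 0 (G.len e), s ≤ τ → χ (G.pt e s) = χ (G.pt e 0)) ∧
    ∀ s ∈ Icc 0 (G.len e), G.len e - τ ≤ s → χ (G.pt e s) = χ (G.pt e (G.len e))
  finite : {e | ∃ s ∈ Icc 0 (G.len e), χ (G.pt e s) ≠ χ (G.pt e 0)}.Finite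

/-- Flat functions that are `1` near the set `A`, vanish near the rest of the boundary, and are
supported in the `ε`-neighbourhood of `A`. -/
structure IsCutoff (A : Set G.Bar) (ε : ℝ) (χ : G.Point → ℝ) : Prop extends IsFlat χ where
  nonneg : ∀ x, 0 ≤ χ x
  le_one : ∀ x, χ x ≤ 1
  near : ∃ ρ > 0, (∀ x ∈ G.nbhd ρ A, χ x = 1) ∧ ∀ x ∈ G.nbhd ρ (G.bdryBar \ A), χ x = 0
  supp : ∀ x, χ x ≠ 0 → x ∈ G.nbhd ε A

/-- A smooth function that is `1` for `x ≤ 1/4` and `0` for `x ≥ 1/2`. -/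
def stepDown (x : ℝ) : ℝ := Real.smoothTransition (2 - 4 * x)

theorem stepDown_eq_one {x : ℝ} (h : x ≤ 1 / 4) : stepDown x = 1 :=
  Real.smoothTransition.one_of_one_le (by linarith)

theorem stepDown_eq_zero {x : ℝ} (h : 1 / 2 ≤ x) : stepDown x = 0 :=
  Real.smoothTransition.zero_of_nonpos (by linarith)

theorem stepDown_nonneg (x : ℝ) : 0 ≤ stepDown x := Real.smoothTransition.nonneg _

theorem stepDown_le_one (x : ℝ) : stepDown x ≤ 1 := Real.smoothTransition.le_one _

theorem contDiff_stepDown : ContDiff ℝ 2 stepDown :=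
  (Real.smoothTransition.contDiff (n := 2)).comp (by fun_prop)

open Classical in
/-- The edge components of the cutoff function with value `1` at the vertices in `T`. -/
def cutoffEdge (G : MetricGraph V E) (T : Set V) (r : ℝ) (e : E) (s : ℝ) : ℝ :=
  -- Without this case the profile would drop to 0 in the middle of a short edge joining two
  -- vertices of `T`, and there may be infinitely many such edges arbitrarily close to the set that
  -- is to be cut off.
  if G.src e ∈ T ∧ G.tgt e ∈ T ∧ G.len e < r then 1
  else (if G.src e ∈ T then 1 else 0) * stepDown (s / min (G.len e) r) +
    (if G.tgt e ∈ T then 1 else 0) * stepDown ((G.len e - s) / min (G.len e) r)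

open Classical in
/-- The cutoff function with value `1` at the vertices in `T`. -/
def cutoffFun (G : MetricGraph V E) (T : Set V) (r : ℝ) : G.Point → ℝ
  | Point.vert v => if v ∈ T then 1 else 0
  | Point.inner e s _ => cutoffEdge G T r e s

section CutoffFun

variable {T : Set V} {r : ℝ}

theorem cutoffEdge_left (hr : 0 < r) (e : E) {s : ℝ}
    (h : s ≤ min (G.len e) r / 4) :
    cutoffEdge G T r e s = cutoffFun G T r (Point.vert (G.src e)) := by
  have hm : 0 < min (G.len e) r := lt_min (G.len_pos e) hr
  have h1 : stepDown (s / min (G.len e) r) = 1 :=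
    stepDown_eq_one (by rw [div_le_iff₀ hm]; linarith)
  have h2 : stepDown ((G.len e - s) / min (G.len e) r) = 0 :=
    stepDown_eq_zero (by rw [le_div_iff₀ hm]; linarith [min_le_left (G.len e) r])
  simp only [cutoffEdge, cutoffFun, h1, h2]
  split_ifs <;> simp_all

theorem cutoffEdge_right (hr : 0 < r) (e : E) {s : ℝ}
    (h : G.len e - min (G.len e) r / 4 ≤ s) :
    cutoffEdge G T r e s = cutoffFun G T r (Point.vert (G.tgt e)) := by
  have hm : 0 < min (G.len e) r := lt_min (G.len_pos e) hr
  have h1 : stepDown ((G.len e - s) / min (G.len e) r) = 1 :=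
    stepDown_eq_one (by rw [div_le_iff₀ hm]; linarith)
  have h2 : stepDown (s / min (G.len e) r) = 0 :=
    stepDown_eq_zero (by rw [le_div_iff₀ hm]; linarith [min_le_left (G.len e) r])
  simp only [cutoffEdge, cutoffFun, h1, h2]
  split_ifs <;> simp_all

theorem cutoffFun_pt (hr : 0 < r) (e : E) {s : ℝ} (hs : s ∈ Icc 0 (G.len e)) :
    cutoffFun G T r (G.pt e s) = cutoffEdge G T r e s := by
  have hm : 0 < min (G.len e) r := lt_min (G.len_pos e) hr
  rcases pt_mem_cases e hs with h | h | h
  · rw [pt_of_mem G e h]; rfl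
  · rw [cutoffEdge_left hr e (by linarith), h, pt_zero]
  · rw [cutoffEdge_right hr e (by linarith), h, pt_len]

theorem contDiff_cutoffEdge (e : E) : ContDiff ℝ 2 (cutoffEdge G T r e) := by
  unfold cutoffEdge
  by_cases h : G.src e ∈ T ∧ G.tgt e ∈ T ∧ G.len e < r
  · simp only [h, and_self, if_true]
    exact contDiff_const
  · simp only [h, if_false]
    refine (contDiff_const.mul (contDiff_stepDown.comp ?_)).add
      (contDiff_const.mul (contDiff_stepDown.comp ?_))
    · exact contDiff_id.div_const _
    · exact (contDiff_const.sub contDiff_id).div_const _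

theorem cutoffFun_nonneg (x : G.Point) : 0 ≤ cutoffFun G T r x := by
  rcases x with v | ⟨e, s, hs⟩
  · simp only [cutoffFun]; split_ifs <;> norm_num
  · have h1 := stepDown_nonneg (s / min (G.len e) r)
    have h2 := stepDown_nonneg ((G.len e - s) / min (G.len e) r)
    simp only [cutoffFun, cutoffEdge]
    split_ifs <;> simp <;> linarith

theorem cutoffFun_le_one (hr : 0 < r) (x : G.Point) : cutoffFun G T r x ≤ 1 := by
  rcases x with v | ⟨e, s, hs⟩
  · simp only [cutoffFun]; split_ifs <;> norm_num
  · have hm : 0 < min (G.len e) r := lt_min (G.len_pos e) hr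
    have h1 := stepDown_nonneg (s / min (G.len e) r)
    have h2 := stepDown_nonneg ((G.len e - s) / min (G.len e) r)
    have h3 := stepDown_le_one (s / min (G.len e) r)
    have h4 := stepDown_le_one ((G.len e - s) / min (G.len e) r)
    have h5 : stepDown (s / min (G.len e) r) + stepDown ((G.len e - s) / min (G.len e) r) ≤ 1 := by
      rcases le_total (min (G.len e) r / 2) s with h | h
      · rw [stepDown_eq_zero (x := s / _) (by rw [le_div_iff₀ hm]; linarith)]; linarith
      · rw [stepDown_eq_zero (x := (G.len e - s) / _)
          (by rw [le_div_iff₀ hm]; linarith [min_le_left (G.len e) r])]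
        linarith
    simp only [cutoffFun, cutoffEdge]
    split_ifs <;> simp <;> linarith

/-- Where the function is nonzero there is a vertex of `T` within distance `r` along the edge. -/
theorem cutoffFun_supp (hr : 0 < r) {A : Set G.Bar} (hT : ∀ v ∈ T, Point.vert v ∈ G.nbhd r A) {x : G.Point}
    (hx : cutoffFun G T r x ≠ 0) : x ∈ G.nbhd (r + r) A := by
  rcases x with v | ⟨e, s, hs⟩
  · have : v ∈ T := by
      by_contra h; simp [cutoffFun, h] at hx
    exact nbhd_mono (by linarith) _ (hT v this)
  · have hm : 0 < min (G.len e) r := lt_min (G.len_pos e) hr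
    have key : (G.src e ∈ T ∧ s ≤ r) ∨ (G.tgt e ∈ T ∧ G.len e - s ≤ r) := by
      by_contra hc
      push Not at hc
      have hc1 : G.src e ∈ T → stepDown (s / min (G.len e) r) = 0 := fun h =>
        stepDown_eq_zero (by
          rw [le_div_iff₀ hm]; linarith [hc.1 h, min_le_right (G.len e) r])
      have hc2 : G.tgt e ∈ T → stepDown ((G.len e - s) / min (G.len e) r) = 0 := fun h =>
        stepDown_eq_zero (by
          rw [le_div_iff₀ hm]; linarith [hc.2 h, min_le_right (G.len e) r])
      apply hx
      simp only [cutoffFun, cutoffEdge]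
      split_ifs with h1 h2 h3 h3
      · linarith [hc.1 h1.1, hs.2]
      · simp [hc1 h2, hc2 h3]
      · simp [hc1 h2]
      · simp [hc2 h3]
      · simp
    rcases key with ⟨h1, h2⟩ | ⟨h1, h2⟩
    · have h3 := hT _ h1
      rw [← pt_zero] at h3
      rw [← pt_of_mem G e hs]
      refine mem_nbhd_of_dist h3 ((dist_pt_le e 0 s).trans ?_)
      rw [zero_sub, abs_neg, abs_of_pos hs.1]; exact h2
    · have h3 := hT _ h1
      rw [← pt_len] at h3
      rw [← pt_of_mem G e hs]
      refine mem_nbhd_of_dist h3 ((dist_pt_le e (G.len e) s).trans ?_)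
      rw [abs_of_pos (by linarith [hs.2])]; exact h2

end CutoffFun

/-- Take the vertices within `r` of `A` as the set `T`. The support then lies within `2r` of `A`,
which is inside the `ε`-neighbourhood and away from the rest of the boundary. That the value is 1
near `A` is shown separately for the finitely many long edges, by compactness of each, and for the
short ones, whose ends all belong to `T` once a point of the edge is close to `A`. -/
theorem exists_isCutoff [CompactSpace G.Bar] {A : Set G.Bar} (hA : IsClosed A)
    (hA' : IsClosed (G.bdryBar \ A)) (hAb : A ⊆ G.bdryBar) {ε : ℝ} (hε : 0 < ε) :
    ∃ χ : G.Point → ℝ, IsCutoff A ε χ := by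
  obtain ⟨r₀, hr₀, hdis⟩ := (disjoint_sdiff_right : Disjoint A (G.bdryBar \ A)).exists_thickenings
    hA.isCompact hA'
  set r := min ε r₀ / 2 with hrdef
  have hr : 0 < r := by positivity
  have hrε : r + r ≤ ε := by rw [hrdef, add_halves]; exact min_le_left _ _
  have hrr₀ : r + r ≤ r₀ := by rw [hrdef, add_halves]; exact min_le_right _ _
  set T : Set V := {v | Point.vert v ∈ G.nbhd r A} with hT
  set χ := cutoffFun G T r with hχ
  have hpt : ∀ e, ∀ s ∈ Icc 0 (G.len e), χ (G.pt e s) = cutoffEdge G T r e s :=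
    fun e s hs => cutoffFun_pt hr e hs
  have hflat : ∀ e, ∃ τ > 0, (∀ s ∈ Icc 0 (G.len e), s ≤ τ → χ (G.pt e s) = χ (G.pt e 0)) ∧
      ∀ s ∈ Icc 0 (G.len e), G.len e - τ ≤ s → χ (G.pt e s) = χ (G.pt e (G.len e)) := by
    intro e
    refine ⟨min (G.len e) r / 4, by have := lt_min (G.len_pos e) hr; positivity,
      fun s hs h => ?_, fun s hs h => ?_⟩
    · rw [hpt e s hs, cutoffEdge_left hr e h, pt_zero]
    · rw [hpt e s hs, cutoffEdge_right hr e h, pt_len]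
  have hsupp : ∀ x, χ x ≠ 0 → x ∈ G.nbhd (r + r) A := fun x hx =>
    cutoffFun_supp hr (fun v hv => hv) hx
  have hcont : ∀ e, ContinuousOn (fun s => χ (G.pt e s)) (Icc 0 (G.len e)) := fun e =>
    (contDiff_cutoffEdge e).continuous.continuousOn.congr fun s hs => hpt e s hs
  have hzero : ∀ x ∈ G.nbhd r₀ (G.bdryBar \ A), χ x = 0 := by
    intro x hx
    by_contra h
    exact disjoint_left.1 hdis (nbhd_mono hrr₀ _ (hsupp x h)) hx
  have hone : ∃ ρ > 0, ∀ x ∈ G.nbhd ρ A, χ x = 1 := by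
    have hlong : ∀ e, ∃ ρ > 0, ∀ s ∈ Icc 0 (G.len e), G.pt e s ∈ G.nbhd ρ A →
        χ (G.pt e s) = 1 := by
      intro e
      obtain ⟨τ, hτ, hτ0, hτ1⟩ := hflat e
      -- The image of `Q` is compact and misses `A`: points inside `e` are not boundary points, and
      -- an endpoint lying in `A` has value 1, which `χ` keeps near that endpoint. So a
      -- neighbourhood of `A` avoids the part of `e` where `χ ≠ 1`.
      set Q : Set ℝ := closure {s ∈ Icc 0 (G.len e) | χ (G.pt e s) ≠ 1} with hQ
      have hQI : Q ⊆ Icc 0 (G.len e) := closure_minimal (sep_subset _ _) isClosed_Icc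
      have hQc : IsCompact Q := isCompact_Icc.of_isClosed_subset isClosed_closure hQI
      have hvA : ∀ v, ((Point.vert v : G.Point) : G.Bar) ∈ A → χ (Point.vert v) = 1 := by
        intro v hv
        have : v ∈ T := mem_nbhd_of_mem hr hv
        simp [hχ, cutoffFun, this]
      have hdQ : Disjoint ((fun s => ((G.pt e s : G.Point) : G.Bar)) '' Q) A := by
        rw [disjoint_left]
        rintro _ ⟨s, hs, rfl⟩ hsA
        rcases pt_mem_cases e (hQI hs) with h | h | h
        · exact inner_notMem_bdryBar h (hAb hsA)
        · subst h
          obtain ⟨s', hs', hd⟩ := Metric.mem_closure_iff.1 hs τ hτ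
          rw [Real.dist_eq, zero_sub, abs_neg] at hd
          refine hs'.2 ?_
          rw [hτ0 s' hs'.1 ((le_abs_self _).trans hd.le)]
          simp only [pt_zero] at hsA ⊢
          exact hvA _ hsA
        · subst h
          obtain ⟨s', hs', hd⟩ := Metric.mem_closure_iff.1 hs τ hτ
          rw [Real.dist_eq] at hd
          refine hs'.2 ?_
          rw [hτ1 s' hs'.1 (by linarith [le_abs_self (G.len e - s')])]
          simp only [pt_len] at hsA ⊢
          exact hvA _ hsA
      obtain ⟨ρ, hρ, hdis'⟩ := hdQ.exists_thickenings (isCompact_image_pt e hQc) hA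
      refine ⟨ρ, hρ, fun s hs hsn => ?_⟩
      by_contra hne
      refine disjoint_left.1 hdis' (Metric.self_subset_thickening hρ _ ?_) hsn
      exact mem_image_of_mem _ (subset_closure ⟨hs, hne⟩)
    have hfin := finite_long_edges (G := G) (half_pos hr)
    have hev : ∀ᶠ ρ in 𝓝[>] (0 : ℝ), ∀ e ∈ {e | r / 2 ≤ G.len e}, ∀ s ∈ Icc 0 (G.len e),
        G.pt e s ∈ G.nbhd ρ A → χ (G.pt e s) = 1 := by
      refine (eventually_all_finite hfin).2 fun e _ => ?_
      obtain ⟨ρ, hρ, h⟩ := hlong e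
      filter_upwards [mem_nhdsWithin_of_mem_nhds (Iic_mem_nhds hρ)] with ρ' hρ' s hs hsn
      exact h s hs (nbhd_mono hρ' _ hsn)
    obtain ⟨ρ, ⟨hρ1, hρ2⟩, hρ⟩ := ((hev.and (mem_nhdsWithin_of_mem_nhds
      (Iic_mem_nhds (half_pos hr)))).and self_mem_nhdsWithin).exists
    replace hρ2 : ρ ≤ r / 2 := hρ2
    refine ⟨ρ, hρ, fun x hx => ?_⟩
    rcases x with v | ⟨e, s, hs⟩
    · have : v ∈ T := nbhd_mono (by linarith) _ hx
      simp [hχ, cutoffFun, this]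
    · by_cases he : r / 2 ≤ G.len e
      · rw [← pt_of_mem G e hs] at hx ⊢
        exact hρ1 e he s (Ioo_subset_Icc_self hs) hx
      · push Not at he
        rw [← pt_of_mem G e hs] at hx
        -- The edge is shorter than `r / 2` and has a point within `ρ ≤ r / 2` of `A`, so both ends
        -- lie within `r` of `A` and `χ` is identically 1 on the edge.
        have h1 : G.src e ∈ T := by
          refine nbhd_mono (show ρ + r / 2 ≤ r by linarith) _ ?_
          rw [← pt_zero]
          refine mem_nbhd_of_dist hx ((dist_pt_le e s 0).trans ?_)
          rw [sub_zero, abs_of_pos hs.1]; linarith [hs.2]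
        have h2 : G.tgt e ∈ T := by
          refine nbhd_mono (show ρ + r / 2 ≤ r by linarith) _ ?_
          rw [← pt_len]
          refine mem_nbhd_of_dist hx ((dist_pt_le e s (G.len e)).trans ?_)
          rw [abs_of_neg (by linarith [hs.2])]; linarith [hs.1]
        have h3 : G.len e < r := by linarith
        simp [hχ, cutoffFun, cutoffEdge, h1, h2, h3]
  obtain ⟨ρ, hρ, hρ1⟩ := hone
  set ρ' := min ρ r₀ with hρ'
  have hρ'pos : 0 < ρ' := lt_min hρ hr₀
  have h1 : ∀ x ∈ G.nbhd ρ' A, χ x = 1 := fun x hx => hρ1 x (nbhd_mono (min_le_left _ _) _ hx)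
  have h0 : ∀ x ∈ G.nbhd ρ' (G.bdryBar \ A), χ x = 0 := fun x hx =>
    hzero x (nbhd_mono (min_le_right _ _) _ hx)
  refine ⟨χ, ⟨⟨fun e => ⟨_, contDiff_cutoffEdge e, hpt e⟩, hflat, ?_⟩, cutoffFun_nonneg,
    cutoffFun_le_one hr, ⟨ρ', hρ'pos, h1, h0⟩, fun x hx => nbhd_mono hrε _ (hsupp x hx)⟩⟩
  refine (finite_edges_not_near (G := G) hρ'pos).subset ?_
  rintro e ⟨s, hs, hne⟩
  by_contra hc
  simp only [mem_ofPred_eq, not_exists, not_and, not_not] at hc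
  -- On an edge contained in the `ρ'`-neighbourhood of the boundary `χ` takes only the values 0 and
  -- 1, so by the intermediate value theorem it is constant there.
  have h01 : ∀ t ∈ Icc 0 (G.len e), χ (G.pt e t) = 1 ∨ χ (G.pt e t) = 0 := by
    intro t ht
    obtain ⟨a, ha, hd⟩ := mem_nbhd.1 (hc t ht)
    by_cases haA : a ∈ A
    · exact Or.inl (h1 _ (mem_nbhd.2 ⟨a, haA, hd⟩))
    · exact Or.inr (h0 _ (mem_nbhd.2 ⟨a, ⟨ha, haA⟩, hd⟩))
  have hsub : uIcc s 0 ⊆ Icc 0 (G.len e) := ordConnected_Icc.uIcc_subset hs (zero_mem_Icc_len e)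
  have hmem : (1 / 2 : ℝ) ∈ uIcc (χ (G.pt e s)) (χ (G.pt e 0)) := by
    rcases h01 s hs with h | h <;> rcases h01 0 (zero_mem_Icc_len e) with h' | h'
    · exact absurd (h.trans h'.symm) hne
    · rw [h, h', uIcc_of_ge zero_le_one]; norm_num
    · rw [h, h', uIcc_of_le zero_le_one]; norm_num
    · exact absurd (h.trans h'.symm) hne
  obtain ⟨t, ht, hthalf⟩ := intermediate_value_uIcc ((hcont e).mono hsub) hmem
  replace hthalf : χ (G.pt e t) = 1 / 2 := hthalf
  rcases h01 t (hsub ht) with h | h <;> rw [h] at hthalf <;> norm_num at hthalf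

/-! ### Integration over the graph -/

theorem isOpen_nbhd (ε : ℝ) (A : Set G.Bar) : IsOpen (G.nbhd ε A) :=
  Metric.isOpen_thickening.preimage (UniformSpace.Completion.continuous_coe _)

theorem eventually_pt_mem_nbhd {ε : ℝ} {A : Set G.Bar} {e : E} {s : ℝ}
    (h : G.pt e s ∈ G.nbhd ε A) : ∀ᶠ t in 𝓝 s, G.pt e t ∈ G.nbhd ε A :=
  ((isOpen_nbhd ε A).preimage (continuous_pt e)).mem_nhds h

theorem measurable_of_edges {f : G.Point → ℝ}
    (h : ∀ e, ContinuousOn (fun s => f (G.pt e s)) (Icc 0 (G.len e))) : Measurable f := by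
  refine (measurable_point_iff f).2 fun e => ?_
  have h1 : Continuous fun s => f (G.pt e (max 0 (min s (G.len e)))) :=
    (h e).comp_continuous (by fun_prop) (clamp_mem e)
  simp only [pt_clamp] at h1
  exact h1.measurable

theorem edgeDeriv_eq_deriv (f : G.Point → ℝ) (e : E) {s : ℝ} (hs : s ∈ Ioo 0 (G.len e)) :
    edgeDeriv f e s = deriv (fun t => f (G.pt e t)) s :=
  derivWithin_of_mem_nhds (Icc_mem_nhds hs.1 hs.2)

theorem D1_pt (f : G.Point → ℝ) (e : E) {s : ℝ} (hs : s ∈ Ioo 0 (G.len e)) :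
    D1 f (G.pt e s) = deriv (fun t => f (G.pt e t)) s := by
  rw [pt_of_mem G e hs, ← edgeDeriv_eq_deriv f e hs]
  rfl

theorem D1_pt_eq_edgeDeriv (f : G.Point → ℝ) (e : E) {s : ℝ} (hs : s ∈ Ioo 0 (G.len e)) :
    D1 f (G.pt e s) = edgeDeriv f e s := by
  rw [pt_of_mem G e hs]
  rfl

theorem D2_pt (f : G.Point → ℝ) (e : E) {s : ℝ} (hs : s ∈ Ioo 0 (G.len e)) :
    D2 f (G.pt e s) = deriv (edgeDeriv f e) s := by
  rw [pt_of_mem G e hs]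
  rfl

theorem D1_vert (f : G.Point → ℝ) (v : V) : D1 f (Point.vert v) = 0 := rfl

/-- Every point that is not a vertex is of the form `pt e s`. -/
@[elab_as_elim]
theorem point_cases {p : G.Point → Prop} (hv : ∀ v, p (Point.vert v))
    (he : ∀ e, ∀ s ∈ Ioo 0 (G.len e), p (G.pt e s)) (x : G.Point) : p x := by
  rcases x with v | ⟨e, s, hs⟩
  · exact hv v
  · rw [← pt_of_mem G e hs]; exact he e s hs

theorem measurable_D1 (f : G.Point → ℝ) : Measurable (D1 f) := by
  have : D1 f = ofEdges fun e => deriv fun t => f (G.pt e t) := by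
    funext x
    induction x using point_cases with
    | hv v => rfl
    | he e s hs => ?_
    rw [D1_pt f e hs, pt_of_mem G e hs]
    rfl
  rw [this]
  exact measurable_ofEdges fun e => measurable_deriv _

theorem integral_edge {h : G.Point → ℝ} (hm : Measurable h) {u : ℝ → ℝ} {e : E}
    (hu : ∀ s ∈ Ioo 0 (G.len e), h (G.pt e s) = u s) :
    ∫ x, h x ∂((volume.restrict (Ioo 0 (G.len e))).map (G.pt e)) = ∫ s in 0..G.len e, u s := by
  rw [integral_map (measurable_pt e).aemeasurable hm.aestronglyMeasurable,
    intervalIntegral.integral_of_le (G.len_pos e).le, integral_Ioc_eq_integral_Ioo]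
  exact setIntegral_congr_fun measurableSet_Ioo hu

theorem integrable_edge {h : G.Point → ℝ} (hm : Measurable h) {u : ℝ → ℝ} {e : E}
    (hu : ∀ s ∈ Ioo 0 (G.len e), h (G.pt e s) = u s) :
    Integrable h ((volume.restrict (Ioo 0 (G.len e))).map (G.pt e)) ↔
      IntervalIntegrable u volume 0 (G.len e) := by
  rw [integrable_map_measure hm.aestronglyMeasurable (measurable_pt e).aemeasurable,
    intervalIntegrable_iff_integrableOn_Ioo_of_le (G.len_pos e).le]
  exact integrableOn_congr_fun hu measurableSet_Ioo

/-- Integration of functions that vanish outside of finitely many edges. -/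
theorem integral_vol_of_finite {h : G.Point → ℝ} (hm : Measurable h) {u : E → ℝ → ℝ}
    (hu : ∀ e, ∀ s ∈ Ioo 0 (G.len e), h (G.pt e s) = u e s) (F : Finset E)
    (h0 : ∀ e ∉ F, ∀ s ∈ Ioo 0 (G.len e), u e s = 0)
    (h1 : ∀ e ∈ F, IntervalIntegrable (u e) volume 0 (G.len e)) :
    Integrable h G.vol ∧ ∫ x, h x ∂G.vol = ∑ e ∈ F, ∫ s in 0..G.len e, u e s := by
  have := G.countable_edges
  have h0' : ∀ e ∉ F, ∀ s ∈ Ioo 0 (G.len e), h (G.pt e s) = (fun _ => (0 : ℝ)) s :=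
    fun e he s hs => by rw [hu e s hs, h0 e he s hs]
  have hint : Integrable h G.vol := by
    refine integrable_sum_measure (fun e => ?_) ?_
    · by_cases he : e ∈ F
      · exact (integrable_edge hm (hu e)).2 (h1 e he)
      · exact (integrable_edge hm (h0' e he)).2 (by simp)
    · refine summable_of_ne_finset_zero (s := F) fun e he => ?_
      rw [integral_edge (h := fun x => ‖h x‖) hm.norm (u := fun _ => 0)]
      · simp
      · intro s hs
        simp only [h0' e he s hs, norm_zero]
  refine ⟨hint, ?_⟩
  rw [vol, integral_sum_measure hint, tsum_eq_sum (s := F)]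
  · exact Finset.sum_congr rfl fun e _ => integral_edge hm (hu e)
  · intro e he
    rw [integral_edge hm (h0' e he)]
    simp

theorem memLp_of_finite {h : G.Point → ℝ} (hm : Measurable h) {F : Set E} (hF : F.Finite)
    (h0 : ∀ e ∉ F, ∀ s ∈ Ioo 0 (G.len e), h (G.pt e s) = 0)
    (h1 : ∀ e ∈ F, ∃ M, ∀ s ∈ Ioo 0 (G.len e), |h (G.pt e s)| ≤ M) : MemLp h 2 G.vol := by
  rw [memLp_two_iff_integrable_sq hm.aestronglyMeasurable]
  refine (integral_vol_of_finite (hm.pow_const 2) (u := fun e s => h (G.pt e s) ^ 2)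
    (fun _ _ _ => rfl) hF.toFinset (fun e he s hs => ?_) fun e he => ?_).1
  · rw [h0 e (by simpa using he) s hs]; norm_num
  · obtain ⟨M, hM⟩ := h1 e (by simpa using he)
    rw [intervalIntegrable_iff_integrableOn_Ioo_of_le (G.len_pos e).le]
    refine Measure.integrableOn_of_bounded (M := M ^ 2) (by simp)
      ((hm.comp (measurable_pt e)).pow_const 2).aestronglyMeasurable ?_
    refine (ae_restrict_iff' measurableSet_Ioo).2 (ae_of_all _ fun s hs => ?_)
    rw [norm_pow, Real.norm_eq_abs]
    exact pow_le_pow_left₀ (abs_nonneg _) (hM s hs) 2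

/-! ### Derivatives along the edges -/

/-- `f` is differentiable on every closed edge. -/
def EdgeDiff (f : G.Point → ℝ) : Prop :=
  ∀ e, DifferentiableOn ℝ (fun t => f (G.pt e t)) (Icc 0 (G.len e))

/-- `f` is absolutely continuous on every closed edge. -/
def EdgeAC (f : G.Point → ℝ) : Prop :=
  ∀ e, AbsolutelyContinuousOnInterval (fun t => f (G.pt e t)) 0 (G.len e)

theorem EdgeDiff.differentiableAt {f : G.Point → ℝ} (hf : EdgeDiff f) {e : E} {s : ℝ}
    (hs : s ∈ Ioo 0 (G.len e)) : DifferentiableAt ℝ (fun t => f (G.pt e t)) s :=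
  (hf e s (Ioo_subset_Icc_self hs)).differentiableAt (Icc_mem_nhds hs.1 hs.2)

theorem EdgeDiff.measurable {f : G.Point → ℝ} (hf : EdgeDiff f) : Measurable f :=
  measurable_of_edges fun e => (hf e).continuousOn

theorem EdgeAC.measurable {f : G.Point → ℝ} (hf : EdgeAC f) : Measurable f :=
  measurable_of_edges fun e => uIcc_of_le (G.len_pos e).le ▸ (hf e).continuousOn

theorem EdgeDiff.mul {f g : G.Point → ℝ} (hf : EdgeDiff f) (hg : EdgeDiff g) : EdgeDiff (f * g) :=
  fun e => (hf e).mul (hg e)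

theorem EdgeDiff.sub {f g : G.Point → ℝ} (hf : EdgeDiff f) (hg : EdgeDiff g) : EdgeDiff (f - g) :=
  fun e => (hf e).sub (hg e)

theorem EdgeDiff.const (c : ℝ) : EdgeDiff (fun _ : G.Point => c) :=
  fun _ => differentiableOn_const c

theorem EdgeDiff.sum {ι : Type*} {s : Finset ι} {f : ι → G.Point → ℝ}
    (hf : ∀ i ∈ s, EdgeDiff (f i)) : EdgeDiff (fun x => ∑ i ∈ s, f i x) :=
  fun e => DifferentiableOn.fun_sum fun i hi => hf i hi e

theorem EdgeAC.mul {f g : G.Point → ℝ} (hf : EdgeAC f) (hg : EdgeAC g) : EdgeAC (f * g) :=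
  fun e => (hf e).mul (hg e)

theorem D1_mul {f g : G.Point → ℝ} (hf : EdgeDiff f) (hg : EdgeDiff g) (x : G.Point) :
    D1 (f * g) x = D1 f x * g x + f x * D1 g x := by
  refine point_cases (fun v => ?_) (fun e s hs => ?_) x
  · simp [D1_vert]
  · rw [D1_pt _ e hs, D1_pt _ e hs, D1_pt _ e hs]
    exact deriv_mul (hf.differentiableAt hs) (hg.differentiableAt hs)

theorem D1_add {f g : G.Point → ℝ} (hf : EdgeDiff f) (hg : EdgeDiff g) (x : G.Point) :
    D1 (f + g) x = D1 f x + D1 g x := by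
  refine point_cases (fun v => ?_) (fun e s hs => ?_) x
  · simp [D1_vert]
  · rw [D1_pt _ e hs, D1_pt _ e hs, D1_pt _ e hs]
    exact deriv_add (hf.differentiableAt hs) (hg.differentiableAt hs)

theorem D1_sub {f g : G.Point → ℝ} (hf : EdgeDiff f) (hg : EdgeDiff g) (x : G.Point) :
    D1 (f - g) x = D1 f x - D1 g x := by
  refine point_cases (fun v => ?_) (fun e s hs => ?_) x
  · simp [D1_vert]
  · rw [D1_pt _ e hs, D1_pt _ e hs, D1_pt _ e hs]
    exact deriv_sub (hf.differentiableAt hs) (hg.differentiableAt hs)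

theorem D1_const (c : ℝ) (x : G.Point) : D1 (fun _ : G.Point => c) x = 0 := by
  refine point_cases (fun v => rfl) (fun e s hs => ?_) x
  rw [D1_pt _ e hs, deriv_const]

theorem D1_sum {ι : Type*} {s : Finset ι} {f : ι → G.Point → ℝ}
    (hf : ∀ i ∈ s, EdgeDiff (f i)) (x : G.Point) :
    D1 (fun x => ∑ i ∈ s, f i x) x = ∑ i ∈ s, D1 (f i) x := by
  refine point_cases (fun v => ?_) (fun e s hs => ?_) x
  · simp [D1_vert]
  · rw [D1_pt _ e hs]
    simp only [D1_pt _ e hs]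
    exact deriv_fun_sum fun i hi => (hf i hi).differentiableAt hs

theorem D1_const_mul (c : ℝ) (f : G.Point → ℝ) (x : G.Point) :
    D1 (fun x => c * f x) x = c * D1 f x := by
  refine point_cases (fun v => ?_) (fun e s hs => ?_) x
  · simp [D1_vert]
  · rw [D1_pt _ e hs, D1_pt _ e hs, deriv_const_mul_field]

/-- The derivative depends only on the values in an open set. -/
theorem D1_congr {f g : G.Point → ℝ} {U : Set G.Point} (hU : IsOpen U) (h : EqOn f g U)
    {x : G.Point} (hx : x ∈ U) : D1 f x = D1 g x := by
  revert hx
  refine point_cases (p := fun x => x ∈ U → D1 f x = D1 g x) (fun v _ => rfl)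
    (fun e s hs hx => ?_) x
  rw [D1_pt _ e hs, D1_pt _ e hs]
  refine Filter.EventuallyEq.deriv_eq ?_
  filter_upwards [(hU.preimage (continuous_pt e)).mem_nhds hx] with t ht using h ht

theorem D2_congr {f g : G.Point → ℝ} {U : Set G.Point} (hU : IsOpen U) (h : EqOn f g U)
    {x : G.Point} (hx : x ∈ U) : D2 f x = D2 g x := by
  revert hx
  refine point_cases (p := fun x => x ∈ U → D2 f x = D2 g x) (fun v _ => rfl)
    (fun e s hs hx => ?_) x
  rw [D2_pt _ e hs, D2_pt _ e hs]
  refine Filter.EventuallyEq.deriv_eq ?_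
  filter_upwards [(hU.preimage (continuous_pt e)).mem_nhds hx, Ioo_mem_nhds hs.1 hs.2] with t ht ht'
  have h1 := D1_congr hU h ht
  rwa [D1_pt _ e ht', D1_pt _ e ht', ← edgeDeriv_eq_deriv f e ht', ← edgeDeriv_eq_deriv g e ht']
    at h1

/-- Functions with absolutely continuous derivative on the edges that satisfy the vertex conditions
at the interior vertices. -/
structure IsRegular (φ : G.Point → ℝ) : Prop where
  diff : EdgeDiff φ
  ac : ∀ e, AbsolutelyContinuousOnInterval (edgeDeriv φ e) 0 (G.len e)
  kirchhoff : ∀ v ∉ G.bdry, vertexFlux φ v = 0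

theorem IsDmax.isRegular {φ : G.Point → ℝ} (h : G.IsDmax φ) : IsRegular φ :=
  ⟨h.diff, h.ac, h.kirchhoff⟩

/-- An absolutely continuous derivative is bounded on the closed edge, so `φ` is Lipschitz there. -/
theorem IsRegular.edgeAC {φ : G.Point → ℝ} (h : IsRegular φ) : EdgeAC φ := by
  intro e
  have hle := (G.len_pos e).le
  obtain ⟨M, hM⟩ := (h.ac e).exists_bound
  rw [uIcc_of_le hle] at hM
  refine LipschitzOnWith.absolutelyContinuousOnInterval (K := ⟨max M 0, le_max_right _ _⟩) ?_
  rw [uIcc_of_le hle]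
  refine (convex_Icc 0 (G.len e)).lipschitzOnWith_of_nnnorm_derivWithin_le (h.diff e) fun s hs => ?_
  exact (hM s hs).trans (le_max_left _ _)

theorem IsRegular.bound_D1 {φ : G.Point → ℝ} (h : IsRegular φ) (e : E) :
    ∃ M, ∀ s ∈ Ioo 0 (G.len e), |D1 φ (G.pt e s)| ≤ M := by
  obtain ⟨M, hM⟩ := (h.ac e).exists_bound
  refine ⟨M, fun s hs => ?_⟩
  have := hM s (uIcc_of_le (G.len_pos e).le ▸ Ioo_subset_Icc_self hs)
  rwa [D1_pt _ e hs, ← edgeDeriv_eq_deriv φ e hs]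

theorem EdgeAC.bound {φ : G.Point → ℝ} (h : EdgeAC φ) (e : E) :
    ∃ M, ∀ s ∈ Icc 0 (G.len e), |φ (G.pt e s)| ≤ M := by
  obtain ⟨M, hM⟩ := (h e).exists_bound
  exact ⟨M, fun s hs => hM s (uIcc_of_le (G.len_pos e).le ▸ hs)⟩

/-- Regroup the endpoint terms by vertices, separately for sources and targets so that loops count
twice. Where `ψ ≠ 0` all incident edges are in `F`, and the coefficient of `ψ(v)` is minus the flux
of `φ` at `v`, which vanishes by the vertex condition. -/
theorem sum_boundary_terms [CompactSpace G.Bar] {φ ψ : G.Point → ℝ} (hφ : IsRegular φ)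
    {F : Finset E} (hF : ∀ v, ψ (Point.vert v) ≠ 0 → v ∉ G.bdry ∧
      ∀ e, G.src e = v ∨ G.tgt e = v → e ∈ F) :
    ∑ e ∈ F, (edgeDeriv φ e (G.len e) * ψ (G.pt e (G.len e)) -
      edgeDeriv φ e 0 * ψ (G.pt e 0)) = 0 := by
  classical
  have key : ∀ (σ : E → V) (hσ : ∀ v, {e | σ e = v}.Finite) (a : E → ℝ) (W : Finset V),
      (∀ e ∈ F, σ e ∈ W) → (∀ v, ψ (Point.vert v) ≠ 0 → ∀ e, σ e = v → e ∈ F) →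
      ∑ e ∈ F, a e * ψ (Point.vert (σ e)) =
        ∑ v ∈ W, ψ (Point.vert v) * ∑ e ∈ (hσ v).toFinset, a e := by
    intro σ hσ a W hW h
    rw [← Finset.sum_fiberwise_of_maps_to hW]
    refine Finset.sum_congr rfl fun v _ => ?_
    by_cases hv : ψ (Point.vert v) = 0
    · rw [hv, zero_mul]
      refine Finset.sum_eq_zero fun e he => ?_
      rw [(Finset.mem_filter.1 he).2, hv, mul_zero]
    · rw [Finset.mul_sum]
      have : F.filter (fun e => σ e = v) = (hσ v).toFinset := by
        ext e
        simp only [Finset.mem_filter, Finite.mem_toFinset, mem_ofPred_eq, and_iff_right_iff_imp]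
        exact h v hv e
      rw [this]
      refine Finset.sum_congr rfl fun e he => ?_
      rw [show σ e = v by simpa using he, mul_comm]
  set W := F.image G.src ∪ F.image G.tgt with hW
  have h1 := key G.src G.finite_src (fun e => edgeDeriv φ e 0) W
    (fun e he => Finset.mem_union_left _ (Finset.mem_image_of_mem _ he))
    (fun v hv e he => (hF v hv).2 e (Or.inl he))
  have h2 := key G.tgt G.finite_tgt (fun e => edgeDeriv φ e (G.len e)) W
    (fun e he => Finset.mem_union_right _ (Finset.mem_image_of_mem _ he))
    (fun v hv e he => (hF v hv).2 e (Or.inr he))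
  simp only [pt_zero, pt_len, Finset.sum_sub_distrib]
  rw [h1, h2, ← Finset.sum_sub_distrib]
  refine Finset.sum_eq_zero fun v _ => ?_
  by_cases hv : ψ (Point.vert v) = 0
  · rw [hv, zero_mul, zero_mul, sub_zero]
  · have h3 := hφ.kirchhoff v (hF v hv).1
    rw [vertexFlux] at h3
    rw [← mul_sub, show (∑ e ∈ (G.finite_tgt v).toFinset, edgeDeriv φ e (G.len e)) -
      ∑ e ∈ (G.finite_src v).toFinset, edgeDeriv φ e 0 = 0 by linarith, mul_zero]

/-- Integration by parts against functions that vanish near the boundary. -/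
theorem integral_by_parts [CompactSpace G.Bar] {φ ψ : G.Point → ℝ} (hφ : IsRegular φ)
    (hψ : EdgeAC ψ) {ε : ℝ} (hε : 0 < ε) (h0 : ∀ x ∈ G.nbhd ε G.bdryBar, ψ x = 0) :
    Integrable (fun x => D1 φ x * D1 ψ x) G.vol ∧
      ∫ x, D2 φ x * ψ x ∂G.vol = -∫ x, D1 φ x * D1 ψ x ∂G.vol := by
  -- Off these finitely many edges `ψ` vanishes identically, so both integrals are finite sums and
  -- no convergence question arises.
  set F := (finite_edges_not_near (G := G) hε).toFinset with hF
  have hout : ∀ e ∉ F, ∀ s ∈ Icc 0 (G.len e), G.pt e s ∈ G.nbhd ε G.bdryBar := by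
    intro e he s hs
    by_contra hn
    exact he ((Finite.mem_toFinset _).2 ⟨s, hs, hn⟩)
  have hD1 : ∀ x ∈ G.nbhd ε G.bdryBar, D1 ψ x = 0 := fun x hx => by
    rw [D1_congr (isOpen_nbhd ε _) (g := fun _ => 0) h0 hx, D1_const]
  have hi2 := fun e => (hφ.ac e).intervalIntegrable_deriv.mul_continuousOn (hψ e).continuousOn
  have hi1 := fun e => (hψ e).intervalIntegrable_deriv.continuousOn_mul (hφ.ac e).continuousOn
  have h1 := (integral_vol_of_finite (h := fun x => D2 φ x * ψ x)
    ((measurable_D2 φ).mul hψ.measurable)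
    (u := fun e s => deriv (edgeDeriv φ e) s * ψ (G.pt e s))
    (fun e s hs => by rw [D2_pt _ e hs]) F
    (fun e he s hs => by rw [h0 _ (hout e he s (Ioo_subset_Icc_self hs)), mul_zero])
    (fun e _ => hi2 e)).2
  obtain ⟨hint, h2⟩ := integral_vol_of_finite (h := fun x => D1 φ x * D1 ψ x)
    ((measurable_D1 φ).mul (measurable_D1 ψ))
    (u := fun e s => edgeDeriv φ e s * deriv (fun t => ψ (G.pt e t)) s)
    (fun e s hs => by rw [D1_pt φ e hs, D1_pt ψ e hs, edgeDeriv_eq_deriv φ e hs]) F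
    (fun e he s hs => by
      rw [← D1_pt ψ e hs, hD1 _ (hout e he s (Ioo_subset_Icc_self hs)), mul_zero])
    (fun e _ => hi1 e)
  have h3 := sum_boundary_terms (ψ := ψ) hφ (F := F) (fun v hv => by
    have hvn : Point.vert v ∉ G.nbhd ε G.bdryBar := fun h => hv (h0 _ h)
    refine ⟨fun hb => hvn (mem_nbhd_of_mem hε (vert_mem_bdryBar hb)), fun e he => ?_⟩
    refine (Finite.mem_toFinset _).2 ?_
    rcases he with rfl | rfl
    · exact ⟨0, zero_mem_Icc_len e, by rwa [pt_zero]⟩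
    · exact ⟨G.len e, len_mem_Icc_len e, by rwa [pt_len]⟩)
  refine ⟨hint, ?_⟩
  rw [h1, h2, eq_neg_iff_add_eq_zero, ← Finset.sum_add_distrib]
  refine Eq.trans (Finset.sum_congr rfl fun e _ => ?_) h3
  have := AbsolutelyContinuousOnInterval.integral_mul_deriv_eq_deriv_mul (hφ.ac e) (hψ e)
  linarith

/-! ### Harmonic functions and cutoff functions -/

theorem IsHarmonic.exists_slope {k : G.Bar → ℝ} (hk : G.IsHarmonic k) (e : E) :
    ∃ b : ℝ, (∀ s ∈ Icc 0 (G.len e), ∀ t ∈ Icc 0 (G.len e),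
      k (G.pt e t : G.Point) = k (G.pt e s : G.Point) + b * (t - s)) ∧
      ∀ s ∈ Icc 0 (G.len e), edgeDeriv (fun x : G.Point => k x) e s = b := by
  obtain ⟨a, b, h⟩ := hk.affine e
  refine ⟨b, fun s hs t ht => by rw [h s hs, h t ht]; ring, fun s hs => ?_⟩
  rw [edgeDeriv, derivWithin_congr (f := fun t => a + b * t) (fun t ht => h t ht) (h s hs)]
  have h1 : HasDerivAt (fun t : ℝ => a + b * t) b s := by
    simpa using ((hasDerivAt_id s).const_mul b).const_add a
  exact h1.hasDerivWithinAt.derivWithin (uniqueDiffOn_Icc (G.len_pos e) s hs)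

theorem IsHarmonic.isRegular {k : G.Bar → ℝ} (hk : G.IsHarmonic k) :
    IsRegular fun x : G.Point => k x where
  diff e := by
    obtain ⟨a, b, h⟩ := hk.affine e
    refine DifferentiableOn.congr (f := fun t => a + b * t) ?_ (fun t ht => h t ht)
    fun_prop
  ac e := by
    obtain ⟨b, -, h⟩ := hk.exists_slope e
    refine ac_congr (f := fun _ => b)
      (contDiff_const.contDiffOn).absolutelyContinuousOnInterval fun s hs => ?_
    rw [uIcc_of_le (G.len_pos e).le] at hs
    exact h s hs
  kirchhoff := hk.kirchhoff

theorem IsHarmonic.D2_eq_zero {k : G.Bar → ℝ} (hk : G.IsHarmonic k) (x : G.Point) :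
    D2 (fun x : G.Point => k x) x = 0 := by
  induction x using point_cases with
  | hv v => rfl
  | he e s hs =>
    obtain ⟨b, -, h⟩ := hk.exists_slope e
    have h1 : edgeDeriv (fun x : G.Point => k x) e =ᶠ[𝓝 s] fun _ => b := by
      filter_upwards [Icc_mem_nhds hs.1 hs.2] with t ht using h t ht
    rw [D2_pt _ e hs, h1.deriv_eq, deriv_const]

theorem IsFlat.edgeDiff {χ : G.Point → ℝ} (hχ : IsFlat χ) : EdgeDiff χ := by
  intro e
  obtain ⟨g, hg, h⟩ := hχ.smooth e
  exact (hg.differentiable (by norm_num)).differentiableOn.congr fun s hs => h s hs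

theorem IsFlat.edgeAC {χ : G.Point → ℝ} (hχ : IsFlat χ) : EdgeAC χ := by
  intro e
  obtain ⟨g, hg, h⟩ := hχ.smooth e
  refine ac_congr ((hg.of_le (by norm_num)).contDiffOn.absolutelyContinuousOnInterval) fun s hs => ?_
  rw [uIcc_of_le (G.len_pos e).le] at hs
  exact h s hs

theorem IsFlat.bound_D1 {χ : G.Point → ℝ} (hχ : IsFlat χ) (e : E) :
    ∃ M, ∀ s ∈ Ioo 0 (G.len e), |D1 χ (G.pt e s)| ≤ M := by
  obtain ⟨g, hg, h⟩ := hχ.smooth e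
  obtain ⟨M, hM⟩ := isCompact_Icc.exists_bound_of_continuousOn
    (s := Icc 0 (G.len e)) (hg.continuous_deriv (by norm_num)).continuousOn
  refine ⟨M, fun s hs => ?_⟩
  have h1 : (fun t => χ (G.pt e t)) =ᶠ[𝓝 s] g := by
    filter_upwards [Icc_mem_nhds hs.1 hs.2] with t ht using h t ht
  rw [D1_pt _ e hs, h1.deriv_eq]
  exact hM s (Ioo_subset_Icc_self hs)

theorem IsFlat.D1_eq_zero {χ : G.Point → ℝ} {e : E}
    (he : e ∉ {e | ∃ s ∈ Icc 0 (G.len e), χ (G.pt e s) ≠ χ (G.pt e 0)}) {s : ℝ}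
    (hs : s ∈ Ioo 0 (G.len e)) : D1 χ (G.pt e s) = 0 := by
  have h1 : (fun t => χ (G.pt e t)) =ᶠ[𝓝 s] fun _ => χ (G.pt e 0) := by
    filter_upwards [Icc_mem_nhds hs.1 hs.2] with t ht
    by_contra hne
    exact he ⟨t, ht, hne⟩
  rw [D1_pt _ e hs, h1.deriv_eq, deriv_const]

theorem bound_D1_mul {f g : G.Point → ℝ} {e : E} (hf : EdgeDiff f) (hg : EdgeDiff g)
    (hf' : EdgeAC f) (hg' : EdgeAC g)
    (h1 : ∃ M, ∀ s ∈ Ioo 0 (G.len e), |D1 f (G.pt e s)| ≤ M)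
    (h2 : ∃ M, ∀ s ∈ Ioo 0 (G.len e), |D1 g (G.pt e s)| ≤ M) :
    ∃ M, ∀ s ∈ Ioo 0 (G.len e), |D1 (f * g) (G.pt e s)| ≤ M := by
  obtain ⟨M₁, h1⟩ := h1
  obtain ⟨M₂, h2⟩ := h2
  obtain ⟨M₃, h3⟩ := hf'.bound e
  obtain ⟨M₄, h4⟩ := hg'.bound e
  refine ⟨M₁ * M₄ + M₃ * M₂, fun s hs => ?_⟩
  have hs' := Ioo_subset_Icc_self hs
  rw [D1_mul hf hg]
  refine (abs_add_le _ _).trans (add_le_add ?_ ?_) <;> rw [abs_mul]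
  · exact mul_le_mul (h1 s hs) (h4 s hs') (abs_nonneg _) ((abs_nonneg _).trans (h1 s hs))
  · exact mul_le_mul (h3 s hs') (h2 s hs) (abs_nonneg _) ((abs_nonneg _).trans (h3 s hs'))

/-- In the product rule `k'χ` is dominated by `k'`, and `kχ'` is bounded on each of finitely many
edges and zero on the others. -/
theorem IsCutoff.memLp_D1_mul {A : Set G.Bar} {ε : ℝ} {χ k : G.Point → ℝ} (hχ : IsCutoff A ε χ)
    (hk : IsRegular k) (hk' : MemLp (D1 k) 2 G.vol) : MemLp (D1 (k * χ)) 2 G.vol := by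
  have hflat := hχ.toIsFlat
  have h1 : MemLp (fun x => D1 k x * χ x) 2 G.vol := by
    refine hk'.of_le ((measurable_D1 k).mul hflat.edgeDiff.measurable).aestronglyMeasurable
      (ae_of_all _ fun x => ?_)
    rw [norm_mul]
    refine mul_le_of_le_one_right (norm_nonneg _) ?_
    rw [Real.norm_eq_abs, abs_of_nonneg (hχ.nonneg x)]
    exact hχ.le_one x
  have h2 : MemLp (fun x => k x * D1 χ x) 2 G.vol := by
    refine memLp_of_finite (hk.diff.measurable.mul (measurable_D1 χ)) hflat.finite
      (fun e he s hs => ?_) fun e _ => ?_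
    · rw [IsFlat.D1_eq_zero he hs, mul_zero]
    · obtain ⟨M₁, h1⟩ := hk.edgeAC.bound e
      obtain ⟨M₂, h2⟩ := hflat.bound_D1 e
      refine ⟨M₁ * M₂, fun s hs => ?_⟩
      have h3 := h1 s (Ioo_subset_Icc_self hs)
      rw [abs_mul]
      exact mul_le_mul h3 (h2 s hs) (abs_nonneg _) ((abs_nonneg _).trans h3)
  exact (memLp_congr_ae (ae_of_all _ fun x => D1_mul hk.diff hflat.edgeDiff x)).2 (h1.add h2)

/-- The boundary contribution `-∫ k' (k χ)'` to the quadratic form, for a function that equals `k`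
near the support of the cutoff function `χ`. -/
def excess (k : G.Bar → ℝ) (χ : G.Point → ℝ) : ℝ :=
  -∫ x, D1 (fun x : G.Point => k x) x * D1 ((fun x : G.Point => k x) * χ) x ∂G.vol

/-! ### The quadratic form of functions that are multiples of harmonic functions near the boundary -/

/-- A finite partition of the boundary by closed sets. -/
structure IsBdryFamily {ι : Type*} (A : ι → Set G.Bar) : Prop where
  closed : ∀ i, IsClosed (A i)
  cover : ⋃ i, A i = G.bdryBar
  disjoint : ∀ i j, i ≠ j → Disjoint (A i) (A j)

theorem IsBdryFamily.subset {ι : Type*} {A : ι → Set G.Bar} (hA : IsBdryFamily A) (i : ι) :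
    A i ⊆ G.bdryBar := hA.cover ▸ subset_iUnion A i

theorem IsBdryFamily.closed_diff {ι : Type*} [Finite ι] {A : ι → Set G.Bar} (hA : IsBdryFamily A)
    (i : ι) : IsClosed (G.bdryBar \ A i) := by
  have : G.bdryBar \ A i = ⋃ j ∈ {j | j ≠ i}, A j := by
    ext z
    simp only [← hA.cover, Set.mem_sdiff, mem_iUnion, mem_ofPred_eq, exists_prop]
    constructor
    · rintro ⟨⟨j, hj⟩, hi⟩
      exact ⟨j, fun h => hi (h ▸ hj), hj⟩
    · rintro ⟨j, hji, hj⟩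
      exact ⟨⟨j, hj⟩, fun hi => disjoint_left.1 (hA.disjoint j i hji) hj hi⟩
  rw [this]
  exact (toFinite _).isClosed_biUnion fun j _ => hA.closed j

section Family

variable {ι : Type*} {A : ι → Set G.Bar} {h : ι → G.Bar → ℝ}
  {χ : ι → G.Point → ℝ} {ε : ℝ}

/-- Near `A i` the function `χ i` is 1 and all the others vanish; a common radius exists because the
family is finite. -/
theorem IsBdryFamily.exists_near [Fintype ι] (hA : IsBdryFamily A) (hχ : ∀ i, IsCutoff (A i) (ε / 2) (χ i)) :
    ∃ ρ > 0, ∀ x ∈ G.nbhd ρ G.bdryBar, ∑ i, χ i x = 1 := by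
  classical
  choose ρ hρ h1 h0 using fun i => (hχ i).near
  obtain ⟨r, hr, hrρ⟩ : ∃ r > 0, ∀ i, r ≤ ρ i := by
    have : ∀ᶠ r in 𝓝[>] (0 : ℝ), ∀ i, r ≤ ρ i :=
      eventually_all.2 fun i => mem_nhdsWithin_of_mem_nhds (Iic_mem_nhds (hρ i))
    obtain ⟨r, h1, h2⟩ := (this.and self_mem_nhdsWithin).exists
    exact ⟨r, h2, h1⟩
  refine ⟨r, hr, fun x hx => ?_⟩
  obtain ⟨a, ha, hd⟩ := mem_nbhd.1 hx
  rw [← hA.cover] at ha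
  obtain ⟨i, hi⟩ := mem_iUnion.1 ha
  rw [Finset.sum_eq_single i]
  · exact h1 i x (nbhd_mono (hrρ i) _ (mem_nbhd.2 ⟨a, hi, hd⟩))
  · intro j _ hji
    refine h0 j x (nbhd_mono (hrρ j) _ (mem_nbhd.2 ⟨a, ⟨hA.subset i hi, fun hj => ?_⟩, hd⟩))
    exact disjoint_left.1 (hA.disjoint j i hji) hj hi
  · simp

theorem D1_mul_cutoff {φ : G.Point → ℝ} {c : ℝ} {i : ι} (hε : 0 < ε)
    (hχ : IsCutoff (A i) (ε / 2) (χ i)) (hφ : ∀ x ∈ G.nbhd ε (A i), φ x = c * h i x)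
    (x : G.Point) : D1 (φ * χ i) x = c * D1 ((fun x : G.Point => h i x) * χ i) x := by
  rw [← D1_const_mul]
  congr 1
  funext y
  by_cases hy : χ i y = 0
  · simp [hy]
  · simp only [Pi.mul_apply]
    rw [hφ y (nbhd_mono (by linarith) _ (hχ.supp y hy)), mul_assoc]

/-- Inside the `ε`-neighbourhood `φ` is the multiple of `h i`. Outside it the gap between `ε / 2`
and `ε` leaves a ball on which `χ i` vanishes, so the derivative of the product vanishes too. -/
theorem D1_mul_D1_cutoff {φ : G.Point → ℝ} {c : ℝ} {i : ι} (hε : 0 < ε)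
    (hχ : IsCutoff (A i) (ε / 2) (χ i)) (hφ : ∀ x ∈ G.nbhd ε (A i), φ x = c * h i x)
    (x : G.Point) : D1 φ x * D1 ((fun x : G.Point => h i x) * χ i) x =
      c * D1 (fun x : G.Point => h i x) x * D1 ((fun x : G.Point => h i x) * χ i) x := by
  by_cases hx : x ∈ G.nbhd ε (A i)
  · rw [D1_congr (isOpen_nbhd _ _) (g := fun x : G.Point => c * h i x) hφ hx, D1_const_mul]
  · have h0 : EqOn ((fun x : G.Point => h i x) * χ i) (fun _ => 0) (Metric.ball x (ε / 2)) := by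
      intro y hy
      have : χ i y = 0 := by
        by_contra hne
        refine hx ?_
        rw [← add_halves ε]
        exact mem_nbhd_of_dist (hχ.supp y hne) (le_of_lt hy)
      simp [this]
    rw [D1_congr Metric.isOpen_ball h0 (Metric.mem_ball_self (half_pos hε)), D1_const, mul_zero,
      mul_zero]

/-- Functions that are multiples of finite energy harmonic functions near each set of a partition of
the boundary have finite energy. -/
theorem memLp_D1_of_family [CompactSpace G.Bar] [Fintype ι] (hA : IsBdryFamily A)
    (hh : ∀ i, G.IsFiniteEnergyHarmonic (h i))
    (hε : 0 < ε) {φ : G.Point → ℝ} (hφ : IsRegular φ) {c : ι → ℝ}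
    (hc : ∀ i, ∀ x ∈ G.nbhd ε (A i), φ x = c i * h i x) :
    MemLp (D1 φ) 2 G.vol ∧ ∀ χ : ι → G.Point → ℝ, (∀ i, IsCutoff (A i) (ε / 2) (χ i)) →
      MemLp (D1 (φ * fun x => 1 - ∑ i, χ i x)) 2 G.vol ∧
      ∀ x, D1 φ x = D1 (φ * fun x => 1 - ∑ i, χ i x) x +
        ∑ i, c i * D1 ((fun x : G.Point => h i x) * χ i) x := by
  have main : ∀ χ : ι → G.Point → ℝ, (∀ i, IsCutoff (A i) (ε / 2) (χ i)) →
      MemLp (D1 (φ * fun x => 1 - ∑ i, χ i x)) 2 G.vol ∧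
      ∀ x, D1 φ x = D1 (φ * fun x => 1 - ∑ i, χ i x) x +
        ∑ i, c i * D1 ((fun x : G.Point => h i x) * χ i) x := by
    intro χ hχ
    have hd : ∀ i ∈ Finset.univ, EdgeDiff (φ * χ i) := fun i _ =>
      hφ.diff.mul (hχ i).toIsFlat.edgeDiff
    have hη : EdgeDiff fun x => 1 - ∑ i, χ i x :=
      (EdgeDiff.const 1).sub (EdgeDiff.sum fun i _ => (hχ i).toIsFlat.edgeDiff)
    -- The first summand vanishes near the boundary and so is supported on finitely many edges; each
    -- of the others is a multiple of `h i * χ i`.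
    have hdec : φ = φ * (fun x => 1 - ∑ i, χ i x) + fun x => ∑ i, (φ * χ i) x := by
      funext x
      simp only [Pi.add_apply, Pi.mul_apply, ← Finset.mul_sum]
      ring
    have hD : ∀ x, D1 φ x = D1 (φ * fun x => 1 - ∑ i, χ i x) x + ∑ i, D1 (φ * χ i) x := by
      intro x
      conv_lhs => rw [hdec]
      rw [D1_add (hφ.diff.mul hη) (EdgeDiff.sum hd), D1_sum hd]
    refine ⟨?_, fun x => ?_⟩
    · obtain ⟨ρ, hρ, hρ1⟩ := hA.exists_near hχ
      have h0 : ∀ x ∈ G.nbhd ρ G.bdryBar, (φ * fun x => 1 - ∑ i, χ i x) x = 0 := by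
        intro x hx
        simp [hρ1 x hx]
      refine memLp_of_finite (measurable_D1 _) (finite_edges_not_near (G := G) hρ)
        (fun e he s hs => ?_) fun e _ => ?_
      · have hx : G.pt e s ∈ G.nbhd ρ G.bdryBar := by
          by_contra hn
          exact he ⟨s, Ioo_subset_Icc_self hs, hn⟩
        rw [D1_congr (isOpen_nbhd _ _) (g := fun _ => 0) h0 hx, D1_const]
      · obtain ⟨M₀, hM₀⟩ := hφ.bound_D1 e
        choose M hM using fun i => bound_D1_mul hφ.diff (hχ i).toIsFlat.edgeDiff hφ.edgeAC
          (hχ i).toIsFlat.edgeAC (hφ.bound_D1 e) ((hχ i).toIsFlat.bound_D1 e)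
        refine ⟨M₀ + ∑ i, M i, fun s hs => ?_⟩
        have h1 := hD (G.pt e s)
        rw [← sub_eq_iff_eq_add] at h1
        rw [← h1]
        refine (abs_sub _ _).trans (add_le_add (hM₀ s hs) ?_)
        exact (Finset.abs_sum_le_sum_abs _ _).trans (Finset.sum_le_sum fun i _ => hM i s hs)
    · rw [hD]
      congr 1
      exact Finset.sum_congr rfl fun i _ => D1_mul_cutoff hε (hχ i) (hc i) x
  refine ⟨?_, main⟩
  choose χ hχ using fun i => exists_isCutoff (hA.closed i) (hA.closed_diff i) (hA.subset i)
    (half_pos hε)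
  obtain ⟨h1, h2⟩ := main χ hχ
  refine (memLp_congr_ae (ae_of_all _ h2)).2 (h1.add (memLp_finsetSum _ fun i _ => ?_))
  exact ((hχ i).memLp_D1_mul (hh i).1.isRegular (hh i).2.2).const_mul (c i)

/-- The form of `-D²` for functions that are multiples of harmonic functions near each set of
a partition of the boundary. -/
theorem integral_D2_mul_of_family [CompactSpace G.Bar] [Fintype ι] (hA : IsBdryFamily A)
    (hh : ∀ i, G.IsFiniteEnergyHarmonic (h i))
    (hε : 0 < ε) (hχ : ∀ i, IsCutoff (A i) (ε / 2) (χ i)) {φ ψ : G.Point → ℝ} (hφ : IsRegular φ)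
    (hψ : IsRegular ψ) {c d : ι → ℝ} (hc : ∀ i, ∀ x ∈ G.nbhd ε (A i), φ x = c i * h i x)
    (hd : ∀ i, ∀ x ∈ G.nbhd ε (A i), ψ x = d i * h i x) :
    -∫ x, D2 φ x * ψ x ∂G.vol =
      ∫ x, D1 φ x * D1 ψ x ∂G.vol + ∑ i, c i * d i * excess (h i) (χ i) := by
  set η : G.Point → ℝ := fun x => 1 - ∑ i, χ i x with hη
  obtain ⟨hφ1, -⟩ := memLp_D1_of_family hA hh hε hφ hc
  obtain ⟨hψ1, hψ2⟩ := memLp_D1_of_family hA hh hε hψ hd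
  obtain ⟨hψη, hDψ⟩ := hψ2 χ hχ
  obtain ⟨ρ, hρ, hρ1⟩ := hA.exists_near hχ
  have hηac : EdgeAC η := by
    intro e
    have h1 : AbsolutelyContinuousOnInterval (fun _ : ℝ => (1 : ℝ)) 0 (G.len e) :=
      (contDiff_const.contDiffOn).absolutelyContinuousOnInterval
    have h2 : ∀ s : Finset ι,
        AbsolutelyContinuousOnInterval (fun t => ∑ i ∈ s, χ i (G.pt e t)) 0 (G.len e) := by
      classical
      intro s
      induction s using Finset.induction_on with
      | empty =>
        simp only [Finset.sum_empty]
        exact (contDiff_const.contDiffOn).absolutelyContinuousOnInterval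
      | insert i s hi ih =>
        simp only [Finset.sum_insert hi]
        exact ((hχ i).toIsFlat.edgeAC e).add ih
    exact h1.sub (h2 _)
  have hibp := (integral_by_parts hφ (hψ.edgeAC.mul hηac) hρ (fun x hx => by
    simp [hη, hρ1 x hx])).2
  -- Where `η ≠ 1` some cutoff function is nonzero, so `φ` is locally a multiple of a harmonic
  -- function and φ'' = 0. Thus `ψ` may be replaced by `ψ * η`, which vanishes near the boundary and
  -- admits integration by parts.
  have h1 : ∀ x, D2 φ x * ψ x = D2 φ x * (ψ * η) x := by
    intro x
    by_cases hx : ∀ i, χ i x = 0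
    · simp [hη, hx]
    · push Not at hx
      obtain ⟨i, hi⟩ := hx
      have hxi : x ∈ G.nbhd ε (A i) := nbhd_mono (by linarith) _ ((hχ i).supp x hi)
      have : D2 φ x = 0 := by
        rw [D2_congr (isOpen_nbhd _ _) (g := c i • fun x : G.Point => h i x) (hc i) hxi, D2_smul,
          Pi.smul_apply, (hh i).1.D2_eq_zero, smul_zero]
      rw [this, zero_mul, zero_mul]
  -- The derivative pairing, unlike the left side, does notice the removed pieces of `ψ`: their
  -- contributions are the excess terms.
  have h2 : ∀ x, D1 φ x * D1 ψ x = D1 φ x * D1 (ψ * η) x +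
      ∑ i, c i * d i * (D1 (fun x : G.Point => h i x) x *
        D1 ((fun x : G.Point => h i x) * χ i) x) := by
    intro x
    rw [hDψ x, mul_add, Finset.mul_sum]
    congr 1
    refine Finset.sum_congr rfl fun i _ => ?_
    have := D1_mul_D1_cutoff hε (hχ i) (hc i) x
    rw [mul_left_comm, this]
    ring
  have hint1 : Integrable (fun x => D1 φ x * D1 (ψ * η) x) G.vol := hφ1.integrable_mul hψη
  have hint2 : ∀ i ∈ Finset.univ, Integrable (fun x => c i * d i *
      (D1 (fun x : G.Point => h i x) x * D1 ((fun x : G.Point => h i x) * χ i) x)) G.vol :=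
    fun i _ => ((hh i).2.2.integrable_mul
      ((hχ i).memLp_D1_mul (hh i).1.isRegular (hh i).2.2)).const_mul _
  rw [integral_congr_ae (ae_of_all _ h1), integral_congr_ae (ae_of_all _ h2), hibp,
    integral_add hint1 (integrable_finsetSum _ hint2), integral_finsetSum _ hint2]
  simp only [integral_const_mul, excess, mul_neg, Finset.sum_neg_distrib, neg_neg]
  ring

end Family

/-! ### The boundary contribution of Robin functions -/

theorem IsHarmonic.continuous_point {k : G.Bar → ℝ} (hk : G.IsHarmonic k) :
    Continuous fun x : G.Point => k x :=
  hk.cont.comp (UniformSpace.Completion.continuous_coe _)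

/-- Between a value of `k` near `A` and the constant value on `A` there is a regular value that is
attained near `A`. -/
theorem IsHarmonic.exists_regular {k : G.Bar → ℝ} (hk : G.IsHarmonic k) {A : Set G.Bar} {C ρ : ℝ}
    (hC : ∀ z ∈ A, k z = C) {x : G.Point} (hx : x ∈ G.nbhd ρ A) (hxC : k x ≠ C) :
    ∃ e, ∃ s ∈ Ioo 0 (G.len e), G.pt e s ∈ G.nbhd ρ A ∧
      G.IsRegularValue k (k (G.pt e s : G.Point)) ∧
      (k x < k (G.pt e s : G.Point) ∧ k (G.pt e s : G.Point) < C ∨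
        C < k (G.pt e s : G.Point) ∧ k (G.pt e s : G.Point) < k x) := by
  obtain ⟨a, ha, hd⟩ := mem_nbhd.1 hx
  -- The slack is spent in thirds: a path of length below dist(x, a) + δ/3 that starts within δ/3 of
  -- `a` stays inside the `ρ`-neighbourhood.
  set δ := ρ - dist (x : G.Bar) a with hδ
  have hδ0 : 0 < δ := sub_pos.2 hd
  have hq : 0 < |k x - C| := abs_pos.2 (sub_ne_zero.2 hxC)
  obtain ⟨r, hr, hrk⟩ := Metric.continuous_iff.1 hk.cont a |k x - C| hq
  obtain ⟨p, hp⟩ := exists_dist_lt a (lt_min hr (show 0 < δ / 3 by positivity))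
  have hp1 : |k p - C| < |k x - C| := by
    have := hrk p (by rw [dist_comm]; exact hp.trans_le (min_le_left _ _))
    rwa [Real.dist_eq, hC a ha] at this
  have hp2 : dist a (p : G.Bar) < δ / 3 := hp.trans_le (min_le_right _ _)
  obtain ⟨L, hL, hpath⟩ := exists_pathLength_lt (p := p) (q := x)
    (r := dist (x : G.Bar) a + δ / 3) (by
      rw [← UniformSpace.Completion.dist_eq, dist_comm]
      have := dist_triangle (x : G.Bar) a p
      linarith)
  -- A value that is not regular, though attained, is a vertex value or the constant value on an
  -- edge of slope zero, which is its value at coordinate 0. There are countably many of these, so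
  -- they can be avoided in every open interval.
  set bad : Set ℝ := range (fun v : V => k (Point.vert v : G.Point)) ∪
    range (fun e : E => k (G.pt e 0 : G.Point)) with hbad
  have hbadc : bad.Countable := by
    have := G.countable_vertices
    have := G.countable_edges
    exact (countable_range _).union (countable_range _)
  have key : ∀ t ∉ bad, ∀ e, ∀ s ∈ Icc 0 (G.len e), k (G.pt e s : G.Point) = t →
      dist p (G.pt e s) ≤ L → s ∈ Ioo 0 (G.len e) ∧ G.pt e s ∈ G.nbhd ρ A ∧
        G.IsRegularValue k t := by
    intro t ht e s hs hst hdist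
    have hreg : ∀ v, k (Point.vert v : G.Point) ≠ t := fun v hv => ht (Or.inl ⟨v, hv⟩)
    refine ⟨?_, ?_, ⟨_, hst⟩, hreg, fun e' s' hs' hk' h0 => ?_⟩
    · rcases pt_mem_cases e hs with h | h | h
      · exact h
      · rw [h, pt_zero] at hst; exact absurd hst (hreg _)
      · rw [h, pt_len] at hst; exact absurd hst (hreg _)
    · refine mem_nbhd.2 ⟨a, ha, ?_⟩
      have h1 := dist_triangle (G.pt e s : G.Bar) p a
      rw [UniformSpace.Completion.dist_eq, dist_comm _ p, dist_comm (p : G.Bar) a] at h1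
      linarith
    · obtain ⟨b, hb, hb'⟩ := hk.exists_slope e'
      have hs'I := Ioo_subset_Icc_self hs'
      rw [hb' s' hs'I] at h0
      have h1 := hb 0 (zero_mem_Icc_len e') s' hs'I
      rw [h0, zero_mul, add_zero, hk'] at h1
      exact ht (Or.inr ⟨e', h1.symm⟩)
  rcases lt_or_gt_of_ne hxC with hlt | hgt
  · rw [abs_of_neg (sub_neg.2 hlt)] at hp1
    have hxp : k x < k p := by linarith [neg_abs_le (k p - C)]
    obtain ⟨t, ht, htb⟩ := (hbadc.dense_compl ℝ).exists_mem_open isOpen_Ioo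
      (nonempty_Ioo.2 (lt_min hxp hlt))
    have htb := htb
    obtain ⟨e, s, hs, hst, hdist⟩ := (PathLength.symm G hpath).exists_eq hk.continuous_point htb.1
      (htb.2.trans_le (min_le_left _ _))
    obtain ⟨h1, h2, h3⟩ := key t ht e s hs hst (by
      rw [dist_comm]; linarith [dist_nonneg (x := x) (y := G.pt e s)])
    refine ⟨e, s, h1, h2, hst ▸ h3, Or.inl ?_⟩
    rw [hst]
    exact ⟨htb.1, htb.2.trans_le (min_le_right _ _)⟩
  · rw [abs_of_pos (sub_pos.2 hgt)] at hp1
    have hxp : k p < k x := by linarith [le_abs_self (k p - C)]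
    obtain ⟨t, ht, htb⟩ := (hbadc.dense_compl ℝ).exists_mem_open isOpen_Ioo
      (nonempty_Ioo.2 (max_lt hxp hgt))
    obtain ⟨e, s, hs, hst, hdist⟩ := hpath.exists_eq hk.continuous_point
      ((le_max_left _ _).trans_lt htb.1) htb.2
    obtain ⟨h1, h2, h3⟩ := key t ht e s hs hst (by
      linarith [dist_nonneg (x := G.pt e s) (y := x)])
    refine ⟨e, s, h1, h2, hst ▸ h3, Or.inr ?_⟩
    rw [hst]
    exact ⟨(le_max_right _ _).trans_lt htb.1, htb.2⟩

theorem exists_nbhd_subset [CompactSpace G.Bar] {A : Set G.Bar} (hA : IsClosed A)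
    {U : Set G.Bar} (hU : IsOpen U) (h : A ⊆ U) : ∃ ρ > 0, ∀ x ∈ G.nbhd ρ A, (x : G.Bar) ∈ U := by
  obtain ⟨ρ, hρ, hsub⟩ := hA.isCompact.exists_thickening_subset_open hU h
  exact ⟨ρ, hρ, fun x hx => hsub hx⟩

/-- A value below `C` near `A` would give a regular value `t < C` attained near `A`. The far side of
that level is `{k ≤ t}`, so the edge direction in which `k` decreases enters the far side, and there
the normal derivative is negative, against the sign condition. -/
theorem IsRobinFunction.exists_ge [CompactSpace G.Bar] {A : Set G.Bar} (hA : IsClosed A)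
    {k : G.Bar → ℝ} {C : ℝ} (hk : G.IsRobinFunction A k C) :
    ∃ ε > 0, ∀ x ∈ G.nbhd ε A, C ≤ k x := by
  have hharm := hk.finite_energy.1
  obtain ⟨ε, hε, η, hη, hpos⟩ := hk.normal_deriv_pos
  obtain ⟨ρ, hρ, hρη⟩ := exists_nbhd_subset (G := G) hA
    (isOpen_lt (hharm.cont.sub continuous_const).abs continuous_const :
      IsOpen {z : G.Bar | |k z - C| < η})
    (fun z hz => by simpa [hk.const z hz] using hη)
  refine ⟨min ε ρ, lt_min hε hρ, fun x hx => ?_⟩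
  by_contra hlt
  push Not at hlt
  obtain ⟨e, s, hs, hmem, hreg, hval⟩ := hharm.exists_regular hk.const hx hlt.ne
  have hval' : k (G.pt e s : G.Point) < C := by
    rcases hval with h | h
    · exact h.2
    · exact absurd (h.1.trans h.2) hlt.not_gt
  set t := k (G.pt e s : G.Point) with ht
  have hsI := Ioo_subset_Icc_self hs
  obtain ⟨b, hb, hb'⟩ := hharm.exists_slope e
  have hb0 : b ≠ 0 := hb' s hsI ▸ hreg.2.2 e s hs rfl
  -- Moving by `r` in direction `σ` changes `k` by `σ * b * r`, which is nonpositive, while `C - t >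
  -- 0`.
  have hfar : ∀ σ : ℝ, σ * b ≤ 0 →
      ∀ᶠ r in 𝓝[>] (0 : ℝ), G.pt e (s + σ * r) ∈ G.farSide k C t := by
    intro σ hσ
    have hcont : Tendsto (fun r : ℝ => s + σ * r) (𝓝 0) (𝓝 s) := by
      have : Continuous fun r : ℝ => s + σ * r := by fun_prop
      simpa using this.tendsto 0
    filter_upwards [mem_nhdsWithin_of_mem_nhds (hcont.eventually (Icc_mem_nhds hs.1 hs.2)),
      self_mem_nhdsWithin] with r hr hr0
    have h1 := hb s hsI _ hr
    have hr0' : 0 < r := hr0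
    change (k _ - t) * (C - t) ≤ 0
    rw [h1, ← ht]
    have h2 : t + b * (s + σ * r - s) - t = (σ * b) * r := by ring
    rw [h2]
    exact mul_nonpos_of_nonpos_of_nonneg (mul_nonpos_of_nonpos_of_nonneg hσ hr0'.le)
      (by linarith)
  have hgen : ∀ σ : ℝ, (σ = 1 ∨ σ = -1) → σ * b ≤ 0 → False := by
    intro σ hσ hσb
    have := hpos t hval'.ne (hρη _ (nbhd_mono (min_le_right _ _) _ hmem)) hreg e s hs
      (nbhd_mono (min_le_left _ _) _ hmem) rfl σ hσ (hfar σ hσb)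
    rw [hb' s hsI] at this
    linarith
  rcases lt_or_gt_of_ne hb0 with h | h
  · exact hgen 1 (Or.inl rfl) (by linarith)
  · exact hgen (-1) (Or.inr rfl) (by linarith)

/-! ### Lower bound for the excess by truncation -/

section Excess

variable {A : Set G.Bar} {k : G.Bar → ℝ} {C ε ε₁ : ℝ} {χ : G.Point → ℝ}

/-- The function is affine on the segment of radius `η` about `s` and stays at least `C` there. On
one side it drops by `|b| * η`, which therefore cannot exceed `k - C`. -/
theorem abs_slope_mul_le (hk : G.IsHarmonic k) (hge : ∀ x ∈ G.nbhd ε₁ A, C ≤ k x)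
    (hsupp : ∀ x, χ x ≠ 0 → x ∈ G.nbhd ε A) {e : E} {s η : ℝ} (hs : s ∈ Icc 0 (G.len e))
    (hη : 0 < η) (hη1 : ε + η ≤ ε₁) (hη2 : η ≤ s) (hη3 : η ≤ G.len e - s)
    (hχ : χ (G.pt e s) ≠ 0) :
    |edgeDeriv (fun x : G.Point => k x) e s| * η ≤ k (G.pt e s : G.Point) - C := by
  obtain ⟨b, hb, hb'⟩ := hk.exists_slope e
  have hmem : ∀ t, |s - t| ≤ η → G.pt e t ∈ G.nbhd ε₁ A := fun t ht =>
    nbhd_mono hη1 _ (mem_nbhd_of_dist (hsupp _ hχ) ((dist_pt_le e s t).trans ht))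
  have h1 := hge _ (hmem (s + η) (by rw [sub_add_cancel_left, abs_neg, abs_of_pos hη]))
  have h2 := hge _ (hmem (s - η) (by rw [sub_sub_cancel, abs_of_pos hη]))
  rw [hb s hs (s + η) ⟨by linarith [hs.1], by linarith⟩] at h1
  rw [hb s hs (s - η) ⟨by linarith, by linarith [hs.2]⟩] at h2
  rw [hb' s hs]
  rcases abs_cases b with h | h <;> rw [h.1] <;> nlinarith

/-- At an inner point of an edge this is a local minimum of an affine function, so the slope is
zero; at vertices the derivative is 0 by convention. -/
theorem D1_eq_zero_of_le (hk : G.IsHarmonic k) (hge : ∀ x ∈ G.nbhd ε₁ A, C ≤ k x)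
    (hε : ε < ε₁) (hsupp : ∀ x, χ x ≠ 0 → x ∈ G.nbhd ε A) {x : G.Point} (hx : χ x ≠ 0)
    (hxC : k x ≤ C) : D1 (fun x : G.Point => k x) x = 0 := by
  revert hx hxC
  induction x using point_cases with
  | hv v => exact fun _ _ => rfl
  | he e s hs =>
    intro hx hxC
    obtain ⟨η, ⟨⟨h1, h2⟩, h3⟩, h4⟩ : ∃ η : ℝ, ((ε + η ≤ ε₁ ∧ η ≤ s) ∧ η ≤ G.len e - s) ∧ 0 < η :=
      ⟨min (ε₁ - ε) (min s (G.len e - s)),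
        ⟨⟨by linarith [min_le_left (ε₁ - ε) (min s (G.len e - s))],
          (min_le_right _ _).trans (min_le_left _ _)⟩, (min_le_right _ _).trans (min_le_right _ _)⟩,
        lt_min (sub_pos.2 hε) (lt_min hs.1 (sub_pos.2 hs.2))⟩
    have h5 := abs_slope_mul_le hk hge hsupp (Ioo_subset_Icc_self hs) h4 h1 h2 h3 hx
    have h6 : |edgeDeriv (fun x : G.Point => k x) e s| * η ≤ 0 := by linarith
    rw [D1_pt_eq_edgeDeriv _ e hs]
    exact abs_nonpos_iff.1 (nonpos_of_mul_nonpos_left h6 h4)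

/-- Where a cutoff function and the Robin function both vary, the Robin function is bounded away from
its boundary value. -/
theorem IsCutoff.exists_threshold (hχ : IsCutoff A ε χ) (hk : G.IsHarmonic k)
    (hge : ∀ x ∈ G.nbhd ε₁ A, C ≤ k x) (hε : ε < ε₁) :
    ∃ s₀ > 0, ∀ x : G.Point, k x < C + s₀ → D1 (fun x : G.Point => k x) x * D1 χ x = 0 := by
  have hev : ∀ᶠ s₀ in 𝓝[>] (0 : ℝ), ∀ e ∈ {e | ∃ s ∈ Icc 0 (G.len e), χ (G.pt e s) ≠ χ (G.pt e 0)},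
      ∀ s ∈ Ioo 0 (G.len e), k (G.pt e s : G.Point) < C + s₀ →
        D1 (fun x : G.Point => k x) (G.pt e s) * D1 χ (G.pt e s) = 0 := by
    refine (eventually_all_finite hχ.finite).2 fun e _ => ?_
    obtain ⟨τ, hτ, hτ0, hτ1⟩ := hχ.flat e
    obtain ⟨b, hb, hb'⟩ := hk.exists_slope e
    by_cases hb0 : b = 0
    · refine Eventually.of_forall fun s₀ s hs _ => ?_
      rw [D1_pt_eq_edgeDeriv _ e hs, hb' s (Ioo_subset_Icc_self hs), hb0, zero_mul]
    -- Where χ' ≠ 0 the point is at least `τ` away from both ends, and the support of `χ` leaves the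
    -- room `ε₁ - ε`, so `k - C ≥ |b| * η` there. Only finitely many edges matter, which keeps the
    -- threshold positive.
    · set η := min τ (ε₁ - ε) with hη
      have hη0 : 0 < η := lt_min hτ (sub_pos.2 hε)
      have hbη : 0 < |b| * η := mul_pos (abs_pos.2 hb0) hη0
      filter_upwards [mem_nhdsWithin_of_mem_nhds (Iic_mem_nhds hbη)] with s₀ hs₀ s hs hlt
      replace hs₀ : s₀ ≤ |b| * η := hs₀
      have hsI := Ioo_subset_Icc_self hs
      by_contra hne
      have hD : D1 χ (G.pt e s) ≠ 0 := right_ne_zero_of_mul hne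
      rw [D1_pt _ e hs] at hD
      have hs1 : τ ≤ s := by
        by_contra h
        push Not at h
        refine hD ?_
        have h1 : (fun t => χ (G.pt e t)) =ᶠ[𝓝 s] fun _ => χ (G.pt e 0) := by
          filter_upwards [Icc_mem_nhds hs.1 hs.2, Iic_mem_nhds h] with t ht ht' using hτ0 t ht ht'
        rw [h1.deriv_eq, deriv_const]
      have hs2 : s ≤ G.len e - τ := by
        by_contra h
        push Not at h
        refine hD ?_
        have h1 : (fun t => χ (G.pt e t)) =ᶠ[𝓝 s] fun _ => χ (G.pt e (G.len e)) := by
          filter_upwards [Icc_mem_nhds hs.1 hs.2, Ici_mem_nhds h] with t ht ht' using hτ1 t ht ht'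
        rw [h1.deriv_eq, deriv_const]
      -- A zero of the nonnegative function `χ` is a minimum, so the derivative would vanish there.
      have hχs : χ (G.pt e s) ≠ 0 := by
        intro h0
        refine hD (IsLocalMin.deriv_eq_zero (Eventually.of_forall fun t => ?_))
        simp only [h0]
        exact hχ.nonneg _
      have h1 := abs_slope_mul_le hk hge hχ.supp hsI hη0
        (by linarith [min_le_right τ (ε₁ - ε)]) (by linarith [min_le_left τ (ε₁ - ε)])
        (by linarith [min_le_left τ (ε₁ - ε)]) hχs
      rw [hb' s hsI] at h1
      linarith
  obtain ⟨s₀, h1, h2⟩ := (hev.and self_mem_nhdsWithin).exists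
  refine ⟨s₀, h2, fun x hx => ?_⟩
  revert hx
  induction x using point_cases with
  | hv v => exact fun _ => by simp [D1_vert]
  | he e s hs =>
    intro hx
    by_cases he : e ∈ {e | ∃ s ∈ Icc 0 (G.len e), χ (G.pt e s) ≠ χ (G.pt e 0)}
    · exact h1 e he s hs hx
    · rw [IsFlat.D1_eq_zero he hs, mul_zero]

/-- The energy density of `k`, weighted with the cutoff function. -/
def weight (k : G.Bar → ℝ) (χ : G.Point → ℝ) (x : G.Point) : ℝ :=
  χ x * D1 (fun x : G.Point => k x) x ^ 2

theorem IsCutoff.weight_nonneg (hχ : IsCutoff A ε χ) (x : G.Point) : 0 ≤ weight k χ x :=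
  mul_nonneg (hχ.nonneg x) (sq_nonneg _)

theorem IsCutoff.measurable_weight (hχ : IsCutoff A ε χ) : Measurable (weight k χ) :=
  hχ.toIsFlat.edgeDiff.measurable.mul ((measurable_D1 _).pow_const 2)

theorem IsCutoff.integrable_weight (hχ : IsCutoff A ε χ) (hk : G.IsFiniteEnergyHarmonic k) :
    Integrable (weight k χ) G.vol := by
  refine hk.2.2.integrable_sq.mono' hχ.measurable_weight.aestronglyMeasurable
    (ae_of_all _ fun x => ?_)
  rw [Real.norm_eq_abs, abs_of_nonneg (hχ.weight_nonneg x)]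
  exact mul_le_of_le_one_left (sq_nonneg _) (hχ.le_one x)

theorem IsHarmonic.measurable_point {k : G.Bar → ℝ} (hk : G.IsHarmonic k) :
    Measurable fun x : G.Point => k x := hk.isRegular.diff.measurable

theorem ae_ne_of_slope_ne_zero {k : G.Bar → ℝ} {e : E} {b : ℝ} (hb0 : b ≠ 0)
    (hb : ∀ s ∈ Icc 0 (G.len e), ∀ t ∈ Icc 0 (G.len e),
      k (G.pt e t : G.Point) = k (G.pt e s : G.Point) + b * (t - s)) (y : ℝ) :
    ∀ᵐ s : ℝ, s ∈ Ioo 0 (G.len e) → k (G.pt e s : G.Point) ≠ y := by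
  have h1 : {s | s ∈ Ioo 0 (G.len e) ∧ k (G.pt e s : G.Point) = y}.Subsingleton := by
    rintro s ⟨hs, hsy⟩ t ⟨ht, hty⟩
    have := hb s (Ioo_subset_Icc_self hs) t (Ioo_subset_Icc_self ht)
    rw [hsy, hty] at this
    have h2 : b * (t - s) = 0 := by linarith
    linarith [(mul_eq_zero.1 h2).resolve_left hb0]
  filter_upwards [measure_eq_zero_iff_ae_notMem.1 (h1.measure_zero volume)] with s hs hs' hy
  exact hs ⟨hs', hy⟩

/-- The truncation of `k` used as test function: `0` for `k ≤ C + s₁`, `k` for `k ≥ C + s₀`, and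
linear in between. -/
def truncation (C s₀ s₁ y : ℝ) : ℝ :=
  max (min ((C + s₀) / (s₀ - s₁) * (y - (C + s₁))) y) 0

theorem lipschitz_truncation (C s₀ s₁ : ℝ) : ∃ K, LipschitzWith K (truncation C s₀ s₁) := by
  have h1 : ∃ K, LipschitzWith K fun y : ℝ => (C + s₀) / (s₀ - s₁) * (y - (C + s₁)) := by
    refine ⟨‖(C + s₀) / (s₀ - s₁)‖₊, LipschitzWith.of_dist_le_mul fun y z => ?_⟩
    rw [Real.dist_eq, Real.dist_eq, ← mul_sub, abs_mul, sub_sub_sub_cancel_right]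
    rfl
  obtain ⟨K, hK⟩ := h1
  exact ⟨_, (hK.min LipschitzWith.id).max_const 0⟩

section Truncation

variable {s₀ s₁ y : ℝ}

theorem truncation_of_le (hC : 0 < C) (h1 : 0 < s₁) (h10 : s₁ < s₀) (hy : y ≤ C + s₁) : truncation C s₀ s₁ y = 0 := by
  refine max_eq_right ((min_le_left _ _).trans ?_)
  refine mul_nonpos_of_nonneg_of_nonpos (div_nonneg (by linarith) (by linarith)) (by linarith)

/-- The linear piece is steeper than the identity and meets it at `C + s₀`, so it is the smaller of
the two below that point and the larger above it. -/
theorem truncation_of_between (hC : 0 < C) (h1 : 0 < s₁) (h10 : s₁ < s₀) (hy : C + s₁ ≤ y)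
    (hy' : y ≤ C + s₀) :
    truncation C s₀ s₁ y = (C + s₀) / (s₀ - s₁) * (y - (C + s₁)) := by
  have h2 : 0 < s₀ - s₁ := sub_pos.2 h10
  rw [truncation, min_eq_left, max_eq_left]
  · exact mul_nonneg (div_nonneg (by linarith) h2.le) (by linarith)
  · rw [div_mul_eq_mul_div, div_le_iff₀ h2]
    nlinarith

theorem truncation_of_ge (hC : 0 < C) (h1 : 0 < s₁) (h10 : s₁ < s₀) (hy : C + s₀ ≤ y) : truncation C s₀ s₁ y = y := by
  have h2 : 0 < s₀ - s₁ := sub_pos.2 h10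
  rw [truncation, min_eq_right, max_eq_left]
  · linarith
  · rw [div_mul_eq_mul_div, le_div_iff₀ h2]
    nlinarith

end Truncation

/-- By continuity `k < C + s₁` near `A`, so the truncation vanishes there; near the rest of the
boundary `χ` vanishes. The product is thus an admissible test function, and k'' = 0. -/
theorem integral_by_parts_truncation [CompactSpace G.Bar] (hA : IsClosed A)
    (hχ : IsCutoff A ε χ) (hk : G.IsHarmonic k) (hC : 0 < C) (hconst : ∀ z ∈ A, k z = C)
    {s₀ s₁ : ℝ} (h1 : 0 < s₁) (h10 : s₁ < s₀) :
    Integrable (fun x => D1 (fun x : G.Point => k x) x *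
      D1 ((fun x : G.Point => truncation C s₀ s₁ (k x)) * χ) x) G.vol ∧
    ∫ x, D1 (fun x : G.Point => k x) x *
      D1 ((fun x : G.Point => truncation C s₀ s₁ (k x)) * χ) x ∂G.vol = 0 := by
  have hac : EdgeAC fun x : G.Point => truncation C s₀ s₁ (k x) := by
    intro e
    obtain ⟨K, hK⟩ := lipschitz_truncation C s₀ s₁
    obtain ⟨b, hb, -⟩ := hk.exists_slope e
    have h2 : LipschitzOnWith ‖b‖₊ (fun t => k (G.pt e t : G.Point)) (Icc 0 (G.len e)) := by
      refine LipschitzOnWith.of_dist_le_mul fun s hs t ht => ?_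
      rw [hb t ht s hs, Real.dist_eq, add_sub_cancel_left, abs_mul, Real.dist_eq]
      rfl
    have h3 := hK.comp_lipschitzOnWith h2
    rw [← uIcc_of_le (G.len_pos e).le] at h3
    exact h3.absolutelyContinuousOnInterval
  obtain ⟨ρ, hρ, hρ1, hρ0⟩ := hχ.near
  obtain ⟨r, hr, hrk⟩ := exists_nbhd_subset (G := G) hA
    (isOpen_lt hk.cont continuous_const : IsOpen {z : G.Bar | k z < C + s₁})
    (fun z hz => by simpa [hconst z hz] using h1)
  obtain ⟨hint, heq⟩ := integral_by_parts hk.isRegular (hac.mul hχ.toIsFlat.edgeAC)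
    (lt_min hρ hr) (fun x hx => by
      obtain ⟨a, ha, hd⟩ := mem_nbhd.1 hx
      simp only [Pi.mul_apply]
      by_cases haA : a ∈ A
      · have : k x < C + s₁ := hrk x (nbhd_mono (min_le_right _ _) _ (mem_nbhd.2 ⟨a, haA, hd⟩))
        rw [truncation_of_le hC h1 h10 this.le, zero_mul]
      · rw [hρ0 x (nbhd_mono (min_le_left _ _) _ (mem_nbhd.2 ⟨a, ⟨ha, haA⟩, hd⟩)), mul_zero])
  refine ⟨hint, ?_⟩
  rw [← neg_eq_zero, ← heq]
  simp [hk.D2_eq_zero]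

/-- Below `C + s₀` the terms with k'χ' drop out and the right side is the weight times T' - 1, where
`T` is the truncation: -1 below `C + s₁`, at least `C / s₀` in the band. Above `C + s₀` it is 0. The
two levels `C + s₁` and `C + s₀` are null sets on edges of nonzero slope, and on edges of slope zero
both sides vanish. -/
theorem excess_density_ge (hχ : IsCutoff A ε χ) (hk : G.IsHarmonic k) (hC : 0 < C)
    {s₀ s₁ : ℝ} (h1 : 0 < s₁) (h10 : s₁ < s₀)
    (hs₀ : ∀ x : G.Point, k x < C + s₀ → D1 (fun x : G.Point => k x) x * D1 χ x = 0) :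
    ∀ᵐ x ∂G.vol, C / s₀ * {x : G.Point | k x < C + s₀}.indicator (weight k χ) x -
        (1 + C / s₀) * {x : G.Point | k x ≤ C + s₁}.indicator (weight k χ) x ≤
      D1 (fun x : G.Point => k x) x * D1 ((fun x : G.Point => truncation C s₀ s₁ (k x)) * χ) x -
        D1 (fun x : G.Point => k x) x * D1 ((fun x : G.Point => k x) * χ) x := by
  have hkm := hk.measurable_point
  have hkd := hk.isRegular.diff
  have hχd := hχ.toIsFlat.edgeDiff
  have hkc := hk.continuous_point
  have hs0 : 0 < s₀ := h1.trans h10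
  refine ae_vol_of_edges (measurableSet_le ?_ ?_) fun e => ?_
  · exact ((hχ.measurable_weight.indicator (measurableSet_lt hkm measurable_const)).const_mul _).sub
      ((hχ.measurable_weight.indicator (measurableSet_le hkm measurable_const)).const_mul _)
  · exact ((measurable_D1 _).mul (measurable_D1 _)).sub ((measurable_D1 _).mul (measurable_D1 _))
  obtain ⟨b, hb, hb'⟩ := hk.exists_slope e
  by_cases hb0 : b = 0
  · refine ae_of_all _ fun s hs => ?_
    have h0 : D1 (fun x : G.Point => k x) (G.pt e s) = 0 := by
      rw [D1_pt_eq_edgeDeriv _ e hs, hb' s (Ioo_subset_Icc_self hs), hb0]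
    have hw : weight k χ (G.pt e s) = 0 := by rw [weight, h0]; ring
    have hi : ∀ S : Set G.Point, S.indicator (weight k χ) (G.pt e s) = 0 := fun S => by
      by_cases hS : G.pt e s ∈ S
      · rw [indicator_of_mem hS, hw]
      · rw [indicator_of_notMem hS]
    rw [h0, hi, hi]
    simp
  filter_upwards [ae_ne_of_slope_ne_zero hb0 hb (C + s₁), ae_ne_of_slope_ne_zero hb0 hb (C + s₀)]
    with s hne1 hne0 hs
  replace hne1 := hne1 hs
  replace hne0 := hne0 hs
  generalize G.pt e s = x at hne1 hne0
  have hmul := D1_mul hkd hχd x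
  rcases lt_or_gt_of_ne hne1 with hlt | hgt
  · have h2 : D1 ((fun x : G.Point => truncation C s₀ s₁ (k x)) * χ) x = 0 := by
      rw [D1_congr (isOpen_lt hkc continuous_const) (g := fun _ => 0) (fun y hy => ?_) hlt,
        D1_const]
      simp [truncation_of_le hC h1 h10 (le_of_lt hy)]
    have h3 := hs₀ x (by linarith)
    rw [h2, hmul, indicator_of_mem (show x ∈ {x : G.Point | k x < C + s₀} by
      simp only [mem_ofPred_eq]; linarith), indicator_of_mem (show x ∈ {x : G.Point | k x ≤ C + s₁}
      from hlt.le), weight]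
    refine le_of_eq ?_
    linear_combination (k x) * h3
  · rw [indicator_of_notMem (show x ∉ {x : G.Point | k x ≤ C + s₁} from hgt.not_ge), mul_zero,
      sub_zero]
    rcases lt_or_gt_of_ne hne0 with hlt | hgt'
    · have h2 : D1 ((fun x : G.Point => truncation C s₀ s₁ (k x)) * χ) x =
          (C + s₀) / (s₀ - s₁) * D1 (fun x : G.Point => k x) x * χ x +
            (C + s₀) / (s₀ - s₁) * (k x - (C + s₁)) * D1 χ x := by
        have hU : IsOpen {x : G.Point | C + s₁ < k x ∧ k x < C + s₀} :=
          (isOpen_lt continuous_const hkc).inter (isOpen_lt hkc continuous_const)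
        let m : G.Point → ℝ := (fun x : G.Point => k x) - fun _ => C + s₁
        have hd : EdgeDiff m := hkd.sub (EdgeDiff.const _)
        have hd' : EdgeDiff fun x => (C + s₀) / (s₀ - s₁) * m x := (EdgeDiff.const _).mul hd
        have hm : D1 m x = D1 (fun x : G.Point => k x) x := by
          rw [D1_sub hkd (EdgeDiff.const _), D1_const, sub_zero]
        rw [D1_congr hU (g := (fun x => (C + s₀) / (s₀ - s₁) * m x) * χ)
          (fun y hy => ?_) ⟨hgt, hlt⟩, D1_mul hd' hχd, D1_const_mul, hm]
        · rfl
        · simp [m, truncation_of_between hC h1 h10 (le_of_lt hy.1) (le_of_lt hy.2)]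
      have h3 := hs₀ x hlt
      rw [h2, hmul, indicator_of_mem (show x ∈ {x : G.Point | k x < C + s₀} from hlt)]
      -- The right side is (C + s₁)/(s₀ - s₁).
      have hα : C / s₀ ≤ (C + s₀) / (s₀ - s₁) - 1 := by
        rw [div_sub_one (by linarith), div_le_div_iff₀ hs0 (by linarith)]
        nlinarith
      have h4 := mul_le_mul_of_nonneg_right hα (hχ.weight_nonneg (k := k) x)
      refine h4.trans (le_of_eq ?_)
      rw [weight]
      linear_combination (k x - (C + s₀) / (s₀ - s₁) * (k x - (C + s₁))) * h3
    · rw [indicator_of_notMem (show x ∉ {x : G.Point | k x < C + s₀} from hgt'.not_gt), mul_zero,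
        D1_congr (isOpen_lt continuous_const hkc)
        (f := (fun x : G.Point => truncation C s₀ s₁ (k x)) * χ) (g := (fun x : G.Point => k x) * χ)
        (fun y hy => ?_) hgt', sub_self]
      simp [truncation_of_ge hC h1 h10 (le_of_lt hy)]

/-- The lower bound for the boundary contribution of a Robin function. -/
theorem IsCutoff.exists_excess_ge [CompactSpace G.Bar] (hA : IsClosed A) (hχ : IsCutoff A ε χ)
    (hk : G.IsFiniteEnergyHarmonic k) (hC : 0 < C) (hconst : ∀ z ∈ A, k z = C)
    (hge : ∀ x ∈ G.nbhd ε₁ A, C ≤ k x) (hε : ε < ε₁) :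
    ∃ s₀ > 0, C / s₀ * ∫ x, {x : G.Point | k x < C + s₀}.indicator (weight k χ) x ∂G.vol ≤
      excess k χ := by
  obtain ⟨s₀, hs0, hs₀⟩ := hχ.exists_threshold hk.1 hge hε
  refine ⟨s₀, hs0, ?_⟩
  have hkm := hk.1.measurable_point
  have hwi := hχ.integrable_weight hk
  have hI : ∀ S : Set G.Point, MeasurableSet S → Integrable (S.indicator (weight k χ)) G.vol :=
    fun S hS => hwi.indicator hS
  have hlt_m : MeasurableSet {x : G.Point | k x < C + s₀} := measurableSet_lt hkm measurable_const
  have hle_m : ∀ s₁, MeasurableSet {x : G.Point | k x ≤ C + s₁} := fun s₁ =>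
    measurableSet_le hkm measurable_const
  -- The sets shrink to `{k ≤ C}` as `s₁ → 0`, and there the weight is zero by `D1_eq_zero_of_le`.
  have hlim : Tendsto (fun s₁ => ∫ x, {x : G.Point | k x ≤ C + s₁}.indicator (weight k χ) x ∂G.vol)
      (𝓝[>] 0) (𝓝 0) := by
    have hzero : (𝓝 (0 : ℝ)) = 𝓝 (∫ _ : G.Point, (0 : ℝ) ∂G.vol) := by rw [integral_zero]
    rw [hzero]
    refine tendsto_integral_filter_of_dominated_convergence (weight k χ)
      (Eventually.of_forall fun s₁ => (hI _ (hle_m s₁)).aestronglyMeasurable)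
      (Eventually.of_forall fun s₁ => ae_of_all _ fun x => ?_) hwi (ae_of_all _ fun x => ?_)
    · rw [Real.norm_eq_abs, abs_of_nonneg (indicator_nonneg (fun x _ => hχ.weight_nonneg x) x)]
      exact indicator_le_self' (fun x _ => hχ.weight_nonneg x) x
    · by_cases hw : weight k χ x = 0
      · refine tendsto_const_nhds.congr fun s₁ => ?_
        by_cases hS : x ∈ {x : G.Point | k x ≤ C + s₁}
        · rw [indicator_of_mem hS, hw]
        · rw [indicator_of_notMem hS]
      · have hxC : C < k x := by
          by_contra hle
          push Not at hle
          have hχx : χ x ≠ 0 := fun h => hw (by rw [weight, h, zero_mul])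
          exact hw (by rw [weight, D1_eq_zero_of_le hk.1 hge hε hχ.supp hχx hle]; ring)
        refine tendsto_const_nhds.congr' ?_
        filter_upwards [mem_nhdsWithin_of_mem_nhds (Iio_mem_nhds (sub_pos.2 hxC))] with s₁ hs₁
        replace hs₁ : s₁ < k x - C := hs₁
        rw [indicator_of_notMem]
        simp only [mem_ofPred_eq, not_le]
        linarith
  have hlim2 := (hlim.const_mul (1 + C / s₀)).const_sub
    (C / s₀ * ∫ x, {x : G.Point | k x < C + s₀}.indicator (weight k χ) x ∂G.vol)
  rw [mul_zero, sub_zero] at hlim2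
  refine le_of_tendsto hlim2 ?_
  filter_upwards [self_mem_nhdsWithin, mem_nhdsWithin_of_mem_nhds (Iio_mem_nhds hs0)] with s₁ h1 h10
  obtain ⟨hint, hzero⟩ := integral_by_parts_truncation hA hχ hk.1 hC hconst h1 h10
  have hint2 : Integrable (fun x => D1 (fun x : G.Point => k x) x *
      D1 ((fun x : G.Point => k x) * χ) x) G.vol :=
    hk.2.2.integrable_mul (hχ.memLp_D1_mul hk.1.isRegular hk.2.2)
  -- The truncated product integrates to 0, so the right side integrates to the excess, which does
  -- not depend on `s₁`.
  have hmono := integral_mono_ae (((hI _ hlt_m).const_mul _).sub ((hI _ (hle_m s₁)).const_mul _))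
    (hint.sub hint2) (excess_density_ge hχ hk.1 hC h1 h10 hs₀)
  simp only [Pi.sub_apply] at hmono
  rw [integral_sub ((hI _ hlt_m).const_mul _) ((hI _ (hle_m s₁)).const_mul _),
    integral_sub hint hint2, hzero, integral_const_mul, integral_const_mul, zero_sub] at hmono
  exact hmono

theorem IsCutoff.excess_nonneg [CompactSpace G.Bar] (hA : IsClosed A) (hχ : IsCutoff A ε χ)
    (hk : G.IsFiniteEnergyHarmonic k) (hC : 0 < C) (hconst : ∀ z ∈ A, k z = C)
    (hge : ∀ x ∈ G.nbhd ε₁ A, C ≤ k x) (hε : ε < ε₁) : 0 ≤ excess k χ := by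
  obtain ⟨s₀, hs0, h⟩ := hχ.exists_excess_ge hA hk hC hconst hge hε
  refine le_trans (mul_nonneg (by positivity) (integral_nonneg fun x => ?_)) h
  exact indicator_nonneg (fun x _ => hχ.weight_nonneg x) x

/-- If the lower bound were 0, the weight would vanish almost everywhere on `{k < C + s₀}`. But
arbitrarily near `A`, where `χ = 1`, a regular value is attained, and its edge carries a segment
with k' ≠ 0. -/
theorem IsCutoff.excess_pos [CompactSpace G.Bar] (hA : IsClosed A) (hχ : IsCutoff A ε χ)
    (hk : G.IsFiniteEnergyHarmonic k) (hC : 0 < C) (hconst : ∀ z ∈ A, k z = C)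
    (hge : ∀ x ∈ G.nbhd ε₁ A, C ≤ k x) (hε : ε < ε₁)
    (hnc : ∀ ρ > 0, ∃ x ∈ G.nbhd ρ A, k x ≠ C) : 0 < excess k χ := by
  obtain ⟨s₀, hs0, h⟩ := hχ.exists_excess_ge hA hk hC hconst hge hε
  refine lt_of_lt_of_le (mul_pos (by positivity) ?_) h
  have hnonneg : ∀ x, 0 ≤ {x : G.Point | k x < C + s₀}.indicator (weight k χ) x :=
    indicator_nonneg fun x _ => hχ.weight_nonneg x
  refine lt_of_le_of_ne (integral_nonneg hnonneg) fun h0 => ?_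
  have hint := (hχ.integrable_weight hk).indicator
    (measurableSet_lt hk.1.measurable_point measurable_const : MeasurableSet
      {x : G.Point | k x < C + s₀})
  have hae := (integral_eq_zero_iff_of_nonneg hnonneg hint).1 h0.symm
  obtain ⟨ρ, hρ, hρ1, -⟩ := hχ.near
  obtain ⟨r, hr, hrk⟩ := exists_nbhd_subset (G := G) hA
    (isOpen_lt hk.1.cont continuous_const : IsOpen {z : G.Bar | k z < C + s₀})
    (fun z hz => by simpa [hconst z hz] using hs0)
  obtain ⟨x, hx, hxC⟩ := hnc (min ρ r) (lt_min hρ hr)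
  obtain ⟨e, s, hs, hmem, hreg, -⟩ := hk.1.exists_regular hconst hx hxC
  obtain ⟨b, -, hb'⟩ := hk.1.exists_slope e
  have hb0 : b ≠ 0 := hb' s (Ioo_subset_Icc_self hs) ▸ hreg.2.2 e s hs rfl
  have hd := Measure.dense_of_ae (ae_edge_of_ae_vol hae e)
  have hev : {t | t ∈ Ioo 0 (G.len e) ∧ G.pt e t ∈ G.nbhd (min ρ r) A} ∈ 𝓝 s :=
    inter_mem (Ioo_mem_nhds hs.1 hs.2) (eventually_pt_mem_nbhd hmem)
  obtain ⟨t, ⟨ht, htn⟩, ht0⟩ := mem_closure_iff_nhds.1 (hd s) _ hev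
  have h1 := ht0 ht
  rw [indicator_of_mem (show G.pt e t ∈ {x : G.Point | k x < C + s₀} from
    hrk _ (nbhd_mono (min_le_right _ _) _ htn)), weight, hρ1 _ (nbhd_mono (min_le_left _ _) _ htn),
    D1_pt_eq_edgeDeriv _ e ht, hb' t (Ioo_subset_Icc_self ht), one_mul] at h1
  exact hb0 (pow_eq_zero_iff (two_ne_zero) |>.1 h1)

end Excess

/-! ### Partitions of the boundary -/

theorem IsBdryClopen.isClosed {A : Set G.Bar} (h : G.IsBdryClopen A) : IsClosed A := by
  have h1 := isClosed_bdryBar.isClosedEmbedding_subtypeVal.isClosedMap _ h.2.1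
  rwa [Subtype.image_preimage_coe, inter_eq_right.2 h.1] at h1

/-- The properties of the partitions that arise by splitting. -/
structure IsRefinement {N : ℕ} (𝓑 : G.BoundaryPartition N) (P : Set (Set G.Bar)) : Prop where
  finite : P.Finite
  clopen : ∀ A ∈ P, G.IsBdryClopen A
  nonempty : ∀ A ∈ P, A.Nonempty
  sub : ∀ A ∈ P, A ⊆ 𝓑.E₀ ∨ ∃ n, A ⊆ 𝓑.E n
  disjoint : ∀ A ∈ P, ∀ B ∈ P, A ≠ B → Disjoint A B
  cover : ⋃₀ P = G.bdryBar

section Partition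

variable {N : ℕ} {𝓑 : G.BoundaryPartition N} {P : Set (Set G.Bar)}

theorem BoundaryPartition.disjoint_sets (𝓑 : G.BoundaryPartition N) {m n : Fin N} (h : m ≠ n) :
    Disjoint (𝓑.E m) (𝓑.E n) :=
  (𝓑.disjoint m n h).mono (Metric.self_subset_thickening 𝓑.δ_pos _)
    (Metric.self_subset_thickening 𝓑.δ_pos _)

theorem BoundaryPartition.disjoint_sets₀ (𝓑 : G.BoundaryPartition N) (n : Fin N) :
    Disjoint 𝓑.E₀ (𝓑.E n) :=
  (𝓑.disjoint₀ n).mono (Metric.self_subset_thickening 𝓑.δ_pos _)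
    (Metric.self_subset_thickening 𝓑.δ_pos _)

theorem isRefinement_initial (𝓑 : G.BoundaryPartition N) :
    IsRefinement 𝓑 {A | A.Nonempty ∧ (A = 𝓑.E₀ ∨ ∃ n, A = 𝓑.E n)} where
  finite := by
    refine ((finite_singleton 𝓑.E₀).union (finite_range 𝓑.E)).subset ?_
    rintro A ⟨-, h | ⟨n, h⟩⟩
    · exact Or.inl h
    · exact Or.inr ⟨n, h.symm⟩
  clopen := by
    rintro A ⟨-, rfl | ⟨n, rfl⟩⟩
    · exact 𝓑.clopen₀
    · exact 𝓑.clopen n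
  nonempty A hA := hA.1
  sub := by
    rintro A ⟨-, rfl | ⟨n, rfl⟩⟩
    · exact Or.inl subset_rfl
    · exact Or.inr ⟨n, subset_rfl⟩
  disjoint := by
    rintro A ⟨-, rfl | ⟨m, rfl⟩⟩ B ⟨-, rfl | ⟨n, rfl⟩⟩ hne
    · exact absurd rfl hne
    · exact 𝓑.disjoint_sets₀ n
    · exact (𝓑.disjoint_sets₀ m).symm
    · exact 𝓑.disjoint_sets fun h => hne (by rw [h])
  cover := by
    rw [← 𝓑.cover]
    ext z
    simp only [mem_sUnion, mem_ofPred_eq, mem_union, mem_iUnion]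
    constructor
    · rintro ⟨A, ⟨-, rfl | ⟨n, rfl⟩⟩, hz⟩
      · exact Or.inl hz
      · exact Or.inr ⟨n, hz⟩
    · rintro (hz | ⟨n, hz⟩)
      · exact ⟨_, ⟨⟨z, hz⟩, Or.inl rfl⟩, hz⟩
      · exact ⟨_, ⟨⟨z, hz⟩, Or.inr ⟨n, rfl⟩⟩, hz⟩

theorem IsRefinement.splitStep (h : IsRefinement 𝓑 P) {Q : Set (Set G.Bar)}
    (hPQ : G.SplitStep P Q) : IsRefinement 𝓑 Q := by
  obtain ⟨B, C, hBC, rfl⟩ := hPQ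
  have hsub : ∀ A ∈ P, B A ⊆ A ∧ C A ⊆ A := by
    intro A hA
    rcases hBC A hA with h1 | ⟨-, h1, h2⟩
    · obtain ⟨-, -, -, -, -, hu⟩ := h1
      exact ⟨subset_union_left.trans hu.subset, subset_union_right.trans hu.subset⟩
    · exact ⟨h1.subset, h2.subset⟩
  have hform : ∀ D ∈ B '' P ∪ C '' P, ∃ A ∈ P, D ⊆ A ∧ (D = B A ∨ D = C A) := by
    rintro D (⟨A, hA, rfl⟩ | ⟨A, hA, rfl⟩)
    · exact ⟨A, hA, (hsub A hA).1, Or.inl rfl⟩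
    · exact ⟨A, hA, (hsub A hA).2, Or.inr rfl⟩
  refine ⟨(h.finite.image B).union (h.finite.image C), ?_, ?_, ?_, ?_, ?_⟩
  · rintro D hD
    obtain ⟨A, hA, -, hD'⟩ := hform D hD
    rcases hBC A hA with ⟨h1, h2, -⟩ | ⟨-, h1, h2⟩
    · rcases hD' with rfl | rfl
      exacts [h1, h2]
    · rcases hD' with rfl | rfl
      · rw [h1]; exact h.clopen A hA
      · rw [h2]; exact h.clopen A hA
  · rintro D hD
    obtain ⟨A, hA, -, hD'⟩ := hform D hD
    rcases hBC A hA with ⟨-, -, h1, h2, -⟩ | ⟨-, h1, h2⟩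
    · rcases hD' with rfl | rfl
      exacts [h1, h2]
    · rcases hD' with rfl | rfl
      · rw [h1]; exact h.nonempty A hA
      · rw [h2]; exact h.nonempty A hA
  · rintro D hD
    obtain ⟨A, hA, hDA, -⟩ := hform D hD
    rcases h.sub A hA with h1 | ⟨n, h1⟩
    · exact Or.inl (hDA.trans h1)
    · exact Or.inr ⟨n, hDA.trans h1⟩
  · rintro D hD D' hD' hne
    obtain ⟨A, hA, hDA, h1⟩ := hform D hD
    obtain ⟨A', hA', hDA', h2⟩ := hform D' hD'
    by_cases hAA : A = A'
    · subst hAA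
      rcases hBC A hA with ⟨-, -, -, -, hd, -⟩ | ⟨-, h3, h4⟩
      · rcases h1 with rfl | rfl <;> rcases h2 with rfl | rfl
        exacts [absurd rfl hne, hd, hd.symm, absurd rfl hne]
      · rw [h3, h4, or_self] at h1 h2
        exact absurd (h1.trans h2.symm) hne
    · exact (h.disjoint A hA A' hA' hAA).mono hDA hDA'
  · rw [← h.cover]
    ext z
    simp only [mem_sUnion]
    constructor
    · rintro ⟨D, hD, hz⟩
      obtain ⟨A, hA, hDA, -⟩ := hform D hD
      exact ⟨A, hA, hDA hz⟩
    · rintro ⟨A, hA, hz⟩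
      rcases hBC A hA with ⟨-, -, -, -, -, hu⟩ | ⟨-, h3, -⟩
      · rw [← hu] at hz
        rcases hz with hz | hz
        · exact ⟨_, Or.inl ⟨A, hA, rfl⟩, hz⟩
        · exact ⟨_, Or.inr ⟨A, hA, rfl⟩, hz⟩
      · exact ⟨_, Or.inl ⟨A, hA, rfl⟩, h3.symm ▸ hz⟩

theorem IsPartitionSequence.isRefinement {P : ℕ → Set (Set G.Bar)}
    (hP : IsPartitionSequence 𝓑 P) (j : ℕ) : IsRefinement 𝓑 (P j) := by
  induction j with
  | zero => rw [hP.1]; exact isRefinement_initial 𝓑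
  | succ j ih => exact ih.splitStep (hP.2 j)

theorem IsRefinement.isBdryFamily (h : IsRefinement 𝓑 P) :
    IsBdryFamily (fun A : P => (A : Set G.Bar)) where
  closed A := (h.clopen A A.2).isClosed
  cover := by rw [← h.cover, sUnion_eq_iUnion]
  disjoint A B hne := h.disjoint A A.2 B B.2 fun h => hne (Subtype.ext h)

open Classical in
/-- The harmonic function that belongs to a set of the partition; it is `0` for the parts of
`E₀`. -/
def localFun (𝓑 : G.BoundaryPartition N) (k : Fin N → G.Bar → ℝ) (A : Set G.Bar) : G.Bar → ℝ :=
  if h : ∃ n, A ⊆ 𝓑.E n then k h.choose else fun _ => 0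

/-- The choice of the index is immaterial because the sets `𝓑.E n` are disjoint and `A` is nonempty.
-/
theorem localFun_eq {k : Fin N → G.Bar → ℝ} {A : Set G.Bar} (hA : A.Nonempty) {n : Fin N}
    (h : A ⊆ 𝓑.E n) : localFun 𝓑 k A = k n := by
  have h' : ∃ n, A ⊆ 𝓑.E n := ⟨n, h⟩
  have : h'.choose = n := by
    by_contra hne
    obtain ⟨z, hz⟩ := hA
    exact disjoint_left.1 (𝓑.disjoint_sets hne) (h'.choose_spec hz) (h hz)
  rw [localFun, dif_pos h', this]

theorem isFiniteEnergyHarmonic_const (c : ℝ) : G.IsFiniteEnergyHarmonic fun _ => c := by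
  have h0 : ∀ e s, edgeDeriv (fun _ : G.Point => c) e s = 0 := by
    intro e s
    simp [edgeDeriv]
  refine ⟨⟨continuous_const, fun e => ⟨c, 0, by simp⟩, fun v _ => by simp [vertexFlux, h0]⟩,
    fun e => (contDiff_const.contDiffOn).absolutelyContinuousOnInterval, ?_⟩
  have : D1 (fun _ : G.Point => c) = 0 := funext fun x => D1_const c x
  rw [this]
  exact MemLp.zero

theorem isFiniteEnergyHarmonic_localFun {k : Fin N → G.Bar → ℝ}
    (hk : ∀ n, G.IsFiniteEnergyHarmonic (k n)) (A : Set G.Bar) :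
    G.IsFiniteEnergyHarmonic (localFun 𝓑 k A) := by
  unfold localFun
  split_ifs
  · exact hk _
  · exact isFiniteEnergyHarmonic_const 0

/-- This puts the parts of `E₀` on the same footing as the others, with the zero function as their
harmonic function, so the form identity applies to one family covering the whole boundary. -/
theorem IsInDomain.exists_coeff (hP : IsRefinement 𝓑 P) {k : Fin N → G.Bar → ℝ}
    {φ : G.Point → ℝ} (hφ : IsInDomain 𝓑 P (fun n x => k n x) φ) :
    ∃ ε > 0, ∃ c : P → ℝ, ∀ A : P, ∀ x ∈ G.nbhd ε (A : Set G.Bar),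
      φ x = c A * localFun 𝓑 k A x := by
  obtain ⟨-, ε, hε, -, h0, h1⟩ := hφ
  refine ⟨ε, hε, ?_⟩
  have : ∀ A : P, ∃ c : ℝ, ∀ x ∈ G.nbhd ε (A : Set G.Bar), φ x = c * localFun 𝓑 k A x := by
    intro A
    rcases hP.sub A A.2 with h | ⟨n, h⟩
    · exact ⟨0, fun x hx => by rw [h0 x (nbhd_subset h hx), zero_mul]⟩
    · obtain ⟨c, hc⟩ := h1 n A A.2 h
      refine ⟨c, fun x hx => ?_⟩
      rw [localFun_eq (hP.nonempty A A.2) h]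
      exact hc x hx
  choose c hc using this
  exact ⟨c, hc⟩

theorem isInDomain_of_vanish {h : Fin N → G.Point → ℝ} (hP : ∀ A ∈ P, A ⊆ G.bdryBar)
    {φ : G.Point → ℝ} (hφ : G.IsDmax φ) {ρ : ℝ} (hρ : 0 < ρ)
    (h0 : ∀ x ∈ G.nbhd ρ G.bdryBar, φ x = 0) : IsInDomain 𝓑 P h φ := by
  refine ⟨hφ, min ρ (𝓑.δ / 2), lt_min hρ (half_pos 𝓑.δ_pos),
    (min_le_right _ _).trans_lt (half_lt_self 𝓑.δ_pos), fun x hx => ?_, fun n A hA _ =>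
      ⟨0, fun x hx => ?_⟩⟩
  · exact h0 x (nbhd_mono (min_le_left _ _) _ (nbhd_subset 𝓑.clopen₀.1 hx))
  · rw [h0 x (nbhd_mono (min_le_left _ _) _ (nbhd_subset (hP A hA) hx)), zero_mul]

end Partition

/-! ### Functions in the maximal domain -/

theorem IsFlat.continuous {χ : G.Point → ℝ} (hχ : IsFlat χ) : Continuous χ := by
  refine continuous_of_edges hχ.finite (fun e he s hs => ?_) fun e _ => ?_
  · by_contra hne
    exact he ⟨s, hs, hne⟩
  · obtain ⟨g, hg, h⟩ := hχ.smooth e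
    obtain ⟨K, hK⟩ := ((hg.of_le (m := 1) (by norm_num)).contDiffOn
      (s := Icc 0 (G.len e))).exists_lipschitzOnWith (by decide) (convex_Icc _ _) isCompact_Icc
    refine ⟨K, fun s hs t ht => ?_⟩
    rw [h s hs, h t ht]
    exact hK.dist_le_mul s hs t ht

/-- The product is C² on each edge and affine on all but finitely many, so its second derivative is
square integrable. Since `χ` is constant near each vertex, the flux of the product at `v` is `χ(v)`
times that of `k`. -/
theorem IsFlat.isDmax_mul {χ : G.Point → ℝ} (hχ : IsFlat χ) {k : G.Bar → ℝ} (hk : G.IsHarmonic k)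
    (hmem : MemLp ((fun x : G.Point => k x) * χ) 2 G.vol) :
    G.IsDmax ((fun x : G.Point => k x) * χ) := by
  have hd : EdgeDiff ((fun x : G.Point => k x) * χ) := hk.isRegular.diff.mul hχ.edgeDiff
  have hsm : ∀ e, ∃ g : ℝ → ℝ, ContDiff ℝ 2 g ∧
      ∀ s ∈ Icc 0 (G.len e), edgeDeriv ((fun x : G.Point => k x) * χ) e s = deriv g s := by
    intro e
    obtain ⟨g, hg, h⟩ := hχ.smooth e
    obtain ⟨a, b, hab⟩ := hk.affine e
    have hG : ContDiff ℝ 2 fun t => (a + b * t) * g t :=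
      (contDiff_const.add (contDiff_const.mul contDiff_id)).mul hg
    refine ⟨_, hG, fun s hs => ?_⟩
    have heq : EqOn (fun t => ((fun x : G.Point => k x) * χ) (G.pt e t))
        (fun t => (a + b * t) * g t) (Icc 0 (G.len e)) := fun t ht => by
      simp only [Pi.mul_apply]
      rw [hab t ht, h t ht]
    rw [edgeDeriv, derivWithin_congr heq (heq hs)]
    exact ((hG.differentiable (by norm_num)) s).derivWithin
      (uniqueDiffOn_Icc (G.len_pos e) s hs)
  refine ⟨hk.continuous_point.mul hχ.continuous, hd, fun e => ?_, hmem, ?_, fun v hv => ?_⟩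
  · obtain ⟨g, hg, h⟩ := hsm e
    have hg1 : ContDiff ℝ 1 (deriv g) := hg.deriv' (n := 1)
    refine ac_congr (hg1.contDiffOn.absolutelyContinuousOnInterval) fun s hs => ?_
    rw [uIcc_of_le (G.len_pos e).le] at hs
    exact h s hs
  · refine memLp_of_finite (measurable_D2 _) hχ.finite (fun e he s hs => ?_) fun e _ => ?_
    · obtain ⟨b, -, hb⟩ := hk.exists_slope e
      have hχc : ∀ t ∈ Icc 0 (G.len e), χ (G.pt e t) = χ (G.pt e 0) := fun t ht => by
        by_contra hne
        exact he ⟨t, ht, hne⟩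
      have h1 : edgeDeriv ((fun x : G.Point => k x) * χ) e =ᶠ[𝓝 s]
          fun _ => χ (G.pt e 0) * b := by
        filter_upwards [Icc_mem_nhds hs.1 hs.2] with t ht
        rw [← hb t ht, ← edgeDeriv_smul, edgeDeriv, edgeDeriv]
        refine derivWithin_congr (fun r hr => ?_) ?_
        · simp [hχc r hr, mul_comm]
        · simp [hχc t ht, mul_comm]
      rw [D2_pt _ e hs, h1.deriv_eq, deriv_const]
    · obtain ⟨g, hg, h⟩ := hsm e
      have hg1 : ContDiff ℝ 1 (deriv g) := hg.deriv' (n := 1)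
      obtain ⟨M, hM⟩ := isCompact_Icc.exists_bound_of_continuousOn (s := Icc 0 (G.len e))
        (hg1.continuous_deriv (by norm_num)).continuousOn
      refine ⟨M, fun s hs => ?_⟩
      have h1 : edgeDeriv ((fun x : G.Point => k x) * χ) e =ᶠ[𝓝 s] deriv g := by
        filter_upwards [Icc_mem_nhds hs.1 hs.2] with t ht using h t ht
      rw [D2_pt _ e hs, h1.deriv_eq]
      exact hM s (Ioo_subset_Icc_self hs)
  · have h0 : ∀ e, edgeDeriv ((fun x : G.Point => k x) * χ) e 0 =
        χ (G.pt e 0) * edgeDeriv (fun x : G.Point => k x) e 0 := by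
      intro e
      obtain ⟨τ, hτ, h1, -⟩ := hχ.flat e
      rw [← edgeDeriv_smul, edgeDeriv, edgeDeriv]
      refine Filter.EventuallyEq.derivWithin_eq ?_ (by simp [mul_comm])
      filter_upwards [self_mem_nhdsWithin, mem_nhdsWithin_of_mem_nhds (Iic_mem_nhds hτ)]
        with t ht ht'
      simp [h1 t ht ht', mul_comm]
    have h1 : ∀ e, edgeDeriv ((fun x : G.Point => k x) * χ) e (G.len e) =
        χ (G.pt e (G.len e)) * edgeDeriv (fun x : G.Point => k x) e (G.len e) := by
      intro e
      obtain ⟨τ, hτ, -, h1⟩ := hχ.flat e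
      rw [← edgeDeriv_smul, edgeDeriv, edgeDeriv]
      refine Filter.EventuallyEq.derivWithin_eq ?_ (by simp [mul_comm])
      filter_upwards [self_mem_nhdsWithin, mem_nhdsWithin_of_mem_nhds
        (Ici_mem_nhds (show G.len e - τ < G.len e by linarith))] with t ht ht'
      simp [h1 t ht ht', mul_comm]
    have hflux := hk.kirchhoff v hv
    rw [vertexFlux] at hflux ⊢
    rw [Finset.sum_congr rfl fun e he => by
        rw [h0 e, pt_zero, show G.src e = v by simpa using he],
      Finset.sum_congr (s₁ := (G.finite_tgt v).toFinset) rfl fun e he => by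
        rw [h1 e, pt_len, show G.tgt e = v by simpa using he],
      ← Finset.mul_sum, ← Finset.mul_sum, ← mul_sub, hflux, mul_zero]

/-! ### Density of the domain -/

open Classical in
/-- The function on the graph that equals `u` on the edge `e` and vanishes elsewhere. -/
def onEdge (G : MetricGraph V E) (e : E) (u : ℝ → ℝ) : G.Point → ℝ :=
  ofEdges fun e' s => if e' = e then u s else 0

theorem onEdge_pt {e : E} {u : ℝ → ℝ} (hu : tsupport u ⊆ Ioo 0 (G.len e)) (s : ℝ) :
    onEdge G e u (G.pt e s) = u s := by
  by_cases hs : s ∈ Ioo 0 (G.len e)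
  · rw [pt_of_mem G e hs]; simp [onEdge, ofEdges]
  · rw [image_eq_zero_of_notMem_tsupport fun h => hs (hu h), pt, dif_neg hs]
    split_ifs <;> rfl

theorem onEdge_pt_of_ne {e e' : E} (u : ℝ → ℝ) (h : e' ≠ e) (s : ℝ) :
    onEdge G e u (G.pt e' s) = 0 := by
  by_cases hs : s ∈ Ioo 0 (G.len e')
  · rw [pt_of_mem G e' hs]; simp [onEdge, ofEdges, h]
  · rw [pt, dif_neg hs]
    split_ifs <;> rfl

section OnEdge

variable {e : E} {u : ℝ → ℝ}

theorem isFlat_onEdge (hu : ContDiff ℝ 2 u) (hs : tsupport u ⊆ Ioo 0 (G.len e)) :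
    IsFlat (onEdge G e u) where
  smooth e' := by
    by_cases he : e' = e
    · subst he; exact ⟨u, hu, fun s _ => onEdge_pt hs s⟩
    · exact ⟨fun _ => 0, contDiff_const, fun s _ => onEdge_pt_of_ne u he s⟩
  flat e' := by
    by_cases he : e' = e
    · subst he
      have h0 : u =ᶠ[𝓝 0] 0 := notMem_tsupport_iff_eventuallyEq.1 fun h => (hs h).1.ne rfl
      have h1 : u =ᶠ[𝓝 (G.len e')] 0 :=
        notMem_tsupport_iff_eventuallyEq.1 fun h => (hs h).2.ne rfl
      obtain ⟨τ₀, hτ₀, h0⟩ := Metric.eventually_nhds_iff.1 h0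
      obtain ⟨τ₁, hτ₁, h1⟩ := Metric.eventually_nhds_iff.1 h1
      have hτ := lt_min hτ₀ hτ₁
      refine ⟨min τ₀ τ₁ / 2, half_pos hτ, fun s hsI hle => ?_, fun s hsI hle => ?_⟩
      · have h2 : u s = 0 := h0 (by
          rw [Real.dist_eq, sub_zero, abs_of_nonneg hsI.1]
          linarith [min_le_left τ₀ τ₁])
        have h3 : u 0 = 0 := h0 (by simpa using hτ₀)
        rw [onEdge_pt hs, onEdge_pt hs, h2, h3]
      · have h2 : u s = 0 := h1 (by
          rw [Real.dist_eq, abs_of_nonpos (by linarith [hsI.2])]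
          linarith [min_le_right τ₀ τ₁])
        have h3 : u (G.len e') = 0 := h1 (by simpa using hτ₁)
        rw [onEdge_pt hs, onEdge_pt hs, h2, h3]
    · exact ⟨1, one_pos, fun s _ _ => by rw [onEdge_pt_of_ne u he, onEdge_pt_of_ne u he],
        fun s _ _ => by rw [onEdge_pt_of_ne u he, onEdge_pt_of_ne u he]⟩
  finite := by
    refine (finite_singleton e).subset ?_
    rintro e' ⟨s, -, hne⟩
    by_contra he
    exact hne (by rw [onEdge_pt_of_ne u he, onEdge_pt_of_ne u he])

theorem isDmax_onEdge (hu : ContDiff ℝ 2 u) (hc : HasCompactSupport u)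
    (hs : tsupport u ⊆ Ioo 0 (G.len e)) : G.IsDmax (onEdge G e u) := by
  have hflat := isFlat_onEdge hu hs
  -- The constant 1 is harmonic, so the product criterion for the maximal domain applies.
  have h1 : (fun x : G.Point => (fun _ : G.Bar => (1 : ℝ)) x) * onEdge G e u = onEdge G e u := by
    funext x
    simp
  rw [← h1]
  refine hflat.isDmax_mul (isFiniteEnergyHarmonic_const 1).1 ?_
  rw [h1]
  refine memLp_of_finite hflat.edgeDiff.measurable (finite_singleton e) (fun e' he s _ => ?_) ?_
  · exact onEdge_pt_of_ne u he s
  · rintro _ rfl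
    obtain ⟨M, hM⟩ := hc.exists_bound_of_continuous hu.continuous
    exact ⟨M, fun s _ => by rw [onEdge_pt hs]; exact hM s⟩

theorem onEdge_vanish (hc : HasCompactSupport u) (hs : tsupport u ⊆ Ioo 0 (G.len e)) :
    ∃ ρ > 0, ∀ x ∈ G.nbhd ρ G.bdryBar, onEdge G e u x = 0 := by
  have hdis : Disjoint ((fun s => ((G.pt e s : G.Point) : G.Bar)) '' tsupport u) G.bdryBar := by
    rw [disjoint_left]
    rintro _ ⟨s, hsu, rfl⟩
    exact inner_notMem_bdryBar (hs hsu)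
  obtain ⟨ρ, hρ, h⟩ := hdis.exists_thickenings (isCompact_image_pt e hc) isClosed_bdryBar
  refine ⟨ρ, hρ, fun x hx => ?_⟩
  revert hx
  induction x using point_cases with
  | hv v => exact fun _ => rfl
  | he e' s hs' =>
    intro hx
    by_cases he : e' = e
    · subst he
      rw [onEdge_pt hs]
      by_contra hne
      refine disjoint_left.1 h (Metric.self_subset_thickening hρ _ ?_) hx
      exact mem_image_of_mem _ (subset_tsupport u hne)
    · exact onEdge_pt_of_ne u he s

end OnEdge

theorem memLp_edge {g : G.Point → ℝ} (hg : MemLp g 2 G.vol) (hm : Measurable g) (e : E) :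
    MemLp (fun s => g (G.pt e s)) 2 (volume.restrict (Ioo 0 (G.len e))) := by
  have h1 := hg.mono_measure (Measure.le_sum
    (fun e => (volume.restrict (Ioo 0 (G.len e))).map (G.pt e)) e)
  exact (memLp_map_measure_iff hm.aestronglyMeasurable (measurable_pt e).aemeasurable).1 h1

theorem integrable_edge_of_memLp {g : G.Point → ℝ} (hg : MemLp g 2 G.vol) (hm : Measurable g)
    (e : E) : IntegrableOn (fun s => g (G.pt e s)) (Ioo 0 (G.len e)) :=
  (memLp_edge hg hm e).integrable one_le_two

/-- Smooth functions with compact support inside one open edge vanish near the boundary and so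
belong to every such domain. A vector orthogonal to all of them is zero on each edge by the
fundamental lemma of the calculus of variations. -/
theorem dense_operator_domain {N : ℕ} (𝓑 : G.BoundaryPartition N) {P : Set (Set G.Bar)}
    (hP : ∀ A ∈ P, A ⊆ G.bdryBar) (h : Fin N → G.Point → ℝ) :
    Dense ((operator 𝓑 P h).domain : Set G.L2) := by
  rw [Submodule.dense_iff_topologicalClosure_eq_top, Submodule.topologicalClosure_eq_top_iff,
    Submodule.eq_bot_iff]
  intro g hg
  have hgm : Measurable g := (Lp.stronglyMeasurable g).measurable
  have hgL := Lp.memLp g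
  have key : ∀ e, ∀ᵐ s : ℝ, s ∈ Ioo 0 (G.len e) → g (G.pt e s) = 0 := by
    intro e
    have hgi := integrable_edge_of_memLp hgL hgm e
    refine isOpen_Ioo.ae_eq_zero_of_integral_contDiff_smul_eq_zero hgi.locallyIntegrableOn
      fun u hu hc hs => ?_
    have hu2 : ContDiff ℝ 2 u := contDiff_infty.1 hu 2
    have hD := isDmax_onEdge hu2 hc hs
    obtain ⟨ρ, hρ, h0⟩ := onEdge_vanish hc hs
    have hdom : IsInDomain 𝓑 P h (onEdge G e u) := isInDomain_of_vanish hP hD hρ h0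
    have horth := (Submodule.mem_orthogonal _ _).1 hg (classMap 𝓑 P h ⟨_, hdom⟩)
      (LinearMap.mem_range_self _ _)
    rw [L2.inner_def, classMap_apply] at horth
    have h1 : ∫ x, onEdge G e u x * g x ∂G.vol = 0 := by
      rw [← horth]
      refine integral_congr_ae ?_
      filter_upwards [MemLp.coeFn_toLp hdom.1.memLp] with x hx
      rw [hx]
      simp [mul_comm]
    obtain ⟨M, hM⟩ := hc.exists_bound_of_continuous hu2.continuous
    have hui : IntegrableOn (fun s => u s * g (G.pt e s)) (Ioo 0 (G.len e)) :=
      hgi.bdd_mul (c := M) hu2.continuous.aestronglyMeasurable (ae_of_all _ hM)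
    have h2 := (integral_vol_of_finite (h := fun x => onEdge G e u x * g x)
      ((isFlat_onEdge hu2 hs).edgeDiff.measurable.mul hgm)
      (u := fun e' s => onEdge G e u (G.pt e' s) * g (G.pt e' s)) (fun _ _ _ => rfl) {e}
      (fun e' he' s _ => by
        rw [onEdge_pt_of_ne u (by simpa using he'), zero_mul])
      (fun e' he' => by
        rw [Finset.mem_singleton.1 he', intervalIntegrable_iff_integrableOn_Ioo_of_le
          (G.len_pos e).le]
        simpa only [onEdge_pt hs] using hui)).2
    rw [h1, Finset.sum_singleton, intervalIntegral.integral_of_le (G.len_pos e).le,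
      integral_Ioc_eq_integral_Ioo] at h2
    simp only [onEdge_pt hs] at h2
    rw [h2]
    simp only [smul_eq_mul]
    refine (setIntegral_eq_integral_of_forall_compl_eq_zero fun s hs' => ?_).symm
    rw [image_eq_zero_of_notMem_tsupport fun h => hs' (hs h), zero_mul]
  have h0 : (g : G.Point → ℝ) =ᵐ[G.vol] 0 :=
    ae_vol_of_edges (measurableSet_eq_fun hgm measurable_const) key
  exact (Lp.eq_zero_iff_ae_eq_zero).2 h0

/-! ### The form of the operators -/

section Operator

variable {N : ℕ} {𝓑 : G.BoundaryPartition N} {P : Set (Set G.Bar)}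

theorem exists_function {h : Fin N → G.Point → ℝ} (f : (operator 𝓑 P h).domain) :
    ∃ φ : functionDomain 𝓑 P h, (f : G.L2) = classMap 𝓑 P h φ ∧
      operator 𝓑 P h f = negD2 𝓑 P h φ := by
  obtain ⟨f, φ, rfl⟩ := f
  exact ⟨φ, rfl, operator_apply 𝓑 P h φ⟩

theorem inner_negD2 {h : Fin N → G.Point → ℝ} (φ ψ : functionDomain 𝓑 P h) :
    ⟪negD2 𝓑 P h φ, classMap 𝓑 P h ψ⟫_ℝ =
      -∫ x, D2 (φ : G.Point → ℝ) x * (ψ : G.Point → ℝ) x ∂G.vol := by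
  rw [negD2_apply, classMap_apply, inner_neg_left, L2.inner_def]
  congr 1
  refine integral_congr_ae ?_
  filter_upwards [MemLp.coeFn_toLp ψ.2.1.memLp, MemLp.coeFn_toLp φ.2.1.memLp_D2] with x h1 h2
  rw [h1, h2]
  simp [mul_comm]

theorem excess_const (c : ℝ) (χ : G.Point → ℝ) : excess (fun _ : G.Bar => c) χ = 0 := by
  simp [excess, D1_const]

/-- Constants carry no flux, so the boundary term disappears and the form is the energy. -/
theorem excess_localFun_const (b : Fin N → ℝ) (A : Set G.Bar) (χ : G.Point → ℝ) :
    excess (localFun 𝓑 (fun n _ => b n) A) χ = 0 := by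
  unfold localFun
  split_ifs <;> exact excess_const _ χ

variable [CompactSpace G.Bar] {k : Fin N → G.Bar → ℝ}

/-- The form of `-D²` on the domain given by finite energy harmonic functions. The cutoff functions
may be supported in any small neighbourhoods. -/
theorem exists_integral_D2_mul (hP : IsRefinement 𝓑 P) [Fintype P]
    (hk : ∀ n, G.IsFiniteEnergyHarmonic (k n)) {φ ψ : G.Point → ℝ}
    (hφ : IsInDomain 𝓑 P (fun n x => k n x) φ) (hψ : IsInDomain 𝓑 P (fun n x => k n x) ψ)
    {ε₀ : ℝ} (hε₀ : 0 < ε₀) :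
    ∃ ε ≤ ε₀, ∃ χ : P → G.Point → ℝ, (∀ A : P, IsCutoff (A : Set G.Bar) ε (χ A)) ∧
      ∃ c d : P → ℝ,
        (-∫ x, D2 φ x * ψ x ∂G.vol = ∫ x, D1 φ x * D1 ψ x ∂G.vol +
          ∑ A : P, c A * d A * excess (localFun 𝓑 k A) (χ A)) ∧
        (-∫ x, D2 ψ x * φ x ∂G.vol = ∫ x, D1 ψ x * D1 φ x ∂G.vol +
          ∑ A : P, d A * c A * excess (localFun 𝓑 k A) (χ A)) ∧
        -∫ x, D2 φ x * φ x ∂G.vol = ∫ x, D1 φ x * D1 φ x ∂G.vol +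
          ∑ A : P, c A * c A * excess (localFun 𝓑 k A) (χ A) := by
  obtain ⟨ε₁, hε₁, c, hc⟩ := hφ.exists_coeff hP
  obtain ⟨ε₂, hε₂, d, hd⟩ := hψ.exists_coeff hP
  have hfam := hP.isBdryFamily
  set ε := min (min ε₁ ε₂) ε₀ with hεdef
  have hε : 0 < ε := lt_min (lt_min hε₁ hε₂) hε₀
  have hεε₀ : ε ≤ ε₀ := min_le_right _ _
  choose χ hχ using fun A : P => exists_isCutoff (hfam.closed A) (hfam.closed_diff A)
    (hfam.subset A) (half_pos hε)
  have hc' : ∀ A : P, ∀ x ∈ G.nbhd ε (A : Set G.Bar), φ x = c A * localFun 𝓑 k A x :=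
    fun A x hx => hc A x (nbhd_mono ((min_le_left _ _).trans (min_le_left _ _)) _ hx)
  have hd' : ∀ A : P, ∀ x ∈ G.nbhd ε (A : Set G.Bar), ψ x = d A * localFun 𝓑 k A x :=
    fun A x hx => hd A x (nbhd_mono ((min_le_left _ _).trans (min_le_right _ _)) _ hx)
  have hh : ∀ A : P, G.IsFiniteEnergyHarmonic (localFun 𝓑 k A) :=
    fun A => isFiniteEnergyHarmonic_localFun hk A
  have h1 := hφ.1.isRegular
  have h2 := hψ.1.isRegular
  exact ⟨ε / 2, by linarith, χ, hχ, c, d, integral_D2_mul_of_family hfam hh hε hχ h1 h2 hc' hd',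
    integral_D2_mul_of_family hfam hh hε hχ h2 h1 hd' hc',
    integral_D2_mul_of_family hfam hh hε hχ h1 h1 hc' hc'⟩

theorem IsInDomain.memLp_D1 (hP : IsRefinement 𝓑 P)
    (hk : ∀ n, G.IsFiniteEnergyHarmonic (k n)) {φ : G.Point → ℝ}
    (hφ : IsInDomain 𝓑 P (fun n x => k n x) φ) : MemLp (D1 φ) 2 G.vol := by
  have := hP.finite.fintype
  obtain ⟨ε, hε, c, hc⟩ := hφ.exists_coeff hP
  exact (memLp_D1_of_family hP.isBdryFamily
    (fun A : P => isFiniteEnergyHarmonic_localFun hk A) hε hφ.1.isRegular hc).1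

/-- Both properties are read off the form identity: its boundary term is symmetric in the
coefficients of the two functions, and on the diagonal it is a sum of squares times excesses.
Restricting to small `ε` confines the cutoff functions to the region where the sign of the excess is
known. -/
theorem isNonnegSymmetric_operator (hP : IsRefinement 𝓑 P)
    (hk : ∀ n, G.IsFiniteEnergyHarmonic (k n)) {ε₀ : ℝ} (hε₀ : 0 < ε₀)
    (hexc : ∀ A ∈ P, ∀ ε ≤ ε₀, ∀ χ, IsCutoff A ε χ → 0 ≤ excess (localFun 𝓑 k A) χ) :
    FormMethod.IsNonnegSymmetric (operator 𝓑 P fun n x => k n x) where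
  dense := dense_operator_domain 𝓑 (fun A hA => (hP.clopen A hA).1) _
  symm f g := by
    have := hP.finite.fintype
    obtain ⟨φ, hf, hSf⟩ := exists_function f
    obtain ⟨ψ, hg, hSg⟩ := exists_function g
    rw [hSf, hSg, hf, hg, real_inner_comm (negD2 _ _ _ ψ), inner_negD2, inner_negD2]
    obtain ⟨ε, -, χ, -, c, d, h1, h2, -⟩ := exists_integral_D2_mul hP hk φ.2 ψ.2 one_pos
    rw [h1, h2]
    simp only [mul_comm]
  nonneg f := by
    have := hP.finite.fintype
    obtain ⟨φ, hf, hSf⟩ := exists_function f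
    rw [hSf, hf, inner_negD2]
    obtain ⟨ε, hε, χ, hχ, c, d, -, -, h1⟩ := exists_integral_D2_mul hP hk φ.2 φ.2 hε₀
    rw [h1]
    refine add_nonneg (integral_nonneg fun x => mul_self_nonneg _) (Finset.sum_nonneg fun A _ => ?_)
    exact mul_nonneg (mul_self_nonneg _) (hexc A A.2 ε hε _ (hχ A))

theorem isNonnegSymmetric_operator_const (hP : IsRefinement 𝓑 P) (b : Fin N → ℝ) :
    FormMethod.IsNonnegSymmetric (operator 𝓑 P fun n _ => b n) :=
  isNonnegSymmetric_operator (k := fun n _ => b n) hP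
    (fun n => isFiniteEnergyHarmonic_const (b n)) one_pos
    fun A _ _ _ χ _ => (excess_localFun_const b A χ).ge

/-- There is a common neighbourhood in which the Robin functions are at least their boundary
values. -/
theorem exists_forall_ge {C : Fin N → ℝ} (hk : ∀ n, G.IsRobinFunction (𝓑.E n) (k n) (C n)) :
    ∃ ε > 0, ∀ n, ∀ x ∈ G.nbhd ε (𝓑.E n), C n ≤ k n x := by
  choose ρ hρ h using fun n => (hk n).exists_ge (𝓑.clopen n).isClosed
  have : ∀ᶠ r in 𝓝[>] (0 : ℝ), ∀ n, r ≤ ρ n :=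
    eventually_all.2 fun n => mem_nhdsWithin_of_mem_nhds (Iic_mem_nhds (hρ n))
  obtain ⟨r, h1, h2⟩ := (this.and self_mem_nhdsWithin).exists
  exact ⟨r, h2, fun n x hx => h n x (nbhd_mono (h1 n) _ hx)⟩

theorem excess_localFun_nonneg (hP : IsRefinement 𝓑 P) {C : Fin N → ℝ}
    (hk : ∀ n, G.IsRobinFunction (𝓑.E n) (k n) (C n)) {ε₁ : ℝ}
    (hge : ∀ n, ∀ x ∈ G.nbhd ε₁ (𝓑.E n), C n ≤ k n x) {A : Set G.Bar} (hA : A ∈ P) {ε : ℝ}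
    (hε : ε < ε₁) {χ : G.Point → ℝ} (hχ : IsCutoff A ε χ) : 0 ≤ excess (localFun 𝓑 k A) χ := by
  by_cases h : ∃ n, A ⊆ 𝓑.E n
  · obtain ⟨n, h⟩ := h
    rw [localFun_eq (hP.nonempty A hA) h]
    exact hχ.excess_nonneg (hP.clopen A hA).isClosed (hk n).finite_energy (hk n).pos
      (fun z hz => (hk n).const z (h hz)) (fun x hx => hge n x (nbhd_subset h hx)) hε
  · rw [localFun, dif_neg h, excess_const]

theorem isNonnegSymmetric_operator_robin (hP : IsRefinement 𝓑 P) {C : Fin N → ℝ}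
    (hk : ∀ n, G.IsRobinFunction (𝓑.E n) (k n) (C n)) :
    FormMethod.IsNonnegSymmetric (operator 𝓑 P fun n x => k n x) := by
  obtain ⟨ε₁, hε₁, hge⟩ := exists_forall_ge hk
  exact isNonnegSymmetric_operator hP (fun n => (hk n).finite_energy) (half_pos hε₁)
    fun A hA ε hε χ hχ => excess_localFun_nonneg hP hk hge hA (by linarith) hχ

theorem inner_negD2_const (hP : IsRefinement 𝓑 P) {b : Fin N → ℝ}
    (φ : functionDomain 𝓑 P fun n _ => b n) :
    ⟪negD2 𝓑 P _ φ, classMap 𝓑 P _ φ⟫_ℝ = ∫ x, D1 (φ : G.Point → ℝ) x ^ 2 ∂G.vol := by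
  have := hP.finite.fintype
  rw [inner_negD2]
  obtain ⟨ε, -, χ, -, c, d, -, -, h1⟩ := exists_integral_D2_mul (k := fun n _ => b n) hP
    (fun n => isFiniteEnergyHarmonic_const (b n)) φ.2 φ.2 one_pos
  simpa [excess_localFun_const, ← sq] using h1

end Operator

/-! ### Functions of finite energy -/

/-- Representatives continuous on the edges that agree almost everywhere agree inside every edge;
this makes the energy of a class in `L²` well defined. -/
theorem EdgeAC.D1_eq_of_ae_eq {F F' : G.Point → ℝ} (hF : EdgeAC F) (hF' : EdgeAC F')
    (h : F =ᵐ[G.vol] F') : D1 F = D1 F' := by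
  funext x
  induction x using point_cases with
  | hv v => rfl
  | he e s hs =>
    have hu : uIcc 0 (G.len e) = Icc 0 (G.len e) := uIcc_of_le (G.len_pos e).le
    have hIoo : EqOn (fun s => F (G.pt e s)) (fun s => F' (G.pt e s)) (Ioo 0 (G.len e)) := by
      refine Measure.eqOn_open_of_ae_eq (μ := volume) ?_ isOpen_Ioo
        ((hF e).continuousOn.mono (hu ▸ Ioo_subset_Icc_self))
        ((hF' e).continuousOn.mono (hu ▸ Ioo_subset_Icc_self))
      exact (ae_restrict_iff' measurableSet_Ioo).2 (ae_edge_of_ae_vol h e)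
    rw [D1_pt _ e hs, D1_pt _ e hs]
    exact (hIoo.eventuallyEq_of_mem (Ioo_mem_nhds hs.1 hs.2)).deriv_eq

theorem HasEnergy.unique {f : G.L2} {q q' : ℝ} (h : HasEnergy f q) (h' : HasEnergy f q') :
    q = q' := by
  obtain ⟨F, h1, h2, rfl⟩ := h
  obtain ⟨F', h1', h2', rfl⟩ := h'
  rw [EdgeAC.D1_eq_of_ae_eq h2.1 h2'.1 (h1.symm.trans h1')]

theorem integral_sq_eq_norm_toLp {F : G.Point → ℝ} (hF : MemLp F 2 G.vol) :
    ∫ x, F x ^ 2 ∂G.vol = ‖hF.toLp F‖ ^ 2 := by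
  rw [← real_inner_self_eq_norm_sq, L2.inner_def]
  refine integral_congr_ae ?_
  filter_upwards [MemLp.coeFn_toLp hF] with x hx
  rw [hx]
  simp [sq]

/-- On one edge, which has finite length, `L²` convergence implies `L¹` convergence by Hölder, and
integrals over subintervals follow. -/
theorem tendsto_integral_edge {h : ℕ → G.Point → ℝ} (hh : ∀ n, MemLp (h n) 2 G.vol)
    (hm : ∀ n, Measurable (h n)) {g : G.L2}
    (hg : Tendsto (fun n => (hh n).toLp (h n)) atTop (𝓝 g)) (e : E) {s : ℝ}
    (hs : s ∈ Icc 0 (G.len e)) :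
    Tendsto (fun n => ∫ r in 0..s, h n (G.pt e r)) atTop (𝓝 (∫ r in 0..s, g (G.pt e r))) := by
  have hgm : Measurable g := (Lp.stronglyMeasurable g).measurable
  have hconv : Tendsto (fun n => eLpNorm (h n - (g : G.Point → ℝ)) 2 G.vol) atTop (𝓝 0) := by
    rw [← Lp.tendsto_Lp_iff_tendsto_eLpNorm'' h hh g (Lp.memLp g), Lp.toLp_coeFn]
    exact hg
  set μ := (volume : Measure ℝ).restrict (Ioo 0 (G.len e)) with hμ
  have hle : ∀ n, eLpNorm ((fun r => h n (G.pt e r)) - fun r => g (G.pt e r)) 1 μ ≤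
      eLpNorm (h n - (g : G.Point → ℝ)) 2 G.vol * μ univ ^ (1 / (1 : ENNReal).toReal - 1 / (2 : ENNReal).toReal) := by
    intro n
    have hmn : Measurable (h n - (g : G.Point → ℝ)) := (hm n).sub hgm
    refine (eLpNorm_le_eLpNorm_mul_rpow_measure_univ one_le_two
      (hmn.comp (measurable_pt e)).aestronglyMeasurable).trans ?_
    gcongr
    have h1 := eLpNorm_map_measure (p := 2) (μ := μ) (f := G.pt e) hmn.aestronglyMeasurable
      (measurable_pt e).aemeasurable
    rw [← h1]
    exact eLpNorm_mono_measure _ (Measure.le_sum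
      (fun e => (volume.restrict (Ioo 0 (G.len e))).map (G.pt e)) e)
  have hL1 : Tendsto (fun n => eLpNorm ((fun r => h n (G.pt e r)) - fun r => g (G.pt e r)) 1 μ)
      atTop (𝓝 0) := by
    refine tendsto_of_tendsto_of_tendsto_of_le_of_le tendsto_const_nhds ?_ (fun _ => zero_le) hle
    have := ENNReal.Tendsto.mul_const (b := μ univ ^
      (1 / (1 : ENNReal).toReal - 1 / (2 : ENNReal).toReal)) hconv (Or.inr (by
        refine ENNReal.rpow_ne_top_of_nonneg (by norm_num) (measure_ne_top μ univ)))
    simpa using this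
  have h2 := tendsto_setIntegral_of_L1' (fun r => g (G.pt e r))
    (hgm.comp (measurable_pt e)).aestronglyMeasurable
    (Eventually.of_forall fun n => integrable_edge_of_memLp (hh n) (hm n) e) hL1 (Ioo 0 s)
  have h3 : ∀ u : ℝ → ℝ, ∫ r in 0..s, u r = ∫ r in Ioo 0 s, u r ∂μ := by
    intro u
    rw [intervalIntegral.integral_of_le hs.1, integral_Ioc_eq_integral_Ioo, hμ,
      Measure.restrict_restrict measurableSet_Ioo,
      inter_eq_left.2 (Ioo_subset_Ioo_right hs.2)]
  simpa only [h3] using h2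

theorem EdgeAC.integral_D1 {F : G.Point → ℝ} (hF : EdgeAC F) (e : E) {s : ℝ}
    (hs : s ∈ Icc 0 (G.len e)) :
    ∫ r in 0..s, D1 F (G.pt e r) = F (G.pt e s) - F (G.pt e 0) := by
  have h1 := ((hF e).mono (by
    rw [uIcc_of_le hs.1, uIcc_of_le (G.len_pos e).le]
    exact Icc_subset_Icc_right hs.2) : AbsolutelyContinuousOnInterval _ 0 s).integral_deriv_eq_sub
  rw [← h1, intervalIntegral.integral_of_le hs.1, intervalIntegral.integral_of_le hs.1,
    integral_Ioc_eq_integral_Ioo, integral_Ioc_eq_integral_Ioo]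
  exact setIntegral_congr_fun measurableSet_Ioo fun r hr => D1_pt F e ⟨hr.1, hr.2.trans_le hs.2⟩

/-- Differentiation on functions of finite energy is closed. -/
theorem exists_edgeAC_of_tendsto {φ : ℕ → G.Point → ℝ} (hac : ∀ n, EdgeAC (φ n))
    (hφ : ∀ n, MemLp (φ n) 2 G.vol) (hφ' : ∀ n, MemLp (D1 (φ n)) 2 G.vol) {f g : G.L2}
    (hf : Tendsto (fun n => (hφ n).toLp (φ n)) atTop (𝓝 f))
    (hg : Tendsto (fun n => (hφ' n).toLp (D1 (φ n))) atTop (𝓝 g)) :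
    ∃ F : G.Point → ℝ, f =ᵐ[G.vol] F ∧ EdgeAC F ∧ D1 F =ᵐ[G.vol] g := by
  -- A subsequence converges almost everywhere; by integrating the derivatives this is upgraded to
  -- convergence at every point of every edge.
  obtain ⟨ns, hns, hae⟩ := (tendstoInMeasure_of_tendsto_Lp hf).exists_seq_tendsto_ae
  have hae' : ∀ᵐ x ∂G.vol, Tendsto (fun i => φ (ns i) x) atTop (𝓝 (f x)) := by
    filter_upwards [hae, ae_all_iff.2 fun n => MemLp.coeFn_toLp (hφ n)] with x hx hx'
    simpa only [hx'] using hx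
  have hgm : Measurable g := (Lp.stronglyMeasurable g).measurable
  have hgi : ∀ e, IntervalIntegrable (fun r => g (G.pt e r)) volume 0 (G.len e) := fun e =>
    (intervalIntegrable_iff_integrableOn_Ioo_of_le (G.len_pos e).le).2
      (integrable_edge_of_memLp (Lp.memLp g) hgm e)
  have key : ∀ e, ∃ a, ∀ s ∈ Icc 0 (G.len e),
      Tendsto (fun i => φ (ns i) (G.pt e s)) atTop (𝓝 (a + ∫ r in 0..s, g (G.pt e r))) := by
    intro e
    have hJ : ∀ s ∈ Icc 0 (G.len e), Tendsto (fun i => φ (ns i) (G.pt e s) - φ (ns i) (G.pt e 0))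
        atTop (𝓝 (∫ r in 0..s, g (G.pt e r))) := by
      intro s hs
      have h1 := (tendsto_integral_edge hφ' (fun n => measurable_D1 _) hg e hs).comp
        hns.tendsto_atTop
      refine h1.congr fun i => ?_
      exact (hac (ns i)).integral_D1 e hs
    -- The increments along `e` converge, so convergence at one point `t` of the edge fixes the
    -- limit at coordinate 0 and hence everywhere on `e`.
    obtain ⟨t, ht, htc⟩ : ∃ t ∈ Ioo 0 (G.len e),
        Tendsto (fun i => φ (ns i) (G.pt e t)) atTop (𝓝 (f (G.pt e t))) := by
      by_contra! hcon
      have h0 : ∀ᵐ s : ℝ, s ∉ Ioo 0 (G.len e) := by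
        filter_upwards [ae_edge_of_ae_vol hae' e] with s hs hs'
        exact hcon s hs' (hs hs')
      have h1 := measure_eq_zero_iff_ae_notMem.2 h0
      rw [Real.volume_Ioo, ENNReal.ofReal_eq_zero] at h1
      linarith [G.len_pos e]
    have h0 := htc.sub (hJ t (Ioo_subset_Icc_self ht))
    simp only [sub_sub_cancel] at h0
    refine ⟨_, fun s hs => (h0.add (hJ s hs)).congr fun i => ?_⟩
    ring
  choose a ha using key
  -- Defining `F` as a pointwise limit on the graph makes its values at a vertex automatically the
  -- same for all incident edges.
  set F : G.Point → ℝ := fun x => limUnder atTop fun i => φ (ns i) x with hF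
  have hFeq : ∀ e, ∀ s ∈ Icc 0 (G.len e), F (G.pt e s) = a e + ∫ r in 0..s, g (G.pt e r) :=
    fun e s hs => (ha e s hs).limUnder_eq
  have hFac : EdgeAC F := fun e => by
    have h1 : AbsolutelyContinuousOnInterval (fun s => a e + ∫ r in 0..s, g (G.pt e r)) 0
        (G.len e) :=
      ((contDiff_const (c := a e)).contDiffOn.absolutelyContinuousOnInterval).add
        ((hgi e).absolutelyContinuousOnInterval_intervalIntegral left_mem_uIcc)
    refine ac_congr h1 fun s hs => hFeq e s ?_
    rwa [uIcc_of_le (G.len_pos e).le] at hs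
  refine ⟨F, ?_, hFac, ?_⟩
  · filter_upwards [hae'] with x hx
    exact hx.limUnder_eq.symm
  · refine ae_vol_of_edges (measurableSet_eq_fun (measurable_D1 F) hgm) fun e => ?_
    filter_upwards [(hgi e).ae_hasDerivAt_integral] with s hs hs'
    have h1 := (hs (by
      rw [uIcc_of_le (G.len_pos e).le]; exact Ioo_subset_Icc_self hs') 0 left_mem_uIcc).const_add
      (a e)
    rw [D1_pt F e hs', ← h1.deriv]
    refine Filter.EventuallyEq.deriv_eq ?_
    filter_upwards [Icc_mem_nhds hs'.1 hs'.2] with r hr using hFeq e r hr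

/-! ### The form of the operators given by constants -/

section Constants

variable [CompactSpace G.Bar] {N : ℕ} {𝓑 : G.BoundaryPartition N} {P : Set (Set G.Bar)}

/-- The form distance of two domain functions is the `L²` distance of their derivatives. A
representing sequence thus has convergent derivatives, closedness of differentiation identifies the
limit as the derivative of `f`, and the form values converge to its squared norm. -/
theorem exists_hasEnergy (hP : IsRefinement 𝓑 P) {b : Fin N → ℝ} {f : G.L2}
    (hf : f ∈ FormMethod.formDomain (operator 𝓑 P fun n _ => b n)) :
    ∃ q, HasEnergy f q ∧ FormMethod.IsFormValue (operator 𝓑 P fun n _ => b n) f f q := by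
  obtain ⟨u, hu⟩ := hf
  have hS := isNonnegSymmetric_operator_const hP b
  choose φ hφu hSφ using fun n => exists_function (u n)
  have hD1 : ∀ ψ : functionDomain 𝓑 P fun n _ => b n, MemLp (D1 (ψ : G.Point → ℝ)) 2 G.vol :=
    fun ψ => ψ.2.memLp_D1 (k := fun n _ => b n) hP fun n => isFiniteEnergyHarmonic_const (b n)
  set w : ℕ → G.L2 := fun n => (hD1 (φ n)).toLp _ with hw
  have hdist : ∀ m n, ⟪operator 𝓑 P (fun n _ => b n) (u m - u n),
      ((u m - u n : (operator 𝓑 P fun n _ => b n).domain) : G.L2)⟫_ℝ = dist (w m) (w n) ^ 2 := by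
    intro m n
    rw [LinearPMap.map_sub, hSφ, hSφ, Submodule.coe_sub, hφu, hφu, ← map_sub, ← map_sub,
      inner_negD2_const hP, integral_sq_eq_norm_toLp (hD1 _), dist_eq_norm, hw]
    congr 2
    rw [← MemLp.toLp_sub, MemLp.toLp_eq_toLp_iff]
    exact ae_of_all _ fun x => D1_sub (φ m).2.1.isRegular.diff (φ n).2.1.isRegular.diff x
  have hcauchy : CauchySeq w := by
    rw [cauchySeq_iff_tendsto_dist_atTop_0]
    have h1 := hu.2
    simp only [hdist] at h1
    simpa [Real.sqrt_sq dist_nonneg] using h1.sqrt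
  obtain ⟨g, hg⟩ := cauchySeq_tendsto_of_complete hcauchy
  have hconv := hu.1
  simp only [hφu, classMap_apply] at hconv
  obtain ⟨F, hfF, hFac, hFg⟩ := exists_edgeAC_of_tendsto (fun n => (φ n).2.1.isRegular.edgeAC)
    (fun n => (φ n).2.1.memLp) (fun n => hD1 (φ n)) hconv hg
  have hFL : MemLp (D1 F) 2 G.vol := (memLp_congr_ae hFg).2 (Lp.memLp g)
  have hgF : hFL.toLp (D1 F) = g := by
    rw [← Lp.toLp_coeFn g (Lp.memLp g), MemLp.toLp_eq_toLp_iff]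
    exact hFg
  refine ⟨‖g‖ ^ 2, ⟨F, hfF, ⟨hFac, hFL⟩, by rw [integral_sq_eq_norm_toLp hFL, hgF]⟩,
    FormMethod.isFormValue_of_tendsto hS hu hu ?_⟩
  refine (hg.norm.pow 2).congr fun n => ?_
  rw [hSφ, hφu, inner_negD2_const hP, integral_sq_eq_norm_toLp (hD1 _)]

end Constants

/-! ### The form of the operators given by Robin functions -/

section Robin

variable {N : ℕ} {𝓑 : G.BoundaryPartition N} {P : Set (Set G.Bar)}
  {k : Fin N → G.Bar → ℝ}

/-- If `k n` were constant near each of the finitely many parts of `E n`, the smallest of the radii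
would make it constant near `E n`. -/
theorem exists_nonconst (hP : IsRefinement 𝓑 P) {n : Fin N} {C : ℝ}
    (hk : G.IsRobinFunction (𝓑.E n) (k n) C) :
    ∃ A ∈ P, A ⊆ 𝓑.E n ∧ ∀ ρ > 0, ∃ x ∈ G.nbhd ρ A, k n x ≠ C := by
  by_contra! hcon
  have hev : ∀ A ∈ P, ∀ᶠ r in 𝓝[>] (0 : ℝ), A ⊆ 𝓑.E n → ∀ x ∈ G.nbhd r A, k n x = C := by
    intro A hA
    by_cases hAn : A ⊆ 𝓑.E n
    · obtain ⟨ρ, hρ, h⟩ := hcon A hA hAn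
      filter_upwards [mem_nhdsWithin_of_mem_nhds (Iic_mem_nhds hρ)] with r hr _ x hx
      exact h x (nbhd_mono hr _ hx)
    · exact Eventually.of_forall fun r h => absurd h hAn
  obtain ⟨r, h1, hr⟩ := (((eventually_all_finite hP.finite).2 hev).and self_mem_nhdsWithin).exists
  obtain ⟨x, hx, hne⟩ := hk.nonconst r hr
  obtain ⟨z, hz, hxz⟩ := Metric.mem_thickening_iff.1 hx
  have hzb : z ∈ ⋃₀ P := hP.cover ▸ (𝓑.clopen n).1 hz
  obtain ⟨A, hA, hzA⟩ := hzb
  have hAn : A ⊆ 𝓑.E n := by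
    rcases hP.sub A hA with h | ⟨m, h⟩
    · exact absurd hz (disjoint_left.1 (𝓑.disjoint_sets₀ n) (h hzA))
    · by_cases hmn : m = n
      · exact hmn ▸ h
      · exact absurd hz (disjoint_left.1 (𝓑.disjoint_sets hmn) (h hzA))
  exact hne (h1 A hA hAn x (Metric.mem_thickening_iff.2 ⟨z, hzA, hxz⟩))

variable [CompactSpace G.Bar]

theorem IsInDomain.hasEnergy (hP : IsRefinement 𝓑 P)
    (hk : ∀ n, G.IsFiniteEnergyHarmonic (k n)) (φ : functionDomain 𝓑 P fun n x => k n x) :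
    HasEnergy (classMap 𝓑 P _ φ) (∫ x, D1 (φ : G.Point → ℝ) x ^ 2 ∂G.vol) :=
  ⟨φ, MemLp.coeFn_toLp φ.2.1.memLp, ⟨φ.2.1.isRegular.edgeAC, φ.2.memLp_D1 hP hk⟩, rfl⟩

/-- A continuous function on the compact completion is bounded, and the product lives on a set of
finite volume. -/
theorem IsHarmonic.memLp_mul_cutoff {k : G.Bar → ℝ} (hk : G.IsHarmonic k) {A : Set G.Bar}
    {ε : ℝ} {χ : G.Point → ℝ} (hχ : IsCutoff A ε χ) (hvol : G.vol (G.nbhd ε A) < ⊤) :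
    MemLp ((fun x : G.Point => k x) * χ) 2 G.vol := by
  obtain ⟨M, hM⟩ := isCompact_univ.exists_bound_of_continuousOn hk.cont.continuousOn
  have hM0 : 0 ≤ max M 0 := le_max_right _ _
  -- The measurable hull has the same volume and spares the measurability of the neighbourhood.
  have h1 : MemLp ((toMeasurable G.vol (G.nbhd ε A)).indicator fun _ => max M 0) 2 G.vol :=
    memLp_indicator_const 2 (measurableSet_toMeasurable _ _) _
      (Or.inr (by rw [measure_toMeasurable]; exact hvol.ne))
  refine h1.of_le (hk.measurable_point.mul hχ.toIsFlat.edgeDiff.measurable).aestronglyMeasurable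
    (ae_of_all _ fun x => ?_)
  by_cases hx : χ x = 0
  · simp [hx]
  · rw [indicator_of_mem (subset_toMeasurable _ _ (hχ.supp x hx)), Pi.mul_apply, norm_mul,
      Real.norm_of_nonneg hM0, Real.norm_of_nonneg (hχ.nonneg x)]
    exact (mul_le_of_le_one_right (norm_nonneg _) (hχ.le_one x)).trans
      ((hM x (mem_univ _)).trans (le_max_left _ _))

open Classical in
/-- The product of a Robin function and a cutoff function is in the domain. -/
theorem isInDomain_mul_cutoff (hP : IsRefinement 𝓑 P) {n : Fin N} (hk : G.IsHarmonic (k n))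
    {A : Set G.Bar} (hA : A ∈ P) (hAn : A ⊆ 𝓑.E n) {ε : ℝ} (hε : ε ≤ 𝓑.δ) {χ : G.Point → ℝ}
    (hχ : IsCutoff A ε χ) :
    IsInDomain 𝓑 P (fun n x => k n x) ((fun x : G.Point => k n x) * χ) ∧
      ∃ ρ > 0, ∀ B ∈ P, ∀ x ∈ G.nbhd ρ B,
        k n x * χ x = (if B = A then 1 else 0) * localFun 𝓑 k B x := by
  have hmem := hk.memLp_mul_cutoff hχ ((measure_mono ((nbhd_mono hε A).trans
    fun x hx => nbhd_subset hAn hx)).trans_lt (𝓑.finite_vol n))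
  obtain ⟨ρ, hρ, hone, hzero⟩ := hχ.near
  have hsub : ∀ B ∈ P, B ≠ A → B ⊆ G.bdryBar \ A := fun B hB hne z hz =>
    ⟨(hP.clopen B hB).1 hz, disjoint_left.1 (hP.disjoint B hB A hA hne) hz⟩
  refine ⟨⟨hχ.toIsFlat.isDmax_mul hk hmem, min ρ (𝓑.δ / 2), lt_min hρ (half_pos 𝓑.δ_pos),
    (min_le_right _ _).trans_lt (half_lt_self 𝓑.δ_pos), fun x hx => ?_, fun m B hB hBm => ?_⟩,
    ρ, hρ, fun B hB x hx => ?_⟩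
  · have h0 : 𝓑.E₀ ⊆ G.bdryBar \ A := fun z hz =>
      ⟨𝓑.clopen₀.1 hz, fun hzA => disjoint_left.1 (𝓑.disjoint_sets₀ n) hz (hAn hzA)⟩
    rw [Pi.mul_apply, hzero x (nbhd_subset h0 (nbhd_mono (min_le_left _ _) _ hx)), mul_zero]
  · by_cases hBA : B = A
    · subst hBA
      have hmn : k m = k n := by
        rw [← localFun_eq (k := k) (hP.nonempty B hB) hBm, localFun_eq (hP.nonempty B hB) hAn]
      refine ⟨1, fun x hx => ?_⟩
      rw [Pi.mul_apply, hone x (nbhd_mono (min_le_left _ _) _ hx), mul_one, one_mul, ← hmn]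
    · refine ⟨0, fun x hx => ?_⟩
      rw [Pi.mul_apply, hzero x (nbhd_subset (hsub B hB hBA) (nbhd_mono (min_le_left _ _) _ hx)),
        mul_zero, zero_mul]
  · by_cases hBA : B = A
    · subst hBA
      rw [hone x hx, if_pos rfl, localFun_eq (hP.nonempty B hB) hAn, mul_one, one_mul]
    · rw [hzero x (nbhd_subset (hsub B hB hBA) hx), if_neg hBA, mul_zero, zero_mul]

/-- The witness is `k n` times a cutoff function at a part `A` near which `k n` is not constant. Its
coefficient is 1 at `A` and 0 at the other parts, so its form exceeds its energy by a single
positive excess. -/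
theorem exists_energy_lt (hP : IsRefinement 𝓑 P) {C : Fin N → ℝ}
    (hk : ∀ n, G.IsRobinFunction (𝓑.E n) (k n) (C n)) (n : Fin N) :
    ∃ φ : functionDomain 𝓑 P fun n x => k n x, ∫ x, D1 (φ : G.Point → ℝ) x ^ 2 ∂G.vol <
      ⟪negD2 𝓑 P _ φ, classMap 𝓑 P _ φ⟫_ℝ := by
  classical
  have := hP.finite.fintype
  have hfam := hP.isBdryFamily
  have hk' : ∀ n, G.IsFiniteEnergyHarmonic (k n) := fun n => (hk n).finite_energy
  obtain ⟨ε₁, hε₁, hge⟩ := exists_forall_ge hk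
  obtain ⟨A, hA, hAn, hnc⟩ := exists_nonconst hP (hk n)
  obtain ⟨χ, hχ⟩ := exists_isCutoff (hfam.closed ⟨A, hA⟩) (hfam.closed_diff ⟨A, hA⟩)
    (hfam.subset ⟨A, hA⟩) 𝓑.δ_pos
  obtain ⟨hdom, ρ, hρ, hcoeff⟩ := isInDomain_mul_cutoff hP (hk n).finite_energy.1 hA hAn le_rfl hχ
  -- A second family `ξ` of cutoff functions with smaller supports enters the form identity: within
  -- `ρ` of each part the witness is an exact multiple of the local harmonic function, and within
  -- `ε₁` the Robin functions are at least their boundary values.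
  have hε : 0 < min ρ ε₁ := lt_min hρ hε₁
  choose ξ hξ using fun B : P => exists_isCutoff (hfam.closed B) (hfam.closed_diff B)
    (hfam.subset B) (half_pos hε)
  have hc : ∀ B : P, ∀ x ∈ G.nbhd (min ρ ε₁) (B : Set G.Bar),
      ((fun x : G.Point => k n x) * χ) x =
        (if B = ⟨A, hA⟩ then 1 else 0) * localFun 𝓑 k B x := fun B x hx => by
    simpa only [Subtype.ext_iff, Pi.mul_apply] using hcoeff B B.2 x (nbhd_mono (min_le_left _ _) _ hx)
  have hform := integral_D2_mul_of_family hfam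
    (fun B : P => isFiniteEnergyHarmonic_localFun hk' B) hε hξ hdom.1.isRegular
    hdom.1.isRegular hc hc
  refine ⟨⟨_, hdom⟩, ?_⟩
  rw [inner_negD2, hform]
  simp only [mul_ite, mul_one, mul_zero, ite_mul, one_mul, zero_mul, Finset.sum_ite_eq',
    Finset.mem_univ, if_true]
  simp only [← sq]
  rw [localFun_eq (hP.nonempty A hA) hAn]
  refine lt_add_of_pos_right _ ((hξ ⟨A, hA⟩).excess_pos (ε₁ := ε₁) (hfam.closed ⟨A, hA⟩)
    (hk n).finite_energy (hk n).pos (fun z hz => (hk n).const z (hAn hz))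
    (fun x hx => hge n x (nbhd_subset hAn hx)) ?_ hnc)
  linarith [min_le_right ρ ε₁]

end Robin

end MetricGraph

end

/-! ### Comparison of the two Friedrichs extensions -/

theorem corollary4p5 {V E : Type*} (G : MetricGraph V E) [CompactSpace G.Bar]
    (htd : IsTotallyDisconnected G.bdryBar)
    {N : ℕ} (hN : 0 < N) (𝓑 : G.BoundaryPartition N)
    (P : ℕ → Set (Set G.Bar)) (hP : MetricGraph.IsPartitionSequence 𝓑 P) (j : ℕ)
    (k : Fin N → G.Bar → ℝ) (C : Fin N → ℝ) (hk : ∀ n, G.IsRobinFunction (𝓑.E n) (k n) (C n))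
    {N' : ℕ} (𝓑' : G.BoundaryPartition N')
    (P' : ℕ → Set (Set G.Bar)) (hP' : MetricGraph.IsPartitionSequence 𝓑' P') (j' : ℕ)
    (b : Fin N' → ℝ)
    (SK : G.L2 →ₗ.[ℝ] G.L2) (hSK : SK = MetricGraph.operator 𝓑 (P j) (fun n x => k n x))
    (SH : G.L2 →ₗ.[ℝ] G.L2) (hSH : SH = MetricGraph.operator 𝓑' (P' j') (fun n _ => b n)) :
    FormMethod.IsNonnegSymmetric SK ∧ FormMethod.IsNonnegSymmetric SH ∧
    -- the Friedrichs extensions are distinct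
    (∃ LK LH : G.L2 →ₗ.[ℝ] G.L2, FormMethod.IsFriedrichsExtension SK LK ∧
      FormMethod.IsFriedrichsExtension SH LH ∧ LK ≠ LH) ∧
    -- the quadratic forms tell them apart
    (∀ f ∈ FormMethod.formDomain SH, ∃ q, MetricGraph.HasEnergy f q ∧
      FormMethod.IsFormValue SH f f q) ∧
    (∃ f ∈ SK.domain, ∃ q a, MetricGraph.HasEnergy f q ∧ FormMethod.IsFormValue SK f f a ∧
      q < a ∧ ¬ FormMethod.IsFormValue SH f f a) := by
  have hR := hP.isRefinement j
  have hR' := hP'.isRefinement j'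
  have hSKn : FormMethod.IsNonnegSymmetric SK :=
    hSK ▸ MetricGraph.isNonnegSymmetric_operator_robin hR hk
  have hSHn : FormMethod.IsNonnegSymmetric SH :=
    hSH ▸ MetricGraph.isNonnegSymmetric_operator_const hR' b
  have hform : ∀ f ∈ FormMethod.formDomain SH, ∃ q, MetricGraph.HasEnergy f q ∧
      FormMethod.IsFormValue SH f f q := by
    subst hSH
    exact fun f hf => MetricGraph.exists_hasEnergy hR' hf
  obtain ⟨f, q, hq, hlt⟩ : ∃ f : SK.domain, ∃ q, MetricGraph.HasEnergy (f : G.L2) q ∧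
      q < ⟪SK f, (f : G.L2)⟫_ℝ := by
    subst hSK
    obtain ⟨φ, hφ⟩ := MetricGraph.exists_energy_lt hR hk ⟨0, hN⟩
    refine ⟨⟨_, LinearMap.mem_range_self _ φ⟩, _,
      MetricGraph.IsInDomain.hasEnergy hR (fun n => (hk n).finite_energy) φ, ?_⟩
    rwa [MetricGraph.operator_apply]
  -- A form value of `SH` at `f` must be the energy of `f`, and both the form value and the energy
  -- are unique, which contradicts the strict inequality.
  have hnot : ¬ FormMethod.IsFormValue SH (f : G.L2) f ⟪SK f, (f : G.L2)⟫_ℝ := by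
    intro h
    obtain ⟨q', hq', h'⟩ := hform f h.1
    rw [h.unique h', hq.unique hq'] at hlt
    exact lt_irrefl _ hlt
  refine ⟨hSKn, hSHn, ?_, hform, f, f.2, q, _, hq,
    FormMethod.isFormValue_of_mem_domain hSKn f (FormMethod.mem_formDomain f), hlt, hnot⟩
  obtain ⟨LK, hLK⟩ := FormMethod.exists_isFriedrichsExtension hSKn
  obtain ⟨LH, hLH⟩ := FormMethod.exists_isFriedrichsExtension hSHn
  refine ⟨LK, LH, hLK, hLH, ?_⟩
  -- With a common Friedrichs extension the form of `SH` would take the value ⟪SK f, f⟫ at `f`.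
  rintro rfl
  exact hnot (FormMethod.isFormValue_of_friedrichs_eq hSKn hLK hLH f)
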